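/- Let $g\ge 1$. **Sullivan diagrams.** Consider fat graphs with one white vertex, which has a marked start half-edge, with trivalent black vertices otherwise, with $m$ labelled leaves, each the only labelled leaf in its boundary cycle (so that it marks an incoming closed boundary component), and possibly an unlabelled leaf at the start of the white vertex. Exceptional components consisting of a single labelled leaf without vertex are allowed. The degree of a graph is the valence of its white vertex minus one. A Sullivan diagram is a class of such graphs under isomorphism and under replacing one of the two trivalent blow-ups of a black vertex of valence four by the other. Let $\mathcal{SD}_*(m,1)$ be the chain complex freely generated by Sullivan diagrams, where $d$ is the alternating sum over all pairs of consecutive half-edges at the white vertex, which are pulled out to a new trivalent black vertex (joining an unlabelled start leaf to a neighbour just removes that leaf). Let $\mu_g\in\mathcal{SD}_{2g+1}(g+1,1)$ be the diagram with $2g+2$ half-edges $1,\dots,2g+2$ at the white vertex, start $1$, where $1,3,\dots,2g+1$ are connected by a planar tree outside of the white vertex and $2,4,\dots,2g+2$ are leaves, labelled $1,\dots,g+1$ in order. Let $t_g\in\mathcal{SD}_{2g+1}(1,1)$ be obtained from $\mu_g$ by connecting $2,4,\dots,2g+2$ by a second such tree, with one additional leaf (its root), which carries the label. The surface of $\mu_g$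 is connected of genus $0$ with $g+1$ incoming boundary components and one outgoing one (the white vertex); that of $t_g$ is connected of genus $g$ with one incoming and one outgoing boundary component. **Action.** For $R=\mathbb{Z}$ or $\mathbb{Q}$ let $A=R[x]/(x^2)$, concentrated in degree $0$, be the commutative Frobenius algebra with $\nu(1)=1\otimes x+x\otimes 1$, $\nu(x)=x\otimes x$, let $C_*(A,A)$ be its reduced Hochschild complex, $C_p(A,A)=A\otimes(A/R)^{\otimes p}$, and $HH_*(A,A)$ its homology. Let $F$ denote the action of Sullivan diagrams on $C_*(A,A)$. For $a_1,\dots,a_m\in A=C_0(A,A)$, $F(G\otimes a_1\otimes\cdots\otimes a_m)$ is obtained by placing $a_j$ at the leaf $j$ of $G$, reading the graph without its white vertex as a composition of operations of the Frobenius algebra $A$ whose outputs are the half-edges at the white vertex, and placing the outputs, in order from the start half-edge, into the tensor factors of a Hochschild chain (with $1$ as the output of an unlabelled start leaf). Then: 1. For $R=\mathbb{Z}$, $F(t_g\otimes x)=1\otimes x\otimes\cdots\otimes x\in C_{2g+1}(A,A)$. 2. $F(t_g\otimes -)$ induces a well-defined nonzero map $HH_0(A,A)\to HH_{2g+1}(A,A)$,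 for $R=\mathbb{Z}$ and for $R=\mathbb{Q}$. 3. $F(\mu_g\otimes -)$ induces a well-defined nonzero map $HH_0(A,A)^{\otimes (g+1)}\to HH_{2g+1}(A,A)$, for $R=\mathbb{Z}$ and for $R=\mathbb{Q}$. 4. $t_g$ and $\mu_g$ are cycles, and their classes in $H_{2g+1}(\mathcal{SD}_*(1,1))$ and $H_{2g+1}(\mathcal{SD}_*(g+1,1))$ are nonzero, with integral and with rational coefficients. 5. For every $N\ge 2$, the corresponding operations of $t_g$ and $\mu_g$ for the graded algebra $H^*(S^N;\mathbb{Q})=\mathbb{Q}[x]/(x^2)$, $|x|=N$, induce nonzero maps $HH_0\to HH_{2g+1}$ and $HH_0^{\otimes(g+1)}\to HH_{2g+1}$ on $HH_*(H^*(S^N;\mathbb{Q}),H^*(S^N;\mathbb{Q}))$ (the subscript is the Hochschild degree). This holds for every choice of the signs with which the summands of the composition of operations, expanded in the basis $1,x$, are counted. Via $HH_{-*}(H^*(S^N;\mathbb{Q}),H^*(S^N;\mathbb{Q}))\cong H^*(LS^N;\mathbb{Q})$ these are the resulting higher string topology operations. -/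

import Mathlib

open scoped TensorProduct

noncomputable section

namespace Sullivan

/-! ### Black and white graphs with one white vertex -/

/-- The half-edges of a graph with one white vertex, `k` half-edges at the white vertex and a set
`V` of trivalent black vertices. The half-edges at the white vertex are `0, …, k - 1` in their
cyclic order; the half-edges at the black vertex `v` are `(v, 0), (v, 1), (v, 2)` in their cyclic
order. -/
abbrev HalfEdge (k : ℕ) (V : Type) := Fin k ⊕ V × Fin 3

/-- The fat structure: the next half-edge in the cyclic order at the same vertex. -/
def nextPerm (k : ℕ) (V : Type) : Equiv.Perm (HalfEdge k V) :=
  Equiv.sumCongr (finRotate k) (Equiv.prodCongr (Equiv.refl V) (finRotate 3))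

/-- Black and white fat graphs with one white vertex, all of whose black vertices are trivalent,
with leaves labelled by `Fin m`. Here `k` counts the half-edges at the white vertex other than an
unlabelled start leaf (see `Gen`).
Two half-edges `h ≠ inv h` form an edge; the fixed points of `inv` are the leaves, each of which
carries exactly one label. A label `j` with `leaf j = none` sits on an exceptional component: a
single leaf without a vertex (a disc, with the leaf `j` on its boundary). -/
structure BWGraph (m k : ℕ) where
  V : Type
  [fin : Fintype V]
  [dec : DecidableEq V]
  inv : HalfEdge k V → HalfEdge k V
  inv_inv : Function.Involutive inv
  leaf : Fin m → Option (HalfEdge k V)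
  leaf_inj : ∀ i j h, leaf i = some h → leaf j = some h → i = j
  inv_eq_self_iff : ∀ h, inv h = h ↔ ∃ j, leaf j = some h

attribute [instance] BWGraph.fin BWGraph.dec

variable {m k : ℕ}

theorem BWGraph.ext_inv {V : Type} [Fintype V] [DecidableEq V]
    {i₁ i₂ : HalfEdge k V → HalfEdge k V} {l₁ l₂ : Fin m → Option (HalfEdge k V)}
    (a₁ : Function.Involutive i₁) (a₂ : Function.Involutive i₂)
    (b₁ : ∀ i j h, l₁ i = some h → l₁ j = some h → i = j)
    (b₂ : ∀ i j h, l₂ i = some h → l₂ j = some h → i = j)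
    (c₁ : ∀ h, i₁ h = h ↔ ∃ j, l₁ j = some h) (c₂ : ∀ h, i₂ h = h ↔ ∃ j, l₂ j = some h)
    (hi : i₁ = i₂) (hl : l₁ = l₂) :
    BWGraph.mk V i₁ a₁ l₁ b₁ c₁ = BWGraph.mk V i₂ a₂ l₂ b₂ c₂ := by
  subst hi; subst hl; rfl

/-- Rename the half-edges of a graph along a bijection onto another set of half-edges. -/
abbrev BWGraph.relabel {k' : ℕ} (G : BWGraph m k) (W : Type) [Fintype W] [DecidableEq W]
    (e : HalfEdge k G.V ≃ HalfEdge k' W) : BWGraph m k' where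
  V := W
  inv h := e (G.inv (e.symm h))
  inv_inv h := by simp [G.inv_inv (e.symm h)]
  leaf j := (G.leaf j).map e
  leaf_inj i j h hi hj := by
    obtain ⟨a, ha, rfl⟩ := Option.map_eq_some_iff.1 hi
    obtain ⟨b, hb, hab⟩ := Option.map_eq_some_iff.1 hj
    obtain rfl := e.injective hab
    exact G.leaf_inj _ _ _ ha hb
  inv_eq_self_iff h := by
    rw [← e.eq_symm_apply, G.inv_eq_self_iff]
    refine exists_congr fun j => ?_
    rw [Option.map_eq_some_iff]
    constructor
    · intro hj
      exact ⟨_, hj, by simp⟩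
    · rintro ⟨a, ha, rfl⟩
      simpa using ha

/-- Add a new edge: the old half-edges together with the two halves `false`, `true` of the new edge
are placed among the half-edges of a new graph by the bijection `e`. -/
abbrev BWGraph.addEdge {k' : ℕ} (G : BWGraph m k) (W : Type) [Fintype W] [DecidableEq W]
    (e : HalfEdge k G.V ⊕ Bool ≃ HalfEdge k' W) : BWGraph m k' where
  V := W
  inv h := e (Sum.map G.inv not (e.symm h))
  inv_inv h := by
    have : ∀ x : HalfEdge k G.V ⊕ Bool, Sum.map G.inv not (Sum.map G.inv not x) = x := by
      rintro (x | x)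
      · simp [G.inv_inv x]
      · simp
    simp [this]
  leaf j := (G.leaf j).map fun h => e (Sum.inl h)
  leaf_inj i j h hi hj := by
    obtain ⟨a, ha, rfl⟩ := Option.map_eq_some_iff.1 hi
    obtain ⟨b, hb, hab⟩ := Option.map_eq_some_iff.1 hj
    obtain rfl := Sum.inl_injective (e.injective hab)
    exact G.leaf_inj _ _ _ ha hb
  inv_eq_self_iff h := by
    rw [← e.eq_symm_apply]
    obtain ⟨x, rfl⟩ := e.surjective h
    rw [e.symm_apply_apply]
    rcases x with x | x
    · simp only [Sum.map_inl, Sum.inl.injEq, G.inv_eq_self_iff, Option.map_eq_some_iff,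
        EmbeddingLike.apply_eq_iff_eq, exists_eq_right]
    · simp [Option.map_eq_some_iff]

/-! ### Sullivan diagrams -/

/-- Let `u ≠ v` be black vertices joined by an edge with halves `(u, 0)` and `(v, 0)`. Collapsing
the edge gives a black vertex of valence four with cyclic order `(u, 1), (u, 2), (v, 1), (v, 2)`.
The other way of blowing it up has the half-edges `(u, 0), (u, 2), (v, 1)` at one vertex and
`(v, 0), (v, 2), (u, 1)` at the other. This permutation puts these half-edges in the
positions `0, 1, 2` at the vertices `u` and `v`. -/
def flipPerm (k : ℕ) {V : Type} [DecidableEq V] (u v : V) : Equiv.Perm (HalfEdge k V) :=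
  Equiv.sumCongr (Equiv.refl (Fin k))
    (Equiv.swap (u, 1) (v, 2) * Equiv.swap (v, 2) (v, 1) * Equiv.swap (v, 1) (u, 2))

/-- The relations among graphs: isomorphism of fat graphs (fixing the half-edges at the white
vertex), and replacing one of the two blow-ups of a black vertex of valence four by the other. -/
inductive Move : BWGraph m k → BWGraph m k → Prop
  | iso (G : BWGraph m k) (W : Type) [Fintype W] [DecidableEq W] (e : G.V × Fin 3 ≃ W × Fin 3)
      (he : ∀ v t, e (v, t + 1) = ((e (v, t)).1, (e (v, t)).2 + 1)) :
      Move G (G.relabel W (Equiv.sumCongr (Equiv.refl (Fin k)) e))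
  | flip (G : BWGraph m k) (u v : G.V) (huv : u ≠ v)
      (h : G.inv (Sum.inr (u, 0)) = Sum.inr (v, 0)) :
      Move G (G.relabel G.V (flipPerm k u v))

/-- Equivalence classes of graphs under the equivalence relation generated by `Move`. -/
def Diagram (m k : ℕ) : Type 1 := Quot (Move (m := m) (k := k))

/-- Rotate the enumeration of the half-edges at the white vertex: the last becomes the first. -/
abbrev BWGraph.rotate (G : BWGraph m k) : BWGraph m k :=
  G.relabel G.V (Equiv.sumCongr (finRotate k) (Equiv.refl _))

/-- The bookkeeping for `BWGraph.merge`: the half-edges `i` and `i + 1` at the white vertex go to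
the positions `1` and `2` of a new black vertex `none`; the new edge joins position `0` of
`none` to the white vertex, at the place `i`. -/
def mergeEquiv {V : Type} (i : Fin k) :
    HalfEdge (k + 1) V ⊕ Bool ≃ HalfEdge k (Option V) where
  toFun
    | Sum.inl (Sum.inl j) =>
      match finSuccEquiv' i.castSucc j with
      | none => Sum.inr (none, 1)
      | some j' => if j' = i then Sum.inr (none, 2) else Sum.inl j'
    | Sum.inl (Sum.inr (v, t)) => Sum.inr (some v, t)
    | Sum.inr false => Sum.inl i
    | Sum.inr true => Sum.inr (none, 0)
  invFun
    | Sum.inl j => if j = i then Sum.inr false else Sum.inl (Sum.inl (i.castSucc.succAbove j))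
    | Sum.inr (some v, t) => Sum.inl (Sum.inr (v, t))
    | Sum.inr (none, t) =>
      if t = 0 then Sum.inr true
      else if t = 1 then Sum.inl (Sum.inl i.castSucc) else Sum.inl (Sum.inl i.succ)
  left_inv := by
    rintro ((j | ⟨v, t⟩) | (_ | _))
    · rcases hj : finSuccEquiv' i.castSucc j with _ | j'
      · rw [finSuccEquiv'_eq_none] at hj
        simp [← hj]
      · rw [finSuccEquiv'_eq_some] at hj
        subst hj
        by_cases h : j' = i
        · subst h
          have h2 : finSuccEquiv' j'.castSucc j'.succ = some j' := by
            rw [finSuccEquiv'_eq_some]; simp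
          simp [h2]
        · simp [h]
    · rfl
    · simp
    · simp
  right_inv := by
    rintro (j | ⟨_ | v, t⟩)
    · by_cases h : j = i <;> simp [h]
    · have h2 : finSuccEquiv' i.castSucc i.succ = some i := by
        rw [finSuccEquiv'_eq_some]; simp
      fin_cases t
      · simp
      · simp
      · simp [h2]
    · rfl

/-- The blow-up of the white vertex that pulls the half-edges `i` and `i + 1` out to a new
trivalent black vertex. -/
abbrev BWGraph.merge (G : BWGraph m (k + 1)) (i : Fin k) : BWGraph m k :=
  G.addEdge (Option G.V) (mergeEquiv i)

theorem BWGraph.relabel_relabel {k' k'' : ℕ} (G : BWGraph m k) (W : Type) [Fintype W]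
    [DecidableEq W] (W' : Type) [Fintype W'] [DecidableEq W']
    (e : HalfEdge k G.V ≃ HalfEdge k' W) (e' : HalfEdge k' W ≃ HalfEdge k'' W') :
    (G.relabel W e).relabel W' e' = G.relabel W' (e.trans e') := by
  refine BWGraph.ext_inv _ _ _ _ _ _ ?_ ?_
  · funext h; simp
  · funext j; simp [Function.comp_def]

theorem BWGraph.relabel_addEdge {k' k'' : ℕ} (G : BWGraph m k) (W : Type) [Fintype W]
    [DecidableEq W] (W' : Type) [Fintype W'] [DecidableEq W']
    (e : HalfEdge k G.V ⊕ Bool ≃ HalfEdge k' W) (e' : HalfEdge k' W ≃ HalfEdge k'' W') :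
    (G.addEdge W e).relabel W' e' = G.addEdge W' (e.trans e') := by
  refine BWGraph.ext_inv _ _ _ _ _ _ ?_ ?_
  · funext h; simp
  · funext j; simp [Function.comp_def]

theorem BWGraph.addEdge_relabel {k' k'' : ℕ} (G : BWGraph m k) (W : Type) [Fintype W]
    [DecidableEq W] (W' : Type) [Fintype W'] [DecidableEq W']
    (e : HalfEdge k G.V ≃ HalfEdge k' W) (e' : HalfEdge k' W ⊕ Bool ≃ HalfEdge k'' W') :
    (G.relabel W e).addEdge W' e' =
      G.addEdge W' ((Equiv.sumCongr e (Equiv.refl Bool)).trans e') := by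
  refine BWGraph.ext_inv _ _ _ _ _ _ ?_ ?_
  · funext h
    obtain ⟨x, rfl⟩ := e'.surjective h
    rcases x with x | x <;> simp
  · funext j; simp [Function.comp_def]

/-- Extend a bijection between half-edges at black vertices by the identity on one more vertex. -/
def extendEquiv {V W : Type} (e : V × Fin 3 ≃ W × Fin 3) : Option V × Fin 3 ≃ Option W × Fin 3 where
  toFun
    | (none, t) => (none, t)
    | (some v, t) => (some (e (v, t)).1, (e (v, t)).2)
  invFun
    | (none, t) => (none, t)
    | (some v, t) => (some (e.symm (v, t)).1, (e.symm (v, t)).2)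
  left_inv := by rintro ⟨_ | v, t⟩ <;> simp
  right_inv := by rintro ⟨_ | v, t⟩ <;> simp

theorem mergeEquiv_comm {V W : Type} (i : Fin k) (e : V × Fin 3 ≃ W × Fin 3) :
    (Equiv.sumCongr (Equiv.sumCongr (Equiv.refl (Fin (k + 1))) e) (Equiv.refl Bool)).trans
        (mergeEquiv i) =
      (mergeEquiv i).trans (Equiv.sumCongr (Equiv.refl (Fin k)) (extendEquiv e)) := by
  ext1 x
  rcases x with ((j | ⟨v, t⟩) | (_ | _))
  · rcases hj : finSuccEquiv' i.castSucc j with _ | j'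
    · simp [mergeEquiv, hj, extendEquiv]
    · by_cases h : j' = i <;> simp [mergeEquiv, hj, h, extendEquiv]
  · rfl
  · rfl
  · rfl

theorem Move.rotate {G G' : BWGraph m k} (h : Move G G') : Move G.rotate G'.rotate := by
  cases h with
  | iso W e he =>
    have := Move.iso G.rotate W e he
    convert this using 1
    refine (BWGraph.relabel_relabel ..).trans (Eq.trans ?_ (BWGraph.relabel_relabel ..).symm)
    congr 1
    ext1 x; rcases x with x | x <;> rfl
  | flip u v huv h =>
    have := Move.flip G.rotate u v huv (by
      change Equiv.sumCongr _ _ (G.inv _) = _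
      rw [show (Equiv.sumCongr (finRotate k) (Equiv.refl (G.V × Fin 3))).symm (Sum.inr (u, 0))
        = Sum.inr (u, 0) from rfl, h]
      rfl)
    convert this using 1
    refine (BWGraph.relabel_relabel ..).trans (Eq.trans ?_ (BWGraph.relabel_relabel ..).symm)
    congr 1
    ext1 x; rcases x with x | x <;> rfl

theorem extendEquiv_swap {V : Type} [DecidableEq V] (a b : V × Fin 3) :
    extendEquiv (Equiv.swap a b) = Equiv.swap (some a.1, a.2) (some b.1, b.2) := by
  ext1 x
  rcases x with ⟨_ | v, t⟩
  · rw [Equiv.swap_apply_of_ne_of_ne (by simp) (by simp)]; rfl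
  · change (some (Equiv.swap a b (v, t)).1, (Equiv.swap a b (v, t)).2) = _
    simp only [Equiv.swap_apply_def, Prod.ext_iff, Option.some.injEq]
    split_ifs <;> simp_all

theorem extendEquiv_mul {V : Type} (e f : Equiv.Perm (V × Fin 3)) :
    extendEquiv (e * f) = extendEquiv e * extendEquiv f := by
  ext1 x
  rcases x with ⟨_ | v, t⟩ <;> rfl

theorem Move.merge {G G' : BWGraph m (k + 1)} (h : Move G G') (i : Fin k) :
    Move (G.merge i) (G'.merge i) := by
  cases h with
  | iso W e he =>
    have := Move.iso (G.merge i) (Option W) (extendEquiv e) (by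
      rintro (_ | v) t
      · rfl
      · simp [extendEquiv, he])
    convert this using 1
    refine (BWGraph.addEdge_relabel ..).trans (Eq.trans ?_ (BWGraph.relabel_addEdge ..).symm)
    rw [mergeEquiv_comm]
  | flip u v huv h =>
    have := Move.flip (G.merge i) (some u) (some v) (by simpa using huv) (by
      change mergeEquiv i (Sum.map G.inv not ((mergeEquiv i).symm _)) = _
      rw [show (mergeEquiv i).symm (Sum.inr (some u, 0)) = Sum.inl (Sum.inr (u, 0)) from rfl]
      simp only [Sum.map_inl, h]
      rfl)
    convert this using 1
    refine (BWGraph.addEdge_relabel ..).trans (Eq.trans ?_ (BWGraph.relabel_addEdge ..).symm)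
    rw [flipPerm, mergeEquiv_comm, flipPerm]
    simp only [extendEquiv_mul, extendEquiv_swap]

/-- The rotation of the white vertex on diagrams. -/
def Diagram.rotate : Diagram m k → Diagram m k :=
  Quot.map BWGraph.rotate fun _ _ h => h.rotate

/-- The blow-up of the white vertex on diagrams. -/
def Diagram.merge (i : Fin k) : Diagram m (k + 1) → Diagram m k :=
  Quot.map (fun G => G.merge i) fun _ _ h => h.merge i

/-- The boundary cycles of the fat graph are the orbits of this permutation. -/
def BWGraph.boundaryPerm (G : BWGraph m k) : Equiv.Perm (HalfEdge k G.V) :=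
  nextPerm k G.V * G.inv_inv.toPerm

/-- Every labelled leaf is the only labelled leaf in its boundary cycle, so that the leaves mark
`m` different incoming closed boundary components. -/
def BWGraph.IsClosed (G : BWGraph m k) : Prop :=
  ∀ i j h h', G.leaf i = some h → G.leaf j = some h' → G.boundaryPerm.SameCycle h h' → i = j

/-- The generators in degree `p`: the white vertex has valence `p + 1`, and its start half-edge is
either the half-edge `0` of a diagram with `p + 1` half-edges at the white vertex (`Sum.inl`), or
an additional unlabelled leaf, which comes before the `p` half-edges of a diagram (`Sum.inr`). -/
abbrev Gen (m p : ℕ) : Type 1 := Diagram m (p + 1) ⊕ Diagram m p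

/-- The boundary of a generator: the alternating sum over all pairs of half-edges that follow each
other in the cyclic order at the white vertex, which are pulled out to a trivalent black vertex.
Pairing the unlabelled start leaf with a neighbour removes this leaf and makes the
neighbour the start half-edge. -/
def boundaryGen (R : Type*) [CommRing R] {m : ℕ} (p : ℕ) : Gen m (p + 1) → (Gen m p →₀ R)
  | Sum.inl D =>
    ∑ i : Fin (p + 1), Finsupp.single (Sum.inl (D.merge i)) ((-1) ^ (i : ℕ))
      + Finsupp.single (Sum.inl (D.rotate.merge 0)) ((-1) ^ (p + 1))
  | Sum.inr D =>
    Finsupp.single (Sum.inl D) 1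
      + ∑ i : Fin p, Finsupp.single (Sum.inr (D.merge i)) ((-1) ^ ((i : ℕ) + 1))
      + Finsupp.single (Sum.inl D.rotate) ((-1) ^ (p + 1))

/-- The differential on linear combinations of diagrams with one white vertex. -/
def boundary (R : Type*) [CommRing R] {m : ℕ} : ∀ p : ℕ, (Gen m p →₀ R) →ₗ[R] (Gen m (p - 1) →₀ R)
  | 0 => 0
  | p + 1 => Finsupp.linearCombination R (boundaryGen R p)

/-- The generators all of whose labelled leaves mark incoming closed boundary components. -/
def closedGen (m p : ℕ) : Set (Gen m p) :=
  {γ | (∃ G : BWGraph m (p + 1), G.IsClosed ∧ γ = Sum.inl (Quot.mk _ G)) ∨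
    ∃ G : BWGraph m p, G.IsClosed ∧ γ = Sum.inr (Quot.mk _ G)}

/-- The degree `p` part of the complex of Sullivan diagrams with `m` incoming closed boundary
components and one outgoing closed boundary component (the white vertex). -/
def SD (R : Type*) [CommRing R] (m p : ℕ) : Submodule R (Gen m p →₀ R) :=
  Submodule.span R ((fun γ => Finsupp.single γ 1) '' closedGen m p)

/-- The cycles of the complex of Sullivan diagrams. -/
def SD.cycles (R : Type*) [CommRing R] (m p : ℕ) : Submodule R (Gen m p →₀ R) :=
  SD R m p ⊓ LinearMap.ker (boundary R p)

/-- The boundaries of the complex of Sullivan diagrams. -/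
def SD.boundaries (R : Type*) [CommRing R] (m p : ℕ) : Submodule R (Gen m p →₀ R) :=
  (SD R m (p + 1)).map (boundary R (p + 1))

/-- The chain `c` is a cycle of the complex of Sullivan diagrams, and its homology class is not
zero. -/
def SD.IsNonzeroClass {R : Type*} [CommRing R] {m p : ℕ} (c : Gen m p →₀ R) : Prop :=
  c ∈ SD.cycles R m p ∧ c ∉ SD.boundaries R m p

/-! ### The reduced Hochschild complex -/

/-- The tensor power `A ⊗ A ⊗ … ⊗ A` with `p + 1` factors. -/
abbrev TPow (R A : Type*) [CommRing R] [CommRing A] [Algebra R A] (p : ℕ) :=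
  ⨂[R] _ : Fin (p + 1), A

section Hochschild

variable (R A : Type*) [CommRing R] [CommRing A] [Algebra R A]

variable {A} in
/-- Multiply the entries `i` and `i + 1`. -/
def contractFun {p : ℕ} (i : Fin (p + 1)) (a : Fin (p + 2) → A) : Fin (p + 1) → A := fun j =>
  if j = i then a i.castSucc * a i.succ else a (i.castSucc.succAbove j)

variable {A} in
theorem contractFun_update {p : ℕ} (i : Fin (p + 1)) (a : Fin (p + 2) → A) (l : Fin (p + 2)) :
    ∃ (j : Fin (p + 1)) (f : A →ₗ[R] A),
      ∀ v, contractFun i (Function.update a l v) =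
        Function.update (contractFun i a) j (f v) := by
  by_cases h1 : l = i.castSucc
  · subst h1
    refine ⟨i, LinearMap.mulRight R (a i.succ), fun v => ?_⟩
    funext j
    by_cases hj : j = i
    · subst hj; simp [contractFun, Fin.castSucc_lt_succ.ne']
    · simp [contractFun, hj, Fin.succAbove_ne]
  · obtain ⟨j', rfl⟩ := Fin.exists_succAbove_eq h1
    by_cases h2 : j' = i
    · subst h2
      refine ⟨j', LinearMap.mulLeft R (a j'.castSucc), fun v => ?_⟩
      funext j
      by_cases hj : j = j'
      · subst hj; simp [contractFun, Fin.castSucc_lt_succ.ne]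
      · simp only [contractFun, hj, if_false, ne_eq, not_false_eq_true, Function.update_of_ne]
        rw [Function.update_of_ne]
        exact fun h => hj (Fin.succAbove_right_injective h)
    · refine ⟨j', LinearMap.id, fun v => ?_⟩
      funext j
      by_cases hj : j = i
      · subst hj
        have e2 : j.succ ≠ j.castSucc.succAbove j' := by
          intro h
          rw [← Fin.succAbove_castSucc_self] at h
          exact h2 (Fin.succAbove_right_injective h).symm
        simp [contractFun, Function.update_of_ne e2,
          Function.update_of_ne (Ne.symm h2)]
      · by_cases hj' : j = j'
        · subst hj'; simp [contractFun, hj]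
        · simp only [contractFun, hj, if_false, ne_eq, hj', not_false_eq_true,
            Function.update_of_ne]
          rw [Function.update_of_ne]
          exact fun h => hj' (Fin.succAbove_right_injective h)

/-- `a₀ ⊗ … ⊗ a_{p+1} ↦ a₀ ⊗ … ⊗ aᵢaᵢ₊₁ ⊗ … ⊗ a_{p+1}`. -/
def contract {p : ℕ} (i : Fin (p + 1)) : TPow R A (p + 1) →ₗ[R] TPow R A p :=
  PiTensorProduct.lift
    { toFun := fun a => PiTensorProduct.tprod R (contractFun i a)
      map_update_add' := by
        intro _ a l v w
        obtain rfl : ‹DecidableEq (Fin (p + 2))› = instDecidableEqFin _ := Subsingleton.elim _ _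
        obtain ⟨j, f, hf⟩ := contractFun_update R i a l
        simp only [hf, map_add, MultilinearMap.map_update_add]
      map_update_smul' := by
        intro _ a l c v
        obtain rfl : ‹DecidableEq (Fin (p + 2))› = instDecidableEqFin _ := Subsingleton.elim _ _
        obtain ⟨j, f, hf⟩ := contractFun_update R i a l
        simp only [hf, map_smul, MultilinearMap.map_update_smul] }

theorem contract_tprod {p : ℕ} (i : Fin (p + 1)) (a : Fin (p + 2) → A) :
    contract R A i (PiTensorProduct.tprod R a) = PiTensorProduct.tprod R (contractFun i a) := by
  simp [contract]

/-- The span of the tensors with a unit at a position other than the first. -/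
def degenerate (p : ℕ) : Submodule R (TPow R A p) :=
  Submodule.span R {t | ∃ a : Fin (p + 1) → A, ∃ i, i ≠ 0 ∧ a i = 1 ∧
    t = PiTensorProduct.tprod R a}

/-- The reduced Hochschild chains `A ⊗ (A/R)^{⊗p}`. -/
abbrev RedChain (p : ℕ) := TPow R A p ⧸ degenerate R A p

/-- The class of `a₀ ⊗ … ⊗ a_p` in the reduced Hochschild chains. -/
def RedChain.of {p : ℕ} (a : Fin (p + 1) → A) : RedChain R A p :=
  (degenerate R A p).mkQ (PiTensorProduct.tprod R a)

/-- A cyclic rotation of the tensor factors, which moves the last one to the front, possibly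
with signs as in a graded algebra. -/
structure Rotation where
  map : ∀ p, TPow R A p →ₗ[R] TPow R A p
  map_last : ∀ p (a : Fin (p + 1) → A), a (Fin.last p) = 1 →
    map p (PiTensorProduct.tprod R a) =
      PiTensorProduct.tprod R fun j => a ((finRotate (p + 1)).symm j)
  map_mem : ∀ p (a : Fin (p + 1) → A) (i : Fin p), a i.castSucc = 1 →
    map p (PiTensorProduct.tprod R a) ∈
      Submodule.span R {t | ∃ b : Fin (p + 1) → A, b i.succ = 1 ∧ t = PiTensorProduct.tprod R b}

theorem finRotate_symm_succ {p : ℕ} (i : Fin p) :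
    (finRotate (p + 1)).symm i.succ = i.castSucc := by
  rw [Equiv.symm_apply_eq]; simp

theorem finRotate_symm_zero {p : ℕ} : (finRotate (p + 1)).symm 0 = Fin.last p := by
  rw [Equiv.symm_apply_eq]; simp

/-- The rotation without signs: `a₀ ⊗ … ⊗ a_p ↦ a_p ⊗ a₀ ⊗ … ⊗ a_{p-1}`. -/
def plainRotation : Rotation R A where
  map p := (PiTensorProduct.reindex R (fun _ => A) (finRotate (p + 1))).toLinearMap
  map_last p a _ := by simp
  map_mem p a i h := by
    refine Submodule.subset_span ⟨fun j => a ((finRotate (p + 1)).symm j), ?_, by simp⟩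
    change a ((finRotate (p + 1)).symm i.succ) = 1
    rw [finRotate_symm_succ, h]

variable {R A} (ρ : Rotation R A)

/-- The Hochschild differential on `A^{⊗(p+2)}`. -/
def hochPre (p : ℕ) : TPow R A (p + 1) →ₗ[R] TPow R A p :=
  ∑ i : Fin (p + 1), (-1 : R) ^ (i : ℕ) • contract R A i
    + (-1 : R) ^ (p + 1) • contract R A 0 ∘ₗ ρ.map (p + 1)

theorem hochPre_degenerate (p : ℕ) :
    degenerate R A (p + 1) ≤ (degenerate R A p).comap (hochPre ρ p) := by
  classical
  rw [degenerate, Submodule.span_le]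
  rintro _ ⟨a, i, hi, ha, rfl⟩
  simp only [Submodule.comap_coe, Set.mem_preimage, SetLike.mem_coe, hochPre, LinearMap.add_apply,
    LinearMap.sum_apply, LinearMap.smul_apply, contract_tprod, LinearMap.comp_apply]
  obtain ⟨i', rfl⟩ := Fin.exists_succ_eq.2 hi
  -- the faces that do not involve the unit are degenerate
  have key : ∀ l : Fin (p + 1), l ≠ i' → l.castSucc ≠ i'.succ →
      PiTensorProduct.tprod R (contractFun l a) ∈ degenerate R A p := by
    intro l h1 h2
    obtain ⟨j, hj⟩ := Fin.exists_succAbove_eq h2.symm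
    have hjl : j ≠ l := by
      rintro rfl
      rw [Fin.succAbove_castSucc_self] at hj
      exact h1 (Fin.succ_injective _ hj)
    refine Submodule.subset_span ⟨_, j, ?_, ?_, rfl⟩
    · rintro rfl
      by_cases hl : l = 0
      · exact hjl hl.symm
      · rw [Fin.succAbove_of_castSucc_lt _ _
          (Fin.castSucc_lt_castSucc_iff.2 (Fin.pos_of_ne_zero hl))] at hj
        exact (Fin.succ_ne_zero _ hj.symm).elim
    · simp [contractFun, hjl, hj, ha]
  rcases Fin.eq_castSucc_or_eq_last i'.succ with ⟨i'', hi''⟩ | hlast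
  · -- the unit is not at the last position
    have hne : i' ≠ i'' := by
      rintro rfl
      exact Fin.castSucc_lt_succ.ne' hi''
    have hval : (i'' : ℕ) = i' + 1 := by
      simpa using (congrArg Fin.val hi'').symm
    have heq : contractFun i' a = contractFun i'' a := by
      funext j
      simp only [contractFun, ha, ← hi'', one_mul, mul_one]
      rcases lt_trichotomy (j : ℕ) (i' : ℕ) with h | h | h
      · have e1 : j ≠ i' := fun e => by omega
        have e2 : j ≠ i'' := fun e => by subst e; omega
        rw [if_neg e1, if_neg e2, Fin.succAbove_of_castSucc_lt _ _ (Fin.lt_def.2 (by simpa using h)),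
          Fin.succAbove_of_castSucc_lt _ _ (Fin.lt_def.2 (by simp; omega))]
      · have e1 : j = i' := Fin.ext h
        subst e1
        rw [if_pos rfl, if_neg hne, Fin.succAbove_of_castSucc_lt _ _ (Fin.lt_def.2 (by simp))]
      · have e1 : j ≠ i' := fun e => by subst e; omega
        rw [if_neg e1, Fin.succAbove_of_le_castSucc _ _ (Fin.le_def.2 (by simpa using h.le))]
        by_cases e2 : j = i''
        · rw [if_pos e2, e2]
        · have : (j : ℕ) ≠ i'' := fun e => e2 (Fin.ext e)
          rw [if_neg e2, Fin.succAbove_of_le_castSucc _ _ (Fin.le_def.2 (by simp; omega))]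
    refine Submodule.add_mem _ ?_ (Submodule.smul_mem _ _ ?_)
    · rw [← Finset.add_sum_erase _ _ (Finset.mem_univ i'),
        ← Finset.add_sum_erase _ _ (Finset.mem_erase.2 ⟨hne.symm, Finset.mem_univ i''⟩),
        ← add_assoc, heq, hval, pow_succ, ← add_smul]
      rw [show (-1 : R) ^ (i' : ℕ) + (-1) ^ (i' : ℕ) * -1 = 0 by ring, zero_smul, zero_add]
      refine Submodule.sum_mem _ fun l hl => Submodule.smul_mem _ _ (key l ?_ ?_)
      · exact (Finset.mem_erase.1 (Finset.mem_erase.1 hl).2).1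
      · rw [hi'']
        exact fun h => (Finset.mem_erase.1 hl).1 (Fin.castSucc_injective _ h)
    · have h1 := ρ.map_mem (p + 1) a i'' (by rw [← hi'', ha])
      refine (Submodule.map_span_le _ _ (degenerate R A p)).2 ?_
        (Submodule.mem_map_of_mem (f := contract R A (0 : Fin (p + 1))) h1)
      rintro _ ⟨b, hb, rfl⟩
      rw [contract_tprod]
      have hi0 : i'' ≠ 0 := by
        rintro rfl
        simp at hval
      refine Submodule.subset_span ⟨_, i'', hi0, ?_, rfl⟩
      simp [contractFun, hi0, Fin.succAbove_of_le_castSucc, hb]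
  · -- the unit is at the last position
    rw [ρ.map_last _ _ (by rw [← hlast, ha]), contract_tprod]
    have hi' : i' = Fin.last p := by
      rw [← Fin.succ_last] at hlast
      exact Fin.succ_injective _ hlast
    subst hi'
    have heq : contractFun (Fin.last p) a =
        contractFun 0 (fun j => a ((finRotate (p + 2)).symm j)) := by
      funext j
      have e0 : ∀ l : Fin (p + 1), (finRotate (p + 2)).symm l.succ = l.castSucc :=
        fun l => finRotate_symm_succ l
      have e1 : (finRotate (p + 2)).symm (Fin.castSucc (0 : Fin (p + 1))) = Fin.last (p + 1) :=
        finRotate_symm_zero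
      simp only [contractFun, e0, e1, ← hlast, ha, one_mul, mul_one]
      by_cases hj : j = Fin.last p
      · subst hj
        by_cases h0 : Fin.last p = 0
        · simp [h0]
        · rw [if_pos rfl, if_neg h0, Fin.succAbove_of_le_castSucc _ _ (by simp), e0]
      · have hlt : j.castSucc < (Fin.last p).castSucc :=
          Fin.castSucc_lt_castSucc_iff.2 (lt_of_le_of_ne (Fin.le_last j) hj)
        rw [if_neg hj, Fin.succAbove_of_castSucc_lt _ _ hlt]
        by_cases h0 : j = 0
        · simp [h0]
        · rw [if_neg h0, Fin.succAbove_of_le_castSucc _ _ (by simp), e0]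
    rw [← Finset.add_sum_erase _ _ (Finset.mem_univ (Fin.last p)), ← heq, add_right_comm,
      Fin.val_last, pow_succ, ← add_smul,
      show (-1 : R) ^ p + (-1) ^ p * -1 = 0 by ring, zero_smul, zero_add]
    refine Submodule.sum_mem _ fun l hl => Submodule.smul_mem _ _ (key l ?_ ?_)
    · exact (Finset.mem_erase.1 hl).1
    · rw [Fin.succ_last]
      exact (Fin.castSucc_lt_last l).ne

/-- The differential of the reduced Hochschild complex. -/
def hoch : ∀ p : ℕ, RedChain R A p →ₗ[R] RedChain R A (p - 1)
  | 0 => 0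
  | p + 1 => Submodule.mapQ _ _ (hochPre ρ p) (hochPre_degenerate ρ p)

/-- The cycles of the reduced Hochschild complex. -/
def hochCycles (p : ℕ) : Submodule R (RedChain R A p) := LinearMap.ker (hoch ρ p)

/-- The boundaries of the reduced Hochschild complex. -/
def hochBoundaries (p : ℕ) : Submodule R (RedChain R A p) := LinearMap.range (hoch ρ (p + 1))

/-- Hochschild homology `HH_p(A, A)`. -/
abbrev HH (p : ℕ) := hochCycles ρ p ⧸ (hochBoundaries ρ p).submoduleOf (hochCycles ρ p)

/-- The homology class of a cycle. -/
def HH.mk {p : ℕ} (c : RedChain R A p) (hc : c ∈ hochCycles ρ p) : HH ρ p :=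
  Submodule.Quotient.mk ⟨c, hc⟩

/-- The class of `a ∈ A = C₀(A, A)` in `HH₀(A, A)`. -/
def HH.zeroClass (a : A) : HH ρ 0 := HH.mk ρ (RedChain.of R A fun _ => a) (by
  simp [hochCycles, hoch])

end Hochschild

/-! ### Commutative Frobenius algebras -/

section Frobenius

variable (R A : Type*) [CommRing R] [CommRing A] [Algebra R A]

/-- A commutative Frobenius algebra structure on the algebra `A`: a coassociative, counital and
cocommutative coproduct which is a map of `A`-modules. -/
structure Frobenius where
  comul : A →ₗ[R] A ⊗[R] A
  counit : A →ₗ[R] R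
  coassoc : ∀ a, TensorProduct.assoc R A A A (comul.rTensor A (comul a)) =
    comul.lTensor A (comul a)
  counit_left : ∀ a, TensorProduct.lid R A (counit.rTensor A (comul a)) = a
  counit_right : ∀ a, TensorProduct.rid R A (counit.lTensor A (comul a)) = a
  comul_comm : ∀ a, TensorProduct.comm R A A (comul a) = comul a
  comul_mul : ∀ a b, comul (a * b) = (a ⊗ₜ[R] (1 : A)) * comul b

variable {R A} {ι : Type} (Φ : Frobenius R A) (b : Module.Basis ι R A)

/-- The coefficients of `ν(1)` in a basis: `ν(1) = ∑ κ i j • b i ⊗ b j`. -/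
def Frobenius.copairing (i j : ι) : R := (b.tensorProduct b).repr (Φ.comul 1) (i, j)

theorem Frobenius.copairing_symm (i j : ι) : Φ.copairing b i j = Φ.copairing b j i := by
  have h : ∀ t : A ⊗[R] A, (b.tensorProduct b).repr (TensorProduct.comm R A A t) (i, j) =
      (b.tensorProduct b).repr t (j, i) := by
    intro t
    induction t using TensorProduct.induction_on with
    | zero => simp
    | tmul x y => simp [mul_comm]
    | add x y hx hy => simp only [map_add, Finsupp.add_apply, hx, hy]
  rw [Frobenius.copairing, Frobenius.copairing, ← h, Φ.comul_comm]

theorem Frobenius.sum_copairing [Fintype ι] (z : A) :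
    ∑ i, ∑ j, (Φ.copairing b i j * Φ.counit (b i * z)) • b j = z := by
  have h1 : Φ.comul 1 = ∑ i, ∑ j, Φ.copairing b i j • (b i ⊗ₜ[R] b j) := by
    rw [← (b.tensorProduct b).sum_repr (Φ.comul 1), Fintype.sum_prod_type]
    simp [Frobenius.copairing]
  have h2 := Φ.counit_left z
  have h3 : Φ.comul z = (z ⊗ₜ[R] (1 : A)) * Φ.comul 1 := by rw [← Φ.comul_mul, mul_one]
  rw [h3, h1] at h2
  conv_rhs => rw [← h2]
  simp [Finset.mul_sum, mul_smul, mul_comm z]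

/-- `ε(abc)` for three basis elements: the operation of a trivalent black vertex. -/
def Frobenius.vertex (i j l : ι) : R := Φ.counit (b i * b j * b l)

end Frobenius

/-! ### The algebra `R[x]/(x²)` -/

section DualNumber

variable (R : Type*) [CommRing R]

/-- The class of `x` in `R[x]/(x²)`. -/
abbrev xElt : DualNumber R := DualNumber.eps

/-- The basis `1, x` of `R[x]/(x²)`; `true` is the index of `x`. -/
def dualBasis : Module.Basis Bool R (DualNumber R) :=
  Module.Basis.ofEquivFun
    { toFun := fun a i => if i then TrivSqZeroExt.snd a else TrivSqZeroExt.fst a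
      invFun := fun f => TrivSqZeroExt.inl (f false) + TrivSqZeroExt.inr (f true)
      map_add' := by intro a b; funext i; cases i <;> simp
      map_smul' := by intro c a; funext i; cases i <;> simp
      left_inv := by intro a; ext <;> simp
      right_inv := by intro f; funext i; cases i <;> simp }

/-- The Frobenius structure with `ν(1) = 1 ⊗ x + x ⊗ 1` and `ν(x) = x ⊗ x`, with counit
`1 ↦ 0`, `x ↦ 1`. -/
def dualFrobenius : Frobenius R (DualNumber R) where
  comul :=
    (TrivSqZeroExt.fstHom R R R).toLinearMap.smulRight
        ((1 : DualNumber R) ⊗ₜ[R] xElt R + xElt R ⊗ₜ[R] (1 : DualNumber R))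
      + (TrivSqZeroExt.sndHom R R).smulRight (xElt R ⊗ₜ[R] xElt R)
  counit := TrivSqZeroExt.sndHom R R
  coassoc a := by
    simp [TensorProduct.tmul_add, TensorProduct.add_tmul, add_assoc, add_comm, add_left_comm]
  counit_left a := by
    simp
    ext <;> simp
  counit_right a := by
    simp
    ext <;> simp
  comul_comm a := by
    simp [add_comm]
  comul_mul a b := by
    have h1 : a * xElt R = TrivSqZeroExt.fst a • xElt R := by ext <;> simp
    have h2 : a = TrivSqZeroExt.fst a • (1 : DualNumber R) + TrivSqZeroExt.snd a • xElt R := by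
      ext <;> simp
    have h3 : a ⊗ₜ[R] xElt R = TrivSqZeroExt.fst a • ((1 : DualNumber R) ⊗ₜ[R] xElt R)
        + TrivSqZeroExt.snd a • (xElt R ⊗ₜ[R] xElt R) := by
      conv_lhs => rw [h2]
      rw [TensorProduct.add_tmul, TensorProduct.smul_tmul', TensorProduct.smul_tmul']
    simp only [LinearMap.add_apply, LinearMap.smulRight_apply, AlgHom.toLinearMap_apply,
      TrivSqZeroExt.fstHom_apply, TrivSqZeroExt.sndHom_apply, TrivSqZeroExt.fst_mul,
      TrivSqZeroExt.snd_mul, mul_add, mul_smul_comm, Algebra.TensorProduct.tmul_mul_tmul, one_mul,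
      mul_one, h1, h3, ← TensorProduct.smul_tmul', MulOpposite.smul_eq_mul_unop,
      MulOpposite.unop_op, smul_eq_mul]
    module

end DualNumber

/-- The sign `x ↦ (-1)^N x`, `1 ↦ 1` on `R[x]/(x²)`. -/
def signMap (R : Type*) [CommRing R] (N : ℕ) : DualNumber R →ₗ[R] DualNumber R :=
  (TrivSqZeroExt.inlAlgHom R R R).toLinearMap ∘ₗ (TrivSqZeroExt.fstHom R R R).toLinearMap
   + (-1 : R) ^ N • TrivSqZeroExt.inrHom R R ∘ₗ TrivSqZeroExt.sndHom R R

/-- The rotation of the tensor factors of the graded algebra `R[x]/(x²)`, `x` in degree `N`. -/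
def sphereRotation (R : Type*) [CommRing R] (N : ℕ) : Rotation R (DualNumber R) where
  map p :=
    (PiTensorProduct.map (fun j : Fin (p + 1) => if j = 0 then
        (TrivSqZeroExt.inlAlgHom R R R).toLinearMap ∘ₗ (TrivSqZeroExt.fstHom R R R).toLinearMap
        else LinearMap.id)
      + PiTensorProduct.map (fun j : Fin (p + 1) => if j = 0 then
        TrivSqZeroExt.inrHom R R ∘ₗ TrivSqZeroExt.sndHom R R else signMap R N))
    ∘ₗ (plainRotation R (DualNumber R)).map p
  map_last p a h := by
    rw [LinearMap.comp_apply, (plainRotation R (DualNumber R)).map_last p a h, LinearMap.add_apply,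
      PiTensorProduct.map_tprod, PiTensorProduct.map_tprod]
    have h0 : a ((finRotate (p + 1)).symm 0) = 1 := by rw [finRotate_symm_zero, h]
    have hz : (PiTensorProduct.tprod R fun j : Fin (p + 1) =>
        (if j = 0 then TrivSqZeroExt.inrHom R R ∘ₗ TrivSqZeroExt.sndHom R R else signMap R N)
          (a ((finRotate (p + 1)).symm j))) = 0 :=
      MultilinearMap.map_coord_zero _ 0 (by rw [if_pos rfl, h0]; simp)
    rw [hz, add_zero]
    congr 1
    funext j
    by_cases hj : j = 0
    · subst hj
      simp only [if_true, h0]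
      simp
    · simp [hj]
  map_mem p a i h := by
    obtain ⟨b, hb, he⟩ : ∃ b : Fin (p + 1) → DualNumber R, b i.succ = 1 ∧
        (plainRotation R (DualNumber R)).map p (PiTensorProduct.tprod R a) =
          PiTensorProduct.tprod R b := by
      refine ⟨fun j => a ((finRotate (p + 1)).symm j), ?_, by simp [plainRotation]⟩
      change a ((finRotate (p + 1)).symm i.succ) = 1
      rw [finRotate_symm_succ, h]
    rw [LinearMap.comp_apply, he, LinearMap.add_apply, PiTensorProduct.map_tprod, PiTensorProduct.map_tprod]
    refine Submodule.add_mem _ (Submodule.subset_span ⟨_, ?_, rfl⟩)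
      (Submodule.subset_span ⟨_, ?_, rfl⟩)
    · simp [hb]
    · rw [if_neg (Fin.succ_ne_zero i), hb]
      simp [signMap]
/-! ### The action on Hochschild chains -/

/-- The edges of a graph, as unordered pairs of half-edges. -/
def BWGraph.edges (G : BWGraph m k) : Finset (Sym2 (HalfEdge k G.V)) :=
  (Finset.univ.filter fun h => G.inv h ≠ h).image fun h => s(h, G.inv h)

section Action

variable {R A : Type*} [CommRing R] [CommRing A] [Algebra R A] {ι : Type}
  (Φ : Frobenius R A) (b : Module.Basis ι R A)

/-- The coefficient of `ν(1)` belonging to an unordered pair of basis elements. -/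
def Frobenius.edgeCoeff : Sym2 ι → R :=
  Sym2.lift ⟨fun i j => Φ.copairing b i j, Φ.copairing_symm b⟩

/-- The product of the contributions of the edges, for a labelling `c` of the half-edges by basis
elements. -/
def edgeWeight (G : BWGraph m k) (c : HalfEdge k G.V → ι) : R :=
  ∏ e ∈ G.edges, Φ.edgeCoeff b (e.map c)

/-- The product of the contributions of the black vertices. -/
def vertexWeight {V : Type} [Fintype V] (β : V × Fin 3 → ι) : R :=
  ∏ v : V, Φ.vertex b (β (v, 0)) (β (v, 1)) (β (v, 2))

/-- The contribution of the labelled leaves, with `a j` placed at the leaf `j`. An exceptional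
component contributes the counit. -/
def leafWeight (G : BWGraph m k) (c : HalfEdge k G.V → ι) :
    MultilinearMap R (fun _ : Fin m => A) R :=
  (MultilinearMap.mkPiAlgebra R (Fin m) R).compLinearMap fun j =>
    (G.leaf j).elim Φ.counit fun h => b.coord (c h)

/-- The graph without its white vertex, read as a composition of operations of the Frobenius
algebra with inputs at the leaves: the coefficient of `b (μ 0) ⊗ … ⊗ b (μ (k - 1))` in the result,
where the output `i` is at the half-edge `i` of the white vertex. It is the sum over all labellings
of the half-edges by basis elements of the product of the contributions of edges (the copairing
`ν(1)`), black vertices (the form `ε(abc)`) and leaves. -/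
def amplitude [Fintype ι] (G : BWGraph m k) (μ : Fin k → ι) : MultilinearMap R (fun _ : Fin m => A) R :=
  ∑ β : G.V × Fin 3 → ι,
    (edgeWeight Φ b G (Sum.elim μ β) * vertexWeight Φ b β) • leafWeight Φ b G (Sum.elim μ β)

theorem edges_relabel (G : BWGraph m k) (W : Type) [Fintype W] [DecidableEq W]
    (e : HalfEdge k G.V ≃ HalfEdge k W) :
    (G.relabel W e).edges = G.edges.image (Sym2.map e) := by
  ext x
  simp only [BWGraph.edges, Finset.mem_image, Finset.mem_filter, Finset.mem_univ, true_and]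
  constructor
  · rintro ⟨h, hh, rfl⟩
    refine ⟨_, ⟨e.symm h, fun h' => hh ?_, rfl⟩, by simp⟩
    rw [h', e.apply_symm_apply]
  · rintro ⟨_, ⟨h, hh, rfl⟩, rfl⟩
    exact ⟨e h, by simpa using hh, by simp⟩

theorem edgeWeight_relabel (G : BWGraph m k) (W : Type) [Fintype W] [DecidableEq W]
    (e : HalfEdge k G.V ≃ HalfEdge k W) (c : HalfEdge k W → ι) :
    edgeWeight Φ b (G.relabel W e) c = edgeWeight Φ b G (c ∘ e) := by
  rw [edgeWeight, edges_relabel, Finset.prod_image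
    (fun x _ y _ h => Sym2.map.injective e.injective h)]
  simp [edgeWeight, Sym2.map_map]

theorem leafWeight_relabel (G : BWGraph m k) (W : Type) [Fintype W] [DecidableEq W]
    (e : HalfEdge k G.V ≃ HalfEdge k W) (c : HalfEdge k W → ι) :
    leafWeight Φ b (G.relabel W e) c = leafWeight Φ b G (c ∘ e) := by
  rw [leafWeight, leafWeight]
  congr 1
  funext j
  change ((G.leaf j).map e).elim _ _ = _
  rcases G.leaf j with _ | h <;> rfl

theorem amplitude_relabel [Fintype ι] (G : BWGraph m k) (W : Type) [Fintype W] [DecidableEq W]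
    (e : G.V × Fin 3 ≃ W × Fin 3) (μ : Fin k → ι) :
    amplitude Φ b (G.relabel W (Equiv.sumCongr (Equiv.refl (Fin k)) e)) μ =
      ∑ β : G.V × Fin 3 → ι, (edgeWeight Φ b G (Sum.elim μ β) * vertexWeight Φ b (β ∘ e.symm)) •
        leafWeight Φ b G (Sum.elim μ β) := by
  classical
  refine Fintype.sum_equiv (Equiv.arrowCongr e.symm (Equiv.refl ι)) _ _ fun β => ?_
  have h1 : Sum.elim μ (Equiv.arrowCongr e.symm (Equiv.refl ι) β) =
      Sum.elim μ β ∘ Equiv.sumCongr (Equiv.refl (Fin k)) e := by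
    funext x; rcases x with x | x <;> simp
  have h2 : Equiv.arrowCongr e.symm (Equiv.refl ι) β ∘ e.symm = β := by
    funext x; simp
  rw [h1, h2, edgeWeight_relabel, leafWeight_relabel]

theorem Frobenius.vertex_rotate (i j l : ι) : Φ.vertex b i j l = Φ.vertex b j l i := by
  rw [Frobenius.vertex, Frobenius.vertex]; congr 1; ring

theorem vertexWeight_comp {V W : Type} [Fintype V] [Fintype W] (e : V × Fin 3 ≃ W × Fin 3)
    (he : ∀ v t, e (v, t + 1) = ((e (v, t)).1, (e (v, t)).2 + 1)) (β : V × Fin 3 → ι) :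
    vertexWeight Φ b (β ∘ e.symm) = vertexWeight Φ b β := by
  have h1 : ∀ v s, e (v, s) = ((e (v, 0)).1, (e (v, 0)).2 + s) := by
    intro v s
    have e1 : e (v, 1) = ((e (v, 0)).1, (e (v, 0)).2 + 1) := he v 0
    have e2 : e (v, 2) = ((e (v, 1)).1, (e (v, 1)).2 + 1) := he v 1
    fin_cases s
    · simp
    · exact e1
    · change e (v, 2) = ((e (v, 0)).1, (e (v, 0)).2 + 2)
      rw [e2, e1]
      simp [add_assoc]
  refine (Fintype.prod_bijective (fun v => (e (v, 0)).1) ⟨?_, ?_⟩ _ _ ?_).symm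
  · intro v v' h
    have h2 := h1 v ((e (v', 0)).2 - (e (v, 0)).2)
    have h3 : e (v, (e (v', 0)).2 - (e (v, 0)).2) = e (v', 0) := by
      rw [h2]
      refine Prod.ext h ?_
      simp
    exact congrArg Prod.fst (e.injective h3)
  · intro w
    refine ⟨(e.symm (w, 0)).1, ?_⟩
    have h2 := h1 (e.symm (w, 0)).1 (e.symm (w, 0)).2
    rw [Prod.mk.eta, e.apply_symm_apply] at h2
    exact (congrArg Prod.fst h2).symm
  · intro v
    have h2 : ∀ s, e.symm ((e (v, 0)).1, s) = (v, s - (e (v, 0)).2) := by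
      intro s
      rw [Equiv.symm_apply_eq, h1 v (s - (e (v, 0)).2)]
      simp
    simp only [Function.comp_apply, h2]
    generalize (e (v, 0)).2 = t
    fin_cases t
    · rfl
    · exact (Φ.vertex_rotate b _ _ _).trans (Φ.vertex_rotate b _ _ _)
    · exact Φ.vertex_rotate b _ _ _

theorem amplitude_iso [Fintype ι] (G : BWGraph m k) (W : Type) [Fintype W] [DecidableEq W]
    (e : G.V × Fin 3 ≃ W × Fin 3) (he : ∀ v t, e (v, t + 1) = ((e (v, t)).1, (e (v, t)).2 + 1))
    (μ : Fin k → ι) :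
    amplitude Φ b (G.relabel W (Equiv.sumCongr (Equiv.refl (Fin k)) e)) μ =
      amplitude Φ b G μ := by
  rw [amplitude_relabel, amplitude]
  refine Finset.sum_congr rfl fun β _ => ?_
  rw [vertexWeight_comp Φ b e he]

/-- Two sums over functions agree if they agree after summing over two of the values. -/
theorem sum_congr_two {α M : Type*} [Fintype α] [DecidableEq α] [Fintype ι] [AddCommMonoid M]
    {x y : α} (hxy : x ≠ y) (f g : (α → ι) → M)
    (h : ∀ β, ∑ i, ∑ j, f (Function.update (Function.update β x i) y j) =
      ∑ i, ∑ j, g (Function.update (Function.update β x i) y j)) :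
    ∑ β, f β = ∑ β, g β := by
  classical
  let r : (α → ι) → ({a // a ≠ x ∧ a ≠ y} → ι) := fun β a => β a
  have key : ∀ (F : (α → ι) → M) (β₀ : α → ι),
      ∑ β with r β = r β₀, F β =
        ∑ i, ∑ j, F (Function.update (Function.update β₀ x i) y j) := by
    intro F β₀
    rw [← Fintype.sum_prod_type']
    refine Finset.sum_bij' (fun β _ => (β x, β y))
      (fun q _ => Function.update (Function.update β₀ x q.1) y q.2) ?_ ?_ ?_ ?_ ?_
    · simp
    · rintro ⟨i, j⟩ _
      simp only [Finset.mem_filter, Finset.mem_univ, true_and]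
      funext ⟨a, ha⟩
      simp [r, Function.update_of_ne ha.1, Function.update_of_ne ha.2]
    · intro β hβ
      simp only [Finset.mem_filter, Finset.mem_univ, true_and] at hβ
      funext a
      by_cases hy : a = y
      · subst hy; simp
      · by_cases hx : a = x
        · subst hx; simp [Function.update_of_ne hy]
        · simpa [r, Function.update_of_ne hy, Function.update_of_ne hx] using
            (congrFun hβ ⟨a, hx, hy⟩).symm
    · rintro ⟨i, j⟩ _
      simp [Function.update_of_ne hxy]
    · intro β hβ
      simp only [Finset.mem_filter, Finset.mem_univ, true_and] at hβ
      congr 1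
      funext a
      by_cases hy : a = y
      · subst hy; simp
      · by_cases hx : a = x
        · subst hx; simp [Function.update_of_ne hy]
        · simpa [r, Function.update_of_ne hy, Function.update_of_ne hx] using
            (congrFun hβ ⟨a, hx, hy⟩)
  rw [← Finset.sum_fiberwise (Finset.univ : Finset (α → ι)) r f,
    ← Finset.sum_fiberwise (Finset.univ : Finset (α → ι)) r g]
  refine Finset.sum_congr rfl fun q _ => ?_
  by_cases hq : ∃ β₀, r β₀ = q
  · obtain ⟨β₀, rfl⟩ := hq
    rw [key, key, h]
  · have : (Finset.univ.filter fun β => r β = q) = ∅ := by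
      ext β
      simp only [Finset.mem_filter, Finset.mem_univ, true_and, Finset.notMem_empty, iff_false]
      exact fun hβ => hq ⟨β, hβ⟩
    rw [this, Finset.sum_empty, Finset.sum_empty]

theorem Frobenius.sum_vertex [Fintype ι] (p q r s : ι) :
    ∑ i, ∑ j, Φ.copairing b i j * (Φ.vertex b i p q * Φ.vertex b j r s) =
      Φ.counit (b p * b q * b r * b s) := by
  have h := congrArg (fun z => Φ.counit (z * (b r * b s))) (Φ.sum_copairing b (b p * b q))
  simp only [Finset.sum_mul, map_sum, smul_mul_assoc, map_smul, smul_eq_mul] at h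
  rw [show b p * b q * b r * b s = b p * b q * (b r * b s) by ring, ← h]
  refine Finset.sum_congr rfl fun i _ => Finset.sum_congr rfl fun j _ => ?_
  rw [Frobenius.vertex, Frobenius.vertex, mul_assoc (b i), mul_assoc (b j), mul_assoc]

theorem amplitude_flip [Fintype ι] (G : BWGraph m k) (u v : G.V) (huv : u ≠ v)
    (h : G.inv (Sum.inr (u, 0)) = Sum.inr (v, 0)) (μ : Fin k → ι) :
    amplitude Φ b (G.relabel G.V (flipPerm k u v)) μ = amplitude Φ b G μ := by
  classical
  rw [flipPerm, amplitude_relabel, amplitude]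
  set π : Equiv.Perm (G.V × Fin 3) :=
    Equiv.swap (u, 1) (v, 2) * Equiv.swap (v, 2) (v, 1) * Equiv.swap (v, 1) (u, 2) with hπ
  have hne : ((u, 0) : G.V × Fin 3) ≠ (v, 0) := fun e => huv (congrArg Prod.fst e)
  refine sum_congr_two hne _ _ fun β => ?_
  set up : ι → ι → G.V × Fin 3 → ι := fun i j =>
    Function.update (Function.update β (u, 0) i) (v, 0) j with hup
  have up_of_ne : ∀ i j x, x ≠ (u, 0) → x ≠ (v, 0) → up i j x = β x := by
    intro i j x h1 h2
    simp [hup, Function.update_of_ne h1, Function.update_of_ne h2]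
  have up_u : ∀ i j, up i j (u, 0) = i := by
    intro i j; simp [hup, Function.update_of_ne hne]
  have up_v : ∀ i j, up i j (v, 0) = j := by
    intro i j; simp [hup]
  -- the leaves do not meet the edge
  have hleaf : ∀ i j, leafWeight Φ b G (Sum.elim μ (up i j)) = leafWeight Φ b G (Sum.elim μ β) := by
    intro i j
    rw [leafWeight, leafWeight]
    congr 1
    funext a
    rcases ha : G.leaf a with _ | x
    · rfl
    · have hx : G.inv x = x := (G.inv_eq_self_iff x).2 ⟨a, ha⟩
      change b.coord (Sum.elim μ (up i j) x) = b.coord (Sum.elim μ β x)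
      congr 1
      rcases x with x | x
      · rfl
      · refine up_of_ne i j x ?_ ?_
        · rintro rfl
          rw [h] at hx
          exact hne (Sum.inr_injective hx).symm
        · rintro rfl
          rw [← h, G.inv_inv] at hx
          exact hne (Sum.inr_injective (hx.trans h))
  -- the contribution of the edge factors out
  set e₀ : Sym2 (HalfEdge k G.V) := s(Sum.inr (u, 0), Sum.inr (v, 0)) with he₀
  have he₀mem : e₀ ∈ G.edges := by
    refine Finset.mem_image.2 ⟨Sum.inr (u, 0), ?_, by rw [h]⟩
    simp only [Finset.mem_filter, Finset.mem_univ, true_and, h]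
    exact fun e => hne (Sum.inr_injective e).symm
  have hedge : ∀ i j, edgeWeight Φ b G (Sum.elim μ (up i j)) =
      Φ.copairing b i j * ∏ e ∈ G.edges.erase e₀, Φ.edgeCoeff b (e.map (Sum.elim μ β)) := by
    intro i j
    rw [edgeWeight, ← Finset.mul_prod_erase _ _ he₀mem]
    congr 1
    · simp only [he₀, Sym2.map_mk, Sum.elim_inr, up_u, up_v]
      rfl
    · refine Finset.prod_congr rfl fun e he => ?_
      obtain ⟨hee, he⟩ := Finset.mem_erase.1 he
      obtain ⟨x, -, rfl⟩ := Finset.mem_image.1 he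
      have hx : ∀ y : HalfEdge k G.V, y ∈ s(x, G.inv x) →
          Sum.elim μ (up i j) y = Sum.elim μ β y := by
        intro y hy
        rcases y with y | y
        · rfl
        · refine up_of_ne i j y ?_ ?_
          · rintro rfl
            rcases Sym2.mem_iff.1 hy with rfl | hy
            · exact hee (by rw [h])
            · refine hee ?_
              rw [← hy, ← G.inv_inv x, ← hy, h, Sym2.eq_swap]
          · rintro rfl
            have h' : G.inv (Sum.inr (v, 0)) = Sum.inr (u, 0) := by rw [← h, G.inv_inv]
            rcases Sym2.mem_iff.1 hy with rfl | hy
            · exact hee (by rw [h', Sym2.eq_swap])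
            · refine hee ?_
              rw [← hy, ← G.inv_inv x, ← hy, h']
      congr 1
      exact Sym2.map_congr hx
  -- the contribution of the vertices
  have hvert : ∀ γ : G.V × Fin 3 → ι, vertexWeight Φ b γ =
      (Φ.vertex b (γ (u, 0)) (γ (u, 1)) (γ (u, 2)) *
        Φ.vertex b (γ (v, 0)) (γ (v, 1)) (γ (v, 2))) *
      ∏ w ∈ (Finset.univ.erase u).erase v, Φ.vertex b (γ (w, 0)) (γ (w, 1)) (γ (w, 2)) := by
    intro γ
    rw [vertexWeight, ← Finset.mul_prod_erase _ _ (Finset.mem_univ u),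
      ← Finset.mul_prod_erase _ _ (Finset.mem_erase.2 ⟨huv.symm, Finset.mem_univ v⟩), mul_assoc]
  have hvu := huv.symm
  have p1 : π.symm (u, 0) = (u, 0) := by
    rw [Equiv.symm_apply_eq]; simp [hπ, Equiv.swap_apply_def, huv]
  have p2 : π.symm (v, 0) = (v, 0) := by
    rw [Equiv.symm_apply_eq]; simp [hπ, Equiv.swap_apply_def, hvu]
  have p3 : π.symm (u, 1) = (u, 2) := by
    simp [hπ, Equiv.symm_apply_eq, Equiv.swap_apply_def, huv, hvu]
  have p4 : π.symm (u, 2) = (v, 1) := by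
    simp [hπ, Equiv.symm_apply_eq, Equiv.swap_apply_def, huv, hvu]
  have p5 : π.symm (v, 1) = (v, 2) := by
    simp [hπ, Equiv.symm_apply_eq, Equiv.swap_apply_def, huv, hvu]
  have p6 : π.symm (v, 2) = (u, 1) := by
    simp [hπ, Equiv.symm_apply_eq, Equiv.swap_apply_def, huv, hvu]
  have p7 : ∀ w t, w ≠ u → w ≠ v → π.symm (w, t) = (w, t) := by
    intro w t h1 h2
    rw [Equiv.symm_apply_eq]; simp [hπ, Equiv.swap_apply_def, h1, h2]
  have hrest : ∀ i j (σ : G.V × Fin 3 → G.V × Fin 3),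
      (∀ w t, w ≠ u → w ≠ v → σ (w, t) = (w, t)) →
      ∏ w ∈ (Finset.univ.erase u).erase v, Φ.vertex b ((up i j ∘ σ) (w, 0)) ((up i j ∘ σ) (w, 1))
          ((up i j ∘ σ) (w, 2)) =
        ∏ w ∈ (Finset.univ.erase u).erase v, Φ.vertex b (β (w, 0)) (β (w, 1)) (β (w, 2)) := by
    intro i j σ hσ
    refine Finset.prod_congr rfl fun w hw => ?_
    simp only [Finset.mem_erase, Finset.mem_univ, and_true] at hw
    have : ∀ t, (up i j ∘ σ) (w, t) = β (w, t) := by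
      intro t
      rw [Function.comp_apply, hσ w t hw.2 hw.1]
      exact up_of_ne i j _ (fun e => hw.2 (congrArg Prod.fst e))
        (fun e => hw.1 (congrArg Prod.fst e))
    rw [this, this, this]
  have n1 : ∀ i j w (t : Fin 3), t ≠ 0 → up i j (w, t) = β (w, t) := fun i j w t ht =>
    up_of_ne i j _ (fun e => ht (congrArg Prod.snd e)) (fun e => ht (congrArg Prod.snd e))
  have hl : ∀ i j, (edgeWeight Φ b G (Sum.elim μ (up i j)) *
      vertexWeight Φ b (up i j ∘ π.symm)) • leafWeight Φ b G (Sum.elim μ (up i j)) =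
      (Φ.copairing b i j * (Φ.vertex b i (β (u, 2)) (β (v, 1)) *
        Φ.vertex b j (β (v, 2)) (β (u, 1)))) •
      ((∏ e ∈ G.edges.erase e₀, Φ.edgeCoeff b (e.map (Sum.elim μ β))) *
        ∏ w ∈ (Finset.univ.erase u).erase v, Φ.vertex b (β (w, 0)) (β (w, 1)) (β (w, 2))) •
        leafWeight Φ b G (Sum.elim μ β) := by
    intro i j
    rw [hleaf, hedge, hvert, hrest i j π.symm p7, smul_smul]
    simp only [Function.comp_apply, p1, p2, p3, p4, p5, p6, up_u, up_v,
      n1 i j _ 1 (by decide), n1 i j _ 2 (by decide)]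
    congr 1
    ring
  have hr : ∀ i j, (edgeWeight Φ b G (Sum.elim μ (up i j)) *
      vertexWeight Φ b (up i j)) • leafWeight Φ b G (Sum.elim μ (up i j)) =
      (Φ.copairing b i j * (Φ.vertex b i (β (u, 1)) (β (u, 2)) *
        Φ.vertex b j (β (v, 1)) (β (v, 2)))) •
      ((∏ e ∈ G.edges.erase e₀, Φ.edgeCoeff b (e.map (Sum.elim μ β))) *
        ∏ w ∈ (Finset.univ.erase u).erase v, Φ.vertex b (β (w, 0)) (β (w, 1)) (β (w, 2))) •
        leafWeight Φ b G (Sum.elim μ β) := by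
    intro i j
    have := hrest i j id (fun _ _ _ _ => rfl)
    simp only [Function.comp_id] at this
    rw [hleaf, hedge, hvert, this, smul_smul]
    simp only [up_u, up_v, n1 i j _ 1 (by decide), n1 i j _ 2 (by decide)]
    congr 1
    ring
  refine (Finset.sum_congr rfl fun i _ => Finset.sum_congr rfl fun j _ => hl i j).trans
    (Eq.trans ?_ (Finset.sum_congr rfl fun i _ => Finset.sum_congr rfl fun j _ => hr i j).symm)
  simp only [← Finset.sum_smul]
  congr 1
  rw [Φ.sum_vertex, Φ.sum_vertex]
  congr 1
  ring

theorem amplitude_move [Fintype ι] {G G' : BWGraph m k} (h : Move G G') :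
    amplitude Φ b G = amplitude Φ b G' := by
  funext μ
  cases h with
  | iso W e he => exact (amplitude_iso Φ b G W e he μ).symm
  | flip u v huv h => exact (amplitude_flip Φ b G u v huv h μ).symm

/-- `amplitude` on diagrams. -/
def Diagram.amplitude [Fintype ι] (D : Diagram m k) :
    (Fin k → ι) → MultilinearMap R (fun _ : Fin m => A) R :=
  Quot.lift (Sullivan.amplitude Φ b) (fun _ _ h => amplitude_move Φ b h) D

/-- The action of a generator on Hochschild chains of degree zero, `a₀, …, a_{m-1} ∈ A = C₀(A, A)`:
the outputs of the diagram are placed in order into the tensor factors of the Hochschild chain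
given by the white vertex, with a unit in the first factor if the start is an unlabelled leaf. -/
def actionGen [Fintype ι] (p : ℕ) : Gen m p → MultilinearMap R (fun _ : Fin m => A) (RedChain R A p)
  | Sum.inl D => ∑ μ : Fin (p + 1) → ι,
      (D.amplitude Φ b μ).smulRight (RedChain.of R A fun i => b (μ i))
  | Sum.inr D => ∑ μ : Fin p → ι,
      (D.amplitude Φ b μ).smulRight (RedChain.of R A (Fin.cons 1 fun i => b (μ i)))

/-- The action `F(c ⊗ (a₀ ⊗ … ⊗ a_{m-1}))` of a chain `c` of degree `p` on Hochschild chains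
`a₀, …, a_{m-1} ∈ A = C₀(A, A)` of degree zero. -/
def action [Fintype ι] (p : ℕ) :
    (Gen m p →₀ R) →ₗ[R] MultilinearMap R (fun _ : Fin m => A) (RedChain R A p) :=
  Finsupp.linearCombination R (actionGen Φ b p)

end Action
/-! ### The graphs `μ_g` and `t_g` -/

/-- The involution of `muGraph n`. -/
def muInv (n : ℕ) : HalfEdge (2 * (n + 1) + 1 + 1) (Fin n) → HalfEdge (2 * (n + 1) + 1 + 1) (Fin n)
  | Sum.inl i =>
    if i.val % 2 = 1 then Sum.inl i
    else if i.val = 0 then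
      if hn : 0 < n then Sum.inr (⟨0, hn⟩, 0) else Sum.inl ⟨2 * n + 2, by omega⟩
    else if i.val = 2 * n + 2 then
      if hn : 0 < n then Sum.inr (⟨n - 1, by omega⟩, 1) else Sum.inl ⟨0, by omega⟩
    else if h : i.val / 2 - 1 < n then Sum.inr (⟨i.val / 2 - 1, h⟩, 2) else Sum.inl i
  | Sum.inr (v, t) =>
    if t = 0 then
      if v.val = 0 then Sum.inl ⟨0, by omega⟩ else Sum.inr (⟨v.val - 1, by omega⟩, 1)
    else if t = 1 then
      if h : v.val + 1 < n then Sum.inr (⟨v.val + 1, h⟩, 0) else Sum.inl ⟨2 * n + 2, by omega⟩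
    else Sum.inl ⟨2 * v.val + 2, by omega⟩

theorem muInv_muInv (n : ℕ) : Function.Involutive (muInv n) := by
  rintro (⟨i, hi⟩ | ⟨⟨v, hv⟩, t⟩)
  · simp only [muInv]
    split_ifs <;> simp [muInv] <;> grind
  · fin_cases t <;> simp only [muInv] <;> grind [muInv]

/-- The graph `μ_g` for `g = n + 1`: a white vertex with the `2g + 2` half-edges `0, …, 2g + 1`, of
which the half-edges `0, 2, …, 2g` are connected by a planar trivalent tree outside of the white
vertex, and the others are leaves, labelled in their cyclic order. -/
def muGraph (n : ℕ) : BWGraph (n + 2) (2 * (n + 1) + 1 + 1) where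
  V := Fin n
  inv := muInv n
  inv_inv := muInv_muInv n
  leaf j := some (Sum.inl ⟨2 * j.val + 1, by omega⟩)
  leaf_inj i j h hi hj := by
    rw [← hj] at hi
    simp at hi
    omega
  inv_eq_self_iff h := by
    rcases h with ⟨i, hi⟩ | ⟨⟨v, hv⟩, t⟩
    · constructor
      · intro h
        have : i % 2 = 1 := by
          simp only [muInv] at h
          grind
        exact ⟨⟨i / 2, by omega⟩, by simp; omega⟩
      · rintro ⟨j, hj⟩
        simp at hj
        simp only [muInv]
        grind
    · constructor
      · intro h
        simp only [muInv] at h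
        grind
      · rintro ⟨j, hj⟩
        simp at hj

/-- The involution of `tGraph n`. The black vertices of the first tree are `Sum.inl v`, those of
the second tree are `Sum.inr v`. -/
def tInv (n : ℕ) : HalfEdge (2 * (n + 1) + 1 + 1) (Fin n ⊕ Fin (n + 1)) →
    HalfEdge (2 * (n + 1) + 1 + 1) (Fin n ⊕ Fin (n + 1))
  | Sum.inl i =>
    if i.val % 2 = 1 then
      if h : i.val / 2 < n + 1 then Sum.inr (Sum.inr ⟨i.val / 2, h⟩, 2)
      else Sum.inr (Sum.inr ⟨n, by omega⟩, 1)
    else if i.val = 0 then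
      if hn : 0 < n then Sum.inr (Sum.inl ⟨0, hn⟩, 0) else Sum.inl ⟨2 * n + 2, by omega⟩
    else if i.val = 2 * n + 2 then
      if hn : 0 < n then Sum.inr (Sum.inl ⟨n - 1, by omega⟩, 1) else Sum.inl ⟨0, by omega⟩
    else if h : i.val / 2 - 1 < n then Sum.inr (Sum.inl ⟨i.val / 2 - 1, h⟩, 2) else Sum.inl i
  | Sum.inr (Sum.inl v, t) =>
    if t = 0 then
      if v.val = 0 then Sum.inl ⟨0, by omega⟩ else Sum.inr (Sum.inl ⟨v.val - 1, by omega⟩, 1)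
    else if t = 1 then
      if h : v.val + 1 < n then Sum.inr (Sum.inl ⟨v.val + 1, h⟩, 0)
      else Sum.inl ⟨2 * n + 2, by omega⟩
    else Sum.inl ⟨2 * v.val + 2, by omega⟩
  | Sum.inr (Sum.inr v, t) =>
    if t = 0 then
      if v.val = 0 then Sum.inr (Sum.inr v, 0) else Sum.inr (Sum.inr ⟨v.val - 1, by omega⟩, 1)
    else if t = 1 then
      if h : v.val + 1 < n + 1 then Sum.inr (Sum.inr ⟨v.val + 1, h⟩, 0)
      else Sum.inl ⟨2 * n + 3, by omega⟩
    else Sum.inl ⟨2 * v.val + 1, by omega⟩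

theorem tInv_tInv (n : ℕ) : Function.Involutive (tInv n) := by
  rintro (⟨i, hi⟩ | ⟨⟨v, hv⟩ | ⟨v, hv⟩, t⟩)
  · simp only [tInv]
    split_ifs <;> simp [tInv] <;> grind
  · fin_cases t <;> simp only [tInv] <;> grind [tInv]
  · fin_cases t <;> simp only [tInv] <;> grind [tInv]

/-- The graph `t_g` for `g = n + 1`: it is obtained from `μ_g` by connecting the half-edges
`1, 3, …, 2g + 1` at the white vertex by a second planar trivalent tree, which has in addition a
leaf (its root), labelled by the only label. -/
def tGraph (n : ℕ) : BWGraph 1 (2 * (n + 1) + 1 + 1) where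
  V := Fin n ⊕ Fin (n + 1)
  inv := tInv n
  inv_inv := tInv_tInv n
  leaf _ := some (Sum.inr (Sum.inr 0, 0))
  leaf_inj i j h hi hj := Subsingleton.elim i j
  inv_eq_self_iff h := by
    rcases h with ⟨i, hi⟩ | ⟨⟨v, hv⟩ | ⟨v, hv⟩, t⟩
    · simp only [tInv]
      grind
    · simp only [tInv]
      grind
    · simp only [tInv]
      grind

/-- The Sullivan diagram `μ_g`, `g = n + 1`, in degree `2g + 1`. -/
def muChain (R : Type*) [CommRing R] (n : ℕ) : Gen (n + 2) (2 * (n + 1) + 1) →₀ R :=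
  Finsupp.single (Sum.inl (Quot.mk _ (muGraph n))) 1

/-- The Sullivan diagram `t_g`, `g = n + 1`, in degree `2g + 1`. -/
def tChain (R : Type*) [CommRing R] (n : ℕ) : Gen 1 (2 * (n + 1) + 1) →₀ R :=
  Finsupp.single (Sum.inl (Quot.mk _ (tGraph n))) 1

/-- A graph whose surface (thicken the graph and put a boundary circle in place of the white
vertex) is connected of genus `g`, with `b` boundary components besides the one at the white
vertex. The Euler characteristic of the surface is the number of black vertices minus the number
of edges. -/
def BWGraph.HasType (G : BWGraph m k) (g b : ℕ) : Prop :=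
  (∀ h h', Relation.EqvGen (fun x y => y = nextPerm k G.V x ∨ y = G.inv x) h h') ∧
  (∀ j, G.leaf j ≠ none) ∧
  Nat.card (Quotient (Equiv.Perm.SameCycle.setoid G.boundaryPerm)) = b ∧
  (Fintype.card G.V : ℤ) - G.edges.card = 2 - 2 * g - (b + 1)

/-! ### Induced maps on Hochschild homology -/

/-- The action of chains of diagrams on `R[x]/(x²)`, on Hochschild chains of degree zero. -/
def dualAction (R : Type*) [CommRing R] {m p : ℕ} (c : Gen m p →₀ R) :
    MultilinearMap R (fun _ : Fin m => DualNumber R) (RedChain R (DualNumber R) p) :=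
  action (dualFrobenius R) (dualBasis R) p c

/-- The operation of a graph with `p + 1` half-edges at the white vertex on the graded Frobenius
algebra `R[x]/(x²)`, `x` in positive degree: as without a grading, but the summand of each
labelling `c` of the half-edges by the basis elements `1, x` comes with a sign `s c`. -/
def signedAction (R : Type*) [CommRing R] {m p : ℕ} (G : BWGraph m (p + 1))
    (s : (HalfEdge (p + 1) G.V → Bool) → ℤˣ) :
    MultilinearMap R (fun _ : Fin m => DualNumber R) (RedChain R (DualNumber R) p) :=
  ∑ μ : Fin (p + 1) → Bool, (∑ β : G.V × Fin 3 → Bool,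
    (((s (Sum.elim μ β) : ℤ) : R) * (edgeWeight (dualFrobenius R) (dualBasis R) G (Sum.elim μ β) *
      vertexWeight (dualFrobenius R) (dualBasis R) β)) •
        leafWeight (dualFrobenius R) (dualBasis R) G (Sum.elim μ β)).smulRight
    (RedChain.of R (DualNumber R) fun i => dualBasis R (μ i))

section Induced

variable {R A : Type*} [CommRing R] [CommRing A] [Algebra R A] (ρ : Rotation R A)

/-- `f` induces a well-defined nonzero map `HH₀ → HH_p`. -/
def InducesNonzero {p : ℕ} (f : MultilinearMap R (fun _ : Fin 1 => A) (RedChain R A p)) : Prop :=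
  ∃ T : HH ρ 0 →ₗ[R] HH ρ p,
    (∀ a : A, ∃ h : f (fun _ => a) ∈ hochCycles ρ p,
      T (HH.zeroClass ρ a) = HH.mk ρ (f fun _ => a) h) ∧ T ≠ 0

/-- `f` induces a well-defined nonzero map `HH₀^{⊗m} → HH_p`. -/
def InducesNonzeroTensor {m p : ℕ} (f : MultilinearMap R (fun _ : Fin m => A) (RedChain R A p)) :
    Prop :=
  ∃ T : (⨂[R] _ : Fin m, HH ρ 0) →ₗ[R] HH ρ p,
    (∀ a : Fin m → A, ∃ h : f a ∈ hochCycles ρ p,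
      T (PiTensorProduct.tprod R fun j => HH.zeroClass ρ (a j)) = HH.mk ρ (f a) h) ∧ T ≠ 0

end Induced

end Sullivan

end

/-!
A half-edge at the white vertex of `μ_g` or `t_g` which hangs on the first tree can be slid along
this tree, so that pulling out the half-edges `2j`, `2j + 1` and pulling out `2j + 1`, `2j + 2` give
the same Sullivan diagram (also for the last and the first half-edge). These pairs come with
opposite signs, and both diagrams are cycles.

In the action on `R[x]/(x²)`, an edge has labels `1, x` and a black vertex has exactly one label `x`
in every labelling that contributes. Such a labelling of `μ_g` or `t_g` with `x` at all half-edges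
of the white vertex except the start is determined by propagation along the trees, and has `1` at
the start. Hence the operation sends `x, …, x` to `± 1 ⊗ x ⊗ … ⊗ x` in the reduced complex, and no
choice of signs can cause a cancellation.

The coefficient of `1 ⊗ x ⊗ … ⊗ x` vanishes on boundaries: every face of a tensor contributes the
sum of two neighbouring coefficients, with one entry `1` removed, and the alternating sum
telescopes. The same argument applies to Sullivan diagrams, through their action on `x, …, x`. So
neither `1 ⊗ x ⊗ … ⊗ x` nor the diagrams are boundaries.
-/

open scoped TensorProduct

noncomputable section

namespace Sullivan

variable {m k : ℕ}

/-! ### Sliding a half-edge along the edges of a graph -/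

/-- The Sullivan diagram of a graph. -/
abbrev BWGraph.toDiagram (G : BWGraph m k) : Diagram m k := Quot.mk Move G

/-- The bijection of half-edges that permutes the black vertices by `π` and shifts the enumeration
of the half-edges at `v` by `s v`. -/
def vertexPerm {V : Type} (π : Equiv.Perm V) (s : V → Fin 3) : Equiv.Perm (V × Fin 3) where
  toFun x := (π x.1, x.2 + s x.1)
  invFun x := (π.symm x.1, x.2 - s (π.symm x.1))
  left_inv x := by simp
  right_inv x := by simp

/-- The relabelling that moves the vertex `u`, which lies on the edge that ends at `(v, t)`, onto
the edge that starts at `(v, t + 2)`. -/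
def slidePerm {V : Type} [DecidableEq V] (u v : V) (t : Fin 3) : Equiv.Perm (V × Fin 3) :=
  Equiv.swap (u, 0) (v, t) * Equiv.swap (u, 1) (v, t + 2)

theorem slidePerm_eq {V : Type} [DecidableEq V] {u v : V} (huv : u ≠ v) (t : Fin 3) :
    vertexPerm (Equiv.swap u v) (fun w => if w = u then t + 2 else 0) *
      (Equiv.swap (u, 1) (v, 2) * Equiv.swap (v, 2) (v, 1) * Equiv.swap (v, 1) (u, 2)) *
      vertexPerm 1 (fun w => if w = u then 2 else if w = v then -t else 0) =
    slidePerm u v t := by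
  ext1 ⟨w, r⟩
  have hvu := huv.symm
  by_cases hu : w = u
  · subst hu
    fin_cases t <;> fin_cases r <;>
      simp +decide [vertexPerm, slidePerm, Equiv.swap_apply_def, huv, hvu]
  · by_cases hv : w = v
    · subst hv
      fin_cases t <;> fin_cases r <;>
        simp +decide [vertexPerm, slidePerm, Equiv.swap_apply_def, huv, hvu]
    · simp [vertexPerm, slidePerm, Equiv.swap_apply_def, hu, hv]

theorem toDiagram_relabel_vertexPerm (G : BWGraph m k) (π : Equiv.Perm G.V) (s : G.V → Fin 3) :
    (G.relabel G.V (Equiv.sumCongr (Equiv.refl (Fin k)) (vertexPerm π s))).toDiagram =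
      G.toDiagram := by
  refine (Quot.sound (Move.iso G G.V (vertexPerm π s) fun v t => ?_)).symm
  simp [vertexPerm, add_right_comm]

theorem toDiagram_relabel_slidePerm (G : BWGraph m k) {u v : G.V} (huv : u ≠ v) (t : Fin 3)
    (h : G.inv (Sum.inr (u, 1)) = Sum.inr (v, t)) :
    (G.relabel G.V (Equiv.sumCongr (Equiv.refl (Fin k)) (slidePerm u v t))).toDiagram =
      G.toDiagram := by
  set s₁ : G.V → Fin 3 := fun w => if w = u then 2 else if w = v then -t else 0 with hs₁
  set s₂ : G.V → Fin 3 := fun w => if w = u then t + 2 else 0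
  set G₁ := G.relabel G.V (Equiv.sumCongr (Equiv.refl (Fin k)) (vertexPerm 1 s₁))
  have h₁ : G₁.inv (Sum.inr (u, 0)) = Sum.inr (v, 0) := by
    have e1 : (vertexPerm 1 s₁).symm (u, 0) = (u, 1) := by
      rw [Equiv.symm_apply_eq]; simp +decide [vertexPerm, hs₁]
    have e2 : vertexPerm 1 s₁ (v, t) = (v, 0) := by simp [vertexPerm, hs₁, huv.symm]
    simp [G₁, e1, h, e2]
  have hflip : G₁.toDiagram = (G₁.relabel G₁.V (flipPerm k u v)).toDiagram :=
    Quot.sound (Move.flip G₁ u v huv h₁)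
  rw [← toDiagram_relabel_vertexPerm G 1 s₁, hflip,
    ← toDiagram_relabel_vertexPerm (G₁.relabel G₁.V (flipPerm k u v)) (Equiv.swap u v) s₂]
  congr 1
  refine Eq.trans ?_ (BWGraph.relabel_relabel ..).symm
  refine Eq.trans ?_ (BWGraph.relabel_relabel ..).symm
  congr 1
  rw [← slidePerm_eq huv t]
  ext1 x; rcases x with x | x <;> rfl

theorem BWGraph.addEdge_trans_of_comm {k' : ℕ} (G : BWGraph m k) {W : Type} [Fintype W]
    [DecidableEq W] (π : Equiv.Perm (HalfEdge k G.V ⊕ Bool))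
    (hπ : ∀ x, π (Sum.map G.inv not x) = Sum.map G.inv not (π x))
    (hleaf : ∀ h, G.inv h = h → π (Sum.inl h) = Sum.inl h)
    (e : HalfEdge k G.V ⊕ Bool ≃ HalfEdge k' W) :
    G.addEdge W (π.trans e) = G.addEdge W e := by
  refine BWGraph.ext_inv _ _ _ _ _ _ ?_ ?_
  · funext h
    simp [hπ]
  · funext j
    rcases hj : G.leaf j with _ | h
    · rfl
    · simp [hleaf h ((G.inv_eq_self_iff h).2 ⟨j, hj⟩)]

theorem BWGraph.addEdge_swap_inr {k' : ℕ} (G : BWGraph m k) {W : Type} [Fintype W]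
    [DecidableEq W] (e : HalfEdge k G.V ⊕ Bool ≃ HalfEdge k' W) :
    G.addEdge W ((Equiv.swap (Sum.inr false) (Sum.inr true)).trans e) = G.addEdge W e := by
  refine G.addEdge_trans_of_comm _ ?_ (fun h _ => ?_) e
  · rintro (h | _ | _) <;> simp [Equiv.swap_apply_def]
  · simp [Equiv.swap_apply_def]

-- Both sides cut the edge of `w` and reconnect its two ends to the ends of the new edge; they
-- differ in which of the two resulting edges is called the new one.
theorem BWGraph.addEdge_swap_inl {k' : ℕ} (G : BWGraph m k) {W : Type} [Fintype W]
    [DecidableEq W] {w : HalfEdge k G.V} (hw : G.inv w ≠ w)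
    (e : HalfEdge k G.V ⊕ Bool ≃ HalfEdge k' W) :
    G.addEdge W ((Equiv.swap (Sum.inl w) (Sum.inr true)).trans e) =
      G.addEdge W ((Equiv.swap (Sum.inl (G.inv w)) (Sum.inr false)).trans e) := by
  set a := Equiv.swap (Sum.inl (G.inv w) : HalfEdge k G.V ⊕ Bool) (Sum.inr false) with ha
  set b := Equiv.swap (Sum.inl w : HalfEdge k G.V ⊕ Bool) (Sum.inr true) with hb
  let σ : Equiv.Perm (HalfEdge k G.V ⊕ Bool) := Equiv.sumCongr G.inv_inv.toPerm Equiv.boolNot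
  have hab : Commute a b := (Equiv.Perm.disjoint_swap_swap (by simp [hw])).commute
  have hσa : σ * a = b * σ := by
    rw [ha, Equiv.mul_swap_eq_swap_mul]; simp [σ, hb, G.inv_inv w]
  have hσb : σ * b = a * σ := by
    rw [hb, Equiv.mul_swap_eq_swap_mul]; simp [σ, ha]
  have hσ : (a * b) * σ = σ * (a * b) := by
    rw [mul_assoc, ← hσa, ← mul_assoc, ← hσb, mul_assoc, hab.eq]
  have he : b.trans e = (a * b : Equiv.Perm _).trans (a.trans e) := by
    ext x : 1
    simp [ha]
  rw [he]
  refine G.addEdge_trans_of_comm _ (fun x => Equiv.congr_fun hσ x) (fun h hh => ?_) _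
  have hne : h ≠ w := fun e => hw (e ▸ hh)
  have hne' : h ≠ G.inv w := fun e => hw (by rw [← e, ← hh, e, G.inv_inv])
  simp [ha, hb, Equiv.swap_apply_def, hne, hne']

/-- The places of the half-edges after the half-edge `z` has been pulled off the white vertex: it
becomes the half-edge `2` of a new black vertex `none`, whose half-edges `0` and `1` are new. -/
def attachEquiv {V : Type} (z : Fin (k + 1)) :
    HalfEdge (k + 1) V ⊕ Bool ≃ HalfEdge k (Option V) where
  toFun
    | Sum.inl (Sum.inl j) => (finSuccEquiv' z j).elim (Sum.inr (none, 2)) Sum.inl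
    | Sum.inl (Sum.inr (v, t)) => Sum.inr (some v, t)
    | Sum.inr false => Sum.inr (none, 0)
    | Sum.inr true => Sum.inr (none, 1)
  invFun
    | Sum.inl j => Sum.inl (Sum.inl (z.succAbove j))
    | Sum.inr (some v, t) => Sum.inl (Sum.inr (v, t))
    | Sum.inr (none, t) =>
      if t = 0 then Sum.inr false else if t = 1 then Sum.inr true else Sum.inl (Sum.inl z)
  left_inv := by
    rintro ((j | ⟨v, t⟩) | (_ | _))
    · rcases hj : finSuccEquiv' z j with _ | j'
      · rw [finSuccEquiv'_eq_none] at hj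
        simp [← hj]
      · rw [finSuccEquiv'_eq_some] at hj
        simp [hj]
    · rfl
    · simp
    · simp
  right_inv := by
    rintro (j | ⟨_ | v, t⟩)
    · simp
    · fin_cases t <;> simp
    · rfl

/-- Pull the half-edge `z` off the white vertex, and attach it to the edge of `q`, on the left hand
side of someone who walks along this edge towards `q`. -/
abbrev BWGraph.attach (G : BWGraph m (k + 1)) (z : Fin (k + 1)) (q : HalfEdge (k + 1) G.V) :
    BWGraph m k :=
  G.addEdge (Option G.V) ((Equiv.swap (Sum.inl q) (Sum.inr false)).trans (attachEquiv z))

theorem attachEquiv_trans_slidePerm {V : Type} [DecidableEq V] (z : Fin (k + 1)) (v : V)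
    (t : Fin 3) :
    ((Equiv.swap (Sum.inl (Sum.inr (v, t))) (Sum.inr false)).trans (attachEquiv z)).trans
        (Equiv.sumCongr (Equiv.refl (Fin k)) (slidePerm none (some v) t)) =
      (Equiv.swap (Sum.inl (Sum.inr (v, t + 2))) (Sum.inr true)).trans (attachEquiv z) := by
  ext1 x
  rcases x with ((j | ⟨w, r⟩) | (_ | _))
  · simp only [Equiv.trans_apply, Equiv.swap_apply_def, reduceCtorEq, Sum.inl.injEq, if_false]
    rcases hj : finSuccEquiv' z j with _ | j' <;>
      simp [attachEquiv, hj, slidePerm, Equiv.swap_apply_def]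
  · by_cases h : w = v
    · subst h
      fin_cases t <;> fin_cases r <;>
        simp +decide [attachEquiv, slidePerm, Equiv.swap_apply_def]
    · simp [attachEquiv, slidePerm, Equiv.swap_apply_def, h]
  · simp [attachEquiv, slidePerm, Equiv.swap_apply_def]
  · simp [attachEquiv, slidePerm, Equiv.swap_apply_def]

theorem toDiagram_attach_inr (G : BWGraph m (k + 1)) (z : Fin (k + 1)) (v : G.V) (t : Fin 3)
    (hw : G.inv (Sum.inr (v, t + 2)) ≠ Sum.inr (v, t + 2)) :
    (G.attach z (Sum.inr (v, t))).toDiagram =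
      (G.attach z (G.inv (Sum.inr (v, t + 2)))).toDiagram := by
  have hnew : (G.attach z (Sum.inr (v, t))).inv (Sum.inr (none, 1)) = Sum.inr (some v, t) := by
    have e : (attachEquiv z).symm (Sum.inr (none, 1)) =
        (Sum.inr true : HalfEdge (k + 1) G.V ⊕ Bool) := rfl
    simp [e]
    rfl
  rw [← toDiagram_relabel_slidePerm (G.attach z (Sum.inr (v, t))) (by simp) t hnew]
  congr 1
  refine (BWGraph.relabel_addEdge ..).trans ?_
  rw [attachEquiv_trans_slidePerm]
  exact G.addEdge_swap_inl hw _

theorem succ_succAbove_of_ne {i j : Fin k} (h : j ≠ i) :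
    i.succ.succAbove j = i.castSucc.succAbove j := by
  rcases lt_or_gt_of_ne h with h | h
  · rw [Fin.succAbove_of_castSucc_lt _ _ (Fin.lt_def.2 (by simp; omega)),
      Fin.succAbove_of_castSucc_lt _ _ (Fin.lt_def.2 (by simpa using h))]
  · rw [Fin.succAbove_of_le_castSucc _ _ (Fin.le_def.2 (by simpa using h)),
      Fin.succAbove_of_le_castSucc _ _ (Fin.le_def.2 (by simp; omega))]

theorem mergeEquiv_eq_trans_attachEquiv {V : Type} [DecidableEq V] (i : Fin k) :
    (mergeEquiv i : HalfEdge (k + 1) V ⊕ Bool ≃ _) =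
      (Equiv.swap (Sum.inr false) (Sum.inr true)).trans
        ((Equiv.swap (Sum.inl (Sum.inl i.castSucc)) (Sum.inr true)).trans
          (attachEquiv i.succ)) := by
  ext1 x
  rcases x with ((j | ⟨v, t⟩) | (_ | _))
  · rcases hj : finSuccEquiv' i.castSucc j with _ | j'
    · obtain rfl := finSuccEquiv'_eq_none.1 hj
      simp [attachEquiv, mergeEquiv, Equiv.swap_apply_def]
    · obtain rfl := finSuccEquiv'_eq_some.1 hj
      by_cases h : j' = i
      · subst h
        rw [Fin.succAbove_castSucc_self] at hj ⊢
        simp [attachEquiv, mergeEquiv, Equiv.swap_apply_def, Fin.castSucc_lt_succ.ne', hj]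
      · have hj' : finSuccEquiv' i.succ (i.castSucc.succAbove j') = some j' := by
          rw [finSuccEquiv'_eq_some, succ_succAbove_of_ne h]
        simp [attachEquiv, mergeEquiv, hj', h, Equiv.swap_apply_def, Fin.succAbove_ne]
  · simp [attachEquiv, mergeEquiv, Equiv.swap_apply_def]
  · have hi : finSuccEquiv' i.succ i.castSucc = some i := by
      rw [finSuccEquiv'_eq_some]; simp
    simp [attachEquiv, mergeEquiv, hi]
  · simp [attachEquiv, mergeEquiv, Equiv.swap_apply_def]

theorem merge_eq_attach (G : BWGraph m (k + 1)) (i : Fin k)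
    (h : G.inv (Sum.inl i.castSucc) ≠ Sum.inl i.castSucc) :
    G.merge i = G.attach i.succ (G.inv (Sum.inl i.castSucc)) := by
  rw [BWGraph.merge, mergeEquiv_eq_trans_attachEquiv, G.addEdge_swap_inr, G.addEdge_swap_inl h]

theorem mergeEquiv_trans_vertexPerm {V : Type} [DecidableEq V] (i : Fin k) :
    (mergeEquiv i).trans (Equiv.sumCongr (Equiv.refl (Fin k))
      (vertexPerm 1 fun v : Option V => if v = none then 1 else 0)) =
    (Equiv.swap (Sum.inl (Sum.inl i.succ)) (Sum.inr false)).trans (attachEquiv i.castSucc) := by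
  ext1 x
  rcases x with ((j | ⟨v, t⟩) | (_ | _))
  · rcases hj : finSuccEquiv' i.castSucc j with _ | j'
    · obtain rfl := finSuccEquiv'_eq_none.1 hj
      simp [attachEquiv, mergeEquiv, Equiv.swap_apply_def, vertexPerm, Fin.castSucc_lt_succ.ne]
    · obtain rfl := finSuccEquiv'_eq_some.1 hj
      by_cases h : j' = i
      · subst h
        rw [Fin.succAbove_castSucc_self] at hj ⊢
        simp +decide [attachEquiv, mergeEquiv, vertexPerm, hj]
      · have hne : i.castSucc.succAbove j' ≠ i.succ := by
          rw [← Fin.succAbove_castSucc_self]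
          exact fun e => h (Fin.succAbove_right_injective e)
        simp [attachEquiv, mergeEquiv, hne, h, Equiv.swap_apply_def]
  · simp [attachEquiv, mergeEquiv, Equiv.swap_apply_def, vertexPerm]
  · have hi : finSuccEquiv' i.castSucc i.succ = some i := by
      rw [finSuccEquiv'_eq_some]; simp
    simp [attachEquiv, mergeEquiv, hi]
  · simp [attachEquiv, mergeEquiv, Equiv.swap_apply_def, vertexPerm]

theorem toDiagram_merge (G : BWGraph m (k + 1)) (i : Fin k) :
    (G.merge i).toDiagram = (G.attach i.castSucc (Sum.inl i.succ)).toDiagram := by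
  rw [← toDiagram_relabel_vertexPerm (G.merge i) 1 fun v : Option G.V => if v = none then 1 else 0]
  congr 1
  exact (BWGraph.relabel_addEdge ..).trans (congrArg _ (mergeEquiv_trans_vertexPerm i))

theorem attachEquiv_rotate {V : Type} (x : HalfEdge (k + 1) V ⊕ Bool) :
    attachEquiv 0 (Equiv.sumCongr (Equiv.sumCongr (finRotate (k + 1)) (Equiv.refl _))
      (Equiv.refl Bool) x) = attachEquiv (Fin.last k) x := by
  rcases x with ((j | ⟨v, t⟩) | (_ | _))
  · induction j using Fin.lastCases with
    | last => simp [attachEquiv]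
    | cast j =>
      have h1 : finSuccEquiv' 0 j.succ = some j := by rw [finSuccEquiv'_eq_some]; simp
      have h2 : finSuccEquiv' (Fin.last k) j.castSucc = some j := by
        rw [finSuccEquiv'_eq_some]; simp
      simp only [attachEquiv, Equiv.coe_fn_mk, Equiv.sumCongr_apply, Sum.map_inl]
      rw [h2, finRotate_apply, ← Fin.coeSucc_eq_succ] at *
      rw [h1]
  · rfl
  · rfl
  · rfl

theorem rotate_attach (G : BWGraph m (k + 1)) (q : HalfEdge (k + 1) G.V) :
    G.rotate.attach 0 (Equiv.sumCongr (finRotate (k + 1)) (Equiv.refl _) q) =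
      G.attach (Fin.last k) q := by
  refine (BWGraph.addEdge_relabel ..).trans (congrArg _ ?_)
  set ρ := Equiv.sumCongr (Equiv.sumCongr (finRotate (k + 1)) (Equiv.refl (G.V × Fin 3)))
    (Equiv.refl Bool)
  ext1 x
  have hswap : Equiv.swap (ρ (Sum.inl q)) (ρ (Sum.inr false)) (ρ x) =
      ρ (Equiv.swap (Sum.inl q) (Sum.inr false) x) := ρ.injective.swap_apply ..
  simp only [Equiv.trans_apply]
  rw [← attachEquiv_rotate]
  exact congrArg _ hswap

theorem toDiagram_rotate_merge (G : BWGraph m (k + 2)) :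
    (G.rotate.merge 0).toDiagram = (G.attach (Fin.last (k + 1)) (Sum.inl 0)).toDiagram := by
  rw [toDiagram_merge, ← rotate_attach]
  congr 2

/-! ### Combs -/

section Comb

variable {V : Type} {n : ℕ}

/-- The half-edges at which the edges along the spine of a comb with vertices `v` start: the first
edge starts at `base`, and every other edge at the vertex it leaves. -/
def spineStart (v : Fin n → V) (base : HalfEdge k V) : Fin (n + 1) → HalfEdge k V :=
  Fin.cons base fun i => Sum.inr (v i, 1)

/-- The half-edges at which the edges along the spine of a comb with vertices `v` end: the last edge
ends at the half-edge `tip` of the white vertex, and every other edge at the vertex it enters. -/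
def spineEnd (v : Fin n → V) (tip : Fin k) (j : Fin (n + 1)) : HalfEdge k V :=
  if h : j < n then Sum.inr (v ⟨j, h⟩, 0) else Sum.inl tip

@[simp]
theorem spineStart_zero (v : Fin n → V) (base : HalfEdge k V) : spineStart v base 0 = base := rfl

@[simp]
theorem spineStart_succ (v : Fin n → V) (base : HalfEdge k V) (i : Fin n) :
    spineStart v base i.succ = Sum.inr (v i, 1) := rfl

@[simp]
theorem spineEnd_castSucc (v : Fin n → V) (tip : Fin k) (i : Fin n) :
    spineEnd v tip i.castSucc = Sum.inr (v i, 0) := by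
  simp [spineEnd]

@[simp]
theorem spineEnd_last (v : Fin n → V) (tip : Fin k) :
    spineEnd v tip (Fin.last n) = Sum.inl tip := by
  simp [spineEnd]

theorem spineEnd_ne_inr_one (v : Fin n → V) (tip : Fin k) (j : Fin (n + 1)) (u : V) :
    spineEnd v tip j ≠ Sum.inr (u, 1) := by
  induction j using Fin.lastCases <;> simp

/-- The graph `G` contains a planar tree in the shape of a comb: the vertices `v 0, …, v (n - 1)`
lie one after the other on a path which starts at `base` and ends at the last tooth, and the other
teeth hang off these vertices. The teeth are half-edges at the white vertex; `base` may also be a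
leaf at `v 0`. -/
structure BWGraph.HasComb (G : BWGraph m k) (v : Fin n → G.V) (base : HalfEdge k G.V)
    (tooth : Fin (n + 1) → Fin k) : Prop where
  inv_spineStart : ∀ j, G.inv (spineStart v base j) = spineEnd v (tooth (Fin.last n)) j
  inv_two : ∀ i : Fin n, G.inv (Sum.inr (v i, 2)) = Sum.inl (tooth i.castSucc)

end Comb

namespace BWGraph.HasComb

section Incidence

variable {n : ℕ} {G : BWGraph m k} {v : Fin n → G.V} {base : HalfEdge k G.V}
  {tooth : Fin (n + 1) → Fin k}

theorem inv_spineEnd (hG : G.HasComb v base tooth) (j : Fin (n + 1)) :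
    G.inv (spineEnd v (tooth (Fin.last n)) j) = spineStart v base j := by
  rw [← hG.inv_spineStart, G.inv_inv]

theorem inv_base (hG : G.HasComb v base tooth) :
    G.inv base = spineEnd v (tooth (Fin.last n)) 0 :=
  hG.inv_spineStart 0

theorem inv_one (hG : G.HasComb v base tooth) (i : Fin n) :
    G.inv (Sum.inr (v i, 1)) = spineEnd v (tooth (Fin.last n)) i.succ :=
  hG.inv_spineStart i.succ

theorem inv_zero (hG : G.HasComb v base tooth) (i : Fin n) :
    G.inv (Sum.inr (v i, 0)) = spineStart v base i.castSucc := by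
  simpa using hG.inv_spineEnd i.castSucc

theorem inv_tooth_castSucc (hG : G.HasComb v base tooth) (i : Fin n) :
    G.inv (Sum.inl (tooth i.castSucc)) = Sum.inr (v i, 2) := by
  rw [← hG.inv_two, G.inv_inv]

theorem inv_tooth_last (hG : G.HasComb v base tooth) :
    G.inv (Sum.inl (tooth (Fin.last n))) = spineStart v base (Fin.last n) := by
  simpa using hG.inv_spineEnd (Fin.last n)

theorem inv_spineStart_ne (hG : G.HasComb v base tooth) (hbase : G.inv base ≠ base)
    (j : Fin (n + 1)) : G.inv (spineStart v base j) ≠ spineStart v base j := by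
  induction j using Fin.cases with
  | zero => exact hbase
  | succ i => rw [hG.inv_spineStart]; exact spineEnd_ne_inr_one v _ i.succ (v i)

theorem inv_tooth_ne (hG : G.HasComb v base tooth) (hbase : G.inv base ≠ base)
    (j : Fin (n + 1)) : G.inv (Sum.inl (tooth j)) ≠ Sum.inl (tooth j) := by
  induction j using Fin.lastCases with
  | last =>
    intro h
    refine hG.inv_spineStart_ne hbase (Fin.last n) ?_
    rw [← hG.inv_tooth_last, G.inv_inv, h]
  | cast i => simp [hG.inv_tooth_castSucc]

end Incidence

section Slide

variable {n : ℕ} {G : BWGraph m (k + 1)} {v : Fin n → G.V} {base : HalfEdge (k + 1) G.V}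
  {tooth : Fin (n + 1) → Fin (k + 1)}

theorem toDiagram_attach_spineEnd (hG : G.HasComb v base tooth) (z : Fin (k + 1))
    (j : Fin (n + 1)) :
    (G.attach z (spineEnd v (tooth (Fin.last n)) j)).toDiagram =
      (G.attach z (Sum.inl (tooth j))).toDiagram := by
  induction j using Fin.lastCases with
  | last => rw [spineEnd_last]
  | cast i =>
    rw [spineEnd_castSucc, toDiagram_attach_inr G z (v i) 0 (by simp [hG.inv_two]), zero_add,
      hG.inv_two]

theorem toDiagram_attach_inv_tooth (hG : G.HasComb v base tooth) (z : Fin (k + 1)) (i : Fin n) :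
    (G.attach z (G.inv (Sum.inl (tooth i.castSucc)))).toDiagram =
      (G.attach z (Sum.inl (tooth i.succ))).toDiagram := by
  have h2 : (2 + 2 : Fin 3) = 1 := rfl
  rw [hG.inv_tooth_castSucc, toDiagram_attach_inr G z (v i) 2, h2, hG.inv_one,
    hG.toDiagram_attach_spineEnd]
  rw [h2, hG.inv_one]
  exact spineEnd_ne_inr_one v _ i.succ (v i)

theorem toDiagram_attach_spineStart (hG : G.HasComb v base tooth) (hbase : G.inv base ≠ base)
    (z : Fin (k + 1)) (j : Fin (n + 1)) :
    (G.attach z (spineStart v base j)).toDiagram = (G.attach z base).toDiagram := by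
  induction j using Fin.induction with
  | zero => rw [spineStart_zero]
  | succ i ih =>
    have h1 : (1 + 2 : Fin 3) = 0 := rfl
    rw [spineStart_succ, toDiagram_attach_inr G z (v i) 1, h1, hG.inv_zero, ih]
    rw [h1, hG.inv_zero]
    have := hG.inv_spineStart_ne hbase i.castSucc
    rw [hG.inv_spineStart, spineEnd_castSucc] at this
    exact this.symm

end Slide

end BWGraph.HasComb

/-- The half-edges `2, 4, …, 2n + 2` at the white vertex. -/
def evenTooth (n : ℕ) (j : Fin (n + 1)) : Fin (2 * (n + 1) + 1 + 1) := ⟨2 * j + 2, by omega⟩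

/-- The half-edges `1, 3, …, 2n + 3` at the white vertex. -/
def oddTooth (n : ℕ) (j : Fin (n + 2)) : Fin (2 * (n + 1) + 1 + 1) := ⟨2 * j + 1, by omega⟩

section CombCycle

variable {n : ℕ} {G : BWGraph m (2 * (n + 1) + 1 + 1)} {v : Fin n → G.V}

theorem BWGraph.HasComb.inv_zero_ne (hG : G.HasComb v (Sum.inl 0) (evenTooth n)) :
    G.inv (Sum.inl 0) ≠ Sum.inl 0 := by
  have hspine : ∀ j, spineEnd v (evenTooth n (Fin.last n)) j ≠ Sum.inl 0 := fun j => by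
    induction j using Fin.lastCases <;> simp [evenTooth]
  rw [hG.inv_base]
  exact hspine 0

theorem BWGraph.HasComb.merge_even (hG : G.HasComb v (Sum.inl 0) (evenTooth n))
    (j : Fin (n + 1)) :
    G.toDiagram.merge ⟨2 * j, by omega⟩ = G.toDiagram.merge ⟨2 * j + 1, by omega⟩ := by
  have hodd : G.toDiagram.merge ⟨2 * j + 1, by omega⟩ =
      (G.attach ⟨2 * j + 1, by omega⟩ (Sum.inl (evenTooth n j))).toDiagram :=
    toDiagram_merge G ⟨2 * j + 1, by omega⟩
  rw [hodd]
  induction j using Fin.cases with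
  | zero =>
    refine (congrArg BWGraph.toDiagram (merge_eq_attach G 0 hG.inv_zero_ne)).trans ?_
    rw [Fin.castSucc_zero, hG.inv_base]
    exact hG.toDiagram_attach_spineEnd _ 0
  | succ i =>
    refine (congrArg BWGraph.toDiagram (merge_eq_attach G ⟨2 * i + 2, by omega⟩
      (hG.inv_tooth_ne hG.inv_zero_ne i.castSucc))).trans ?_
    exact hG.toDiagram_attach_inv_tooth _ i

theorem BWGraph.HasComb.merge_last (hG : G.HasComb v (Sum.inl 0) (evenTooth n)) :
    G.toDiagram.merge (Fin.last (2 * (n + 1))) = G.toDiagram.rotate.merge 0 := by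
  refine (congrArg BWGraph.toDiagram (merge_eq_attach G (Fin.last (2 * (n + 1)))
    (hG.inv_tooth_ne hG.inv_zero_ne (Fin.last n)))).trans ?_
  refine Eq.trans ?_ (toDiagram_rotate_merge G).symm
  change (G.attach _ (G.inv (Sum.inl (evenTooth n (Fin.last n))))).toDiagram = _
  rw [hG.inv_tooth_last]
  exact hG.toDiagram_attach_spineStart hG.inv_zero_ne _ _

theorem sum_single_neg_one_pow_eq_zero (R : Type*) [CommRing R] {α : Type*} (q : ℕ)
    (E : Fin (2 * q) → α)
    (h : ∀ j : Fin q, E ⟨2 * j, by omega⟩ = E ⟨2 * j + 1, by omega⟩) :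
    ∑ i, Finsupp.single (E i) ((-1 : R) ^ (i : ℕ)) = 0 := by
  induction q with
  | zero => rfl
  | succ q ih =>
    have hlast : E (Fin.last (2 * q + 1)) = E (Fin.last (2 * q)).castSucc := (h (Fin.last q)).symm
    have hinit := ih (fun i => E i.castSucc.castSucc) fun j => h j.castSucc
    refine (Fin.sum_univ_castSucc (n := 2 * q + 1) _).trans ?_
    refine (congrArg (· + _) (Fin.sum_univ_castSucc (n := 2 * q) _)).trans ?_
    simp only [Fin.val_castSucc, hinit, zero_add, hlast, Fin.val_last, ← Finsupp.single_add]
    simp [pow_succ]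

theorem boundaryGen_inl_eq_zero (R : Type*) [CommRing R] {q : ℕ} (D : Diagram m (2 * q + 1 + 1))
    (hmerge : ∀ j : Fin q, D.merge ⟨2 * j, by omega⟩ = D.merge ⟨2 * j + 1, by omega⟩)
    (hlast : D.merge (Fin.last (2 * q)) = D.rotate.merge 0) :
    boundaryGen R (2 * q) (Sum.inl D) = 0 := by
  have hpairs := sum_single_neg_one_pow_eq_zero R q
    (fun i => (Sum.inl (D.merge i.castSucc) : Gen m (2 * q))) fun j => congrArg Sum.inl (hmerge j)
  rw [boundaryGen, Fin.sum_univ_castSucc]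
  simp only [Fin.val_castSucc, hpairs, zero_add, hlast, Fin.val_last, ← Finsupp.single_add]
  simp [pow_succ]

theorem BWGraph.HasComb.boundary_eq_zero (R : Type*) [CommRing R]
    (hG : G.HasComb v (Sum.inl 0) (evenTooth n)) :
    boundary R (2 * (n + 1) + 1)
      (Finsupp.single (Sum.inl G.toDiagram : Gen m (2 * (n + 1) + 1)) 1) = 0 := by
  rw [boundary, Finsupp.linearCombination_single, one_smul]
  exact boundaryGen_inl_eq_zero R G.toDiagram hG.merge_even hG.merge_last

end CombCycle

theorem muGraph_hasComb (n : ℕ) : (muGraph n).HasComb id (Sum.inl 0) (evenTooth n) where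
  inv_spineStart j := by
    induction j using Fin.cases with
    | zero => by_cases hn : 0 < n <;> simp [muGraph, muInv, spineEnd, evenTooth, hn]
    | succ i => simp [muGraph, muInv, spineEnd, evenTooth]
  inv_two i := by simp [muGraph, muInv, evenTooth]

theorem tGraph_hasComb_inl (n : ℕ) :
    (tGraph n).HasComb Sum.inl (Sum.inl 0) (evenTooth n) where
  inv_spineStart j := by
    induction j using Fin.cases with
    | zero => by_cases hn : 0 < n <;> simp [tGraph, tInv, spineEnd, evenTooth, hn]
    | succ i => simp [tGraph, tInv, spineEnd, evenTooth]
  inv_two i := by simp [tGraph, tInv, evenTooth]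

theorem tGraph_hasComb_inr (n : ℕ) :
    (tGraph n).HasComb Sum.inr (Sum.inr (Sum.inr 0, 0)) (oddTooth n) where
  inv_spineStart j := by
    induction j using Fin.cases with
    | zero => simp [tGraph, tInv, spineEnd]
    | succ i => simp [tGraph, tInv, spineEnd, oddTooth]; rfl
  inv_two i := by simp [tGraph, tInv, oddTooth]

/-! ### Topological types -/

theorem nextPerm_inr {V : Type} (v : V) (t : Fin 3) :
    nextPerm k V (Sum.inr (v, t)) = Sum.inr (v, t + 1) := by
  simp [nextPerm]

theorem nextPerm_inl_castSucc {V : Type} (i : Fin k) :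
    nextPerm (k + 1) V (Sum.inl i.castSucc) = Sum.inl i.succ := by
  obtain ⟨i, hi⟩ := i
  exact congrArg Sum.inl (finRotate_of_lt hi)

theorem nextPerm_inl_last {V : Type} :
    nextPerm (k + 1) V (Sum.inl (Fin.last k)) = Sum.inl 0 :=
  congrArg Sum.inl finRotate_last

section Edges

variable (G : BWGraph m k)

theorem BWGraph.filter_mk_inv_eq {x : HalfEdge k G.V} (hx : G.inv x ≠ x) :
    ((Finset.univ.filter fun h => G.inv h ≠ h).filter fun h => s(h, G.inv h) = s(x, G.inv x)) =
      {x, G.inv x} := by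
  ext h
  simp only [Finset.mem_filter, Finset.mem_univ, true_and, Finset.mem_insert,
    Finset.mem_singleton, Sym2.eq_iff]
  constructor
  · rintro ⟨-, ⟨h, -⟩ | ⟨h, -⟩⟩
    exacts [Or.inl h, Or.inr h]
  · rintro (rfl | rfl)
    · exact ⟨hx, Or.inl ⟨rfl, rfl⟩⟩
    · exact ⟨by rwa [G.inv_inv, ne_comm], Or.inr ⟨rfl, G.inv_inv x⟩⟩

theorem BWGraph.card_filter_inv_ne :
    (Finset.univ.filter fun h => G.inv h ≠ h).card = 2 * G.edges.card := by
  rw [Finset.card_eq_sum_card_image (fun h => s(h, G.inv h)), ← BWGraph.edges, mul_comm,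
    ← smul_eq_mul, ← Finset.sum_const]
  refine Finset.sum_congr rfl fun e he => ?_
  obtain ⟨x, hx, rfl⟩ := Finset.mem_image.1 he
  have hx' : G.inv x ≠ x := (Finset.mem_filter.1 hx).2
  rw [G.filter_mk_inv_eq hx', Finset.card_pair hx'.symm]

theorem BWGraph.card_filter_inv_eq {l : Fin m → HalfEdge k G.V} (hl : ∀ j, G.leaf j = some (l j)) :
    (Finset.univ.filter fun h => G.inv h = h).card = m := by
  have himage : (Finset.univ.filter fun h => G.inv h = h) = Finset.univ.image l := by
    ext h
    simp [G.inv_eq_self_iff, hl]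
  rw [himage, Finset.card_image_of_injective, Finset.card_fin]
  exact fun i j hij => G.leaf_inj i j _ (hl i) (by rw [hl, hij])

theorem BWGraph.two_mul_card_edges_add {l : Fin m → HalfEdge k G.V}
    (hl : ∀ j, G.leaf j = some (l j)) :
    2 * G.edges.card + m = k + 3 * Fintype.card G.V := by
  have hsplit := Finset.card_filter_add_card_filter_not (s := Finset.univ)
    fun h : HalfEdge k G.V => G.inv h = h
  rw [G.card_filter_inv_eq hl, G.card_filter_inv_ne, add_comm] at hsplit
  simpa [mul_comm] using hsplit

end Edges

/-- Two half-edges of a graph lie in the same connected component: they are linked by a chain of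
half-edges of which any two consecutive ones are neighbours at a vertex or form an edge. -/
abbrev BWGraph.Linked (G : BWGraph m k) : HalfEdge k G.V → HalfEdge k G.V → Prop :=
  Relation.EqvGen fun x y => y = nextPerm k G.V x ∨ y = G.inv x

section Linked

variable (G : BWGraph m (k + 1))

theorem BWGraph.linked_zero_inl (i : Fin (k + 1)) : G.Linked (Sum.inl 0) (Sum.inl i) := by
  induction i using Fin.induction with
  | zero => exact .refl _
  | succ i ih => exact ih.trans _ _ _ (.rel _ _ (.inl (nextPerm_inl_castSucc i).symm))

theorem BWGraph.linked_inr_add (v : G.V) (t s : Fin 3) :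
    G.Linked (Sum.inr (v, t)) (Sum.inr (v, t + s)) := by
  induction s using Fin.induction with
  | zero => rw [add_zero]; exact .refl _
  | succ s ih =>
    refine ih.trans _ _ _ (.rel _ _ (.inl ?_))
    rw [nextPerm_inr, add_assoc, Fin.coeSucc_eq_succ]

theorem BWGraph.linked_of_inv_inr (t : G.V → Fin 3) (w : G.V → Fin (k + 1))
    (hw : ∀ v, G.inv (Sum.inr (v, t v)) = Sum.inl (w v)) (h h' : HalfEdge (k + 1) G.V) :
    G.Linked h h' := by
  have hzero : ∀ h, G.Linked (Sum.inl 0) h := by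
    rintro (i | ⟨v, s⟩)
    · exact G.linked_zero_inl i
    · have hedge : G.Linked (Sum.inl (w v)) (Sum.inr (v, t v)) :=
        .symm _ _ (.rel _ _ (.inr (hw v).symm))
      have hvertex := G.linked_inr_add v (t v) (s - t v)
      rw [add_sub_cancel] at hvertex
      exact (G.linked_zero_inl (w v)).trans _ _ _ (hedge.trans _ _ _ hvertex)
  exact (hzero h).symm.trans _ _ _ (hzero h')

end Linked

theorem apply_eq_of_sameCycle {α β : Type*} {σ : Equiv.Perm α} {f : α → β}
    (hf : ∀ x, f (σ x) = f x) {x y : α} (h : σ.SameCycle x y) : f x = f y := by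
  have hinv : ∀ x, f (σ⁻¹ x) = f x := fun x =>
    (hf _).symm.trans (congrArg f (σ.apply_symm_apply x))
  obtain ⟨i, rfl⟩ := h
  induction i using Int.induction_on with
  | zero => rfl
  | succ i ih => rwa [add_comm, zpow_one_add, Equiv.Perm.mul_apply, hf]
  | pred i ih =>
    rwa [sub_eq_add_neg, add_comm, zpow_add, zpow_neg_one, Equiv.Perm.mul_apply, hinv]

theorem card_quotient_sameCycle {α ι : Type*} {σ : Equiv.Perm α} (f : α → ι) (s : ι → α)
    (hf : ∀ x, f (σ x) = f x) (hfs : ∀ i, f (s i) = i) (hsf : ∀ x, σ.SameCycle (s (f x)) x) :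
    Nat.card (Quotient (Equiv.Perm.SameCycle.setoid σ)) = Nat.card ι :=
  Nat.card_congr
    { toFun := Quotient.lift f fun _ _ h => apply_eq_of_sameCycle hf h
      invFun := fun i => Quotient.mk _ (s i)
      left_inv := by rintro ⟨x⟩; exact Quotient.sound (hsf x)
      right_inv := hfs }

theorem BWGraph.sameCycle_inv (G : BWGraph m k) (h : HalfEdge k G.V) :
    G.boundaryPerm.SameCycle (G.inv h) (nextPerm k G.V h) :=
  ⟨1, congrArg (nextPerm k G.V) (G.inv_inv h)⟩

theorem BWGraph.sameCycle_inv_inr (G : BWGraph m k) (v : G.V) (t : Fin 3) :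
    G.boundaryPerm.SameCycle (G.inv (Sum.inr (v, t))) (Sum.inr (v, t + 1)) := by
  rw [← nextPerm_inr]
  exact G.sameCycle_inv _

namespace BWGraph.HasComb

section Cycles

variable {n : ℕ} {G : BWGraph m k} {v : Fin n → G.V} {base : HalfEdge k G.V}
  {tooth : Fin (n + 1) → Fin k}

theorem sameCycle_base_spineStart (hG : G.HasComb v base tooth) (j : Fin (n + 1)) :
    G.boundaryPerm.SameCycle base (spineStart v base j) := by
  induction j using Fin.induction with
  | zero => exact .refl _ _
  | succ i ih =>
    refine ih.trans ?_
    rw [← hG.inv_zero]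
    exact G.sameCycle_inv_inr (v i) 0

theorem sameCycle_base_nextPerm (hG : G.HasComb v base tooth) :
    G.boundaryPerm.SameCycle base (nextPerm k G.V (Sum.inl (tooth (Fin.last n)))) := by
  refine (hG.sameCycle_base_spineStart (Fin.last n)).trans ?_
  rw [← hG.inv_tooth_last]
  exact G.sameCycle_inv _

theorem sameCycle_tooth_castSucc (hG : G.HasComb v base tooth) (i : Fin n) :
    G.boundaryPerm.SameCycle (Sum.inl (tooth i.castSucc)) (Sum.inr (v i, 0)) := by
  rw [← hG.inv_two]
  exact G.sameCycle_inv_inr (v i) 2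

theorem sameCycle_tooth_spineEnd (hG : G.HasComb v base tooth) (j : Fin (n + 1)) :
    G.boundaryPerm.SameCycle (Sum.inl (tooth j)) (spineEnd v (tooth (Fin.last n)) j) := by
  induction j using Fin.lastCases with
  | last => rw [spineEnd_last]
  | cast i =>
    rw [spineEnd_castSucc]
    exact hG.sameCycle_tooth_castSucc i

theorem sameCycle_tooth_zero (hG : G.HasComb v base tooth) :
    G.boundaryPerm.SameCycle (Sum.inl (tooth 0)) (nextPerm k G.V base) := by
  refine (hG.sameCycle_tooth_spineEnd 0).trans ?_
  rw [← hG.inv_base]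
  exact G.sameCycle_inv base

theorem sameCycle_tooth_succ (hG : G.HasComb v base tooth) (i : Fin n) :
    G.boundaryPerm.SameCycle (Sum.inl (tooth i.succ)) (Sum.inr (v i, 2)) := by
  refine (hG.sameCycle_tooth_spineEnd i.succ).trans ?_
  rw [← hG.inv_one]
  exact G.sameCycle_inv_inr (v i) 1

theorem sameCycle_tooth_succ_nextPerm (hG : G.HasComb v base tooth) (i : Fin n) :
    G.boundaryPerm.SameCycle (Sum.inl (tooth i.succ))
      (nextPerm k G.V (Sum.inl (tooth i.castSucc))) := by
  refine (hG.sameCycle_tooth_succ i).trans ?_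
  rw [← hG.inv_tooth_castSucc]
  exact G.sameCycle_inv _

theorem sameCycle_inr (hG : G.HasComb v base tooth) {h : HalfEdge k G.V}
    (hbase : G.boundaryPerm.SameCycle h base)
    (htooth : ∀ j, G.boundaryPerm.SameCycle h (Sum.inl (tooth j))) (i : Fin n) (t : Fin 3) :
    G.boundaryPerm.SameCycle h (Sum.inr (v i, t)) := by
  fin_cases t
  · exact (htooth i.castSucc).trans (hG.sameCycle_tooth_castSucc i)
  · exact hbase.trans (hG.sameCycle_base_spineStart i.succ)
  · exact (htooth i.succ).trans (hG.sameCycle_tooth_succ i)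

end Cycles

end BWGraph.HasComb

section Teeth

variable {n : ℕ}

theorem eq_zero_or_tooth (i : Fin (2 * (n + 1) + 1 + 1)) :
    i = 0 ∨ (∃ j, i = oddTooth n j) ∨ ∃ j, i = evenTooth n j := by
  obtain ⟨i, hi⟩ := i
  obtain rfl | ⟨j, rfl | rfl⟩ : i = 0 ∨ ∃ j, i = 2 * j + 1 ∨ i = 2 * j + 2 := by
    rcases Nat.eq_zero_or_pos i with h | h
    exacts [Or.inl h, Or.inr ⟨(i - 1) / 2, by omega⟩]
  · exact Or.inl rfl
  · exact Or.inr (Or.inl ⟨⟨j, by omega⟩, rfl⟩)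
  · exact Or.inr (Or.inr ⟨⟨j, by omega⟩, rfl⟩)

theorem nextPerm_zero {V : Type} :
    nextPerm _ V (Sum.inl 0) = Sum.inl (oddTooth n 0) :=
  nextPerm_inl_castSucc 0

theorem nextPerm_oddTooth_castSucc {V : Type} (j : Fin (n + 1)) :
    nextPerm _ V (Sum.inl (oddTooth n j.castSucc)) = Sum.inl (evenTooth n j) :=
  nextPerm_inl_castSucc ⟨2 * j + 1, by omega⟩

theorem nextPerm_oddTooth_last {V : Type} :
    nextPerm _ V (Sum.inl (oddTooth n (Fin.last (n + 1)))) = Sum.inl 0 :=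
  nextPerm_inl_last

theorem nextPerm_evenTooth {V : Type} (j : Fin (n + 1)) :
    nextPerm _ V (Sum.inl (evenTooth n j)) = Sum.inl (oddTooth n j.succ) :=
  nextPerm_inl_castSucc ⟨2 * j + 2, by omega⟩

variable {G : BWGraph m (2 * (n + 1) + 1 + 1)} {v : Fin n → G.V}

theorem BWGraph.HasComb.sameCycle_zero_oddTooth_last
    (hG : G.HasComb v (Sum.inl 0) (evenTooth n)) :
    G.boundaryPerm.SameCycle (Sum.inl 0) (Sum.inl (oddTooth n (Fin.last (n + 1)))) := by
  simpa only [nextPerm_evenTooth, Fin.succ_last] using hG.sameCycle_base_nextPerm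

theorem BWGraph.HasComb.sameCycle_evenTooth_oddTooth
    (hG : G.HasComb v (Sum.inl 0) (evenTooth n)) (j : Fin (n + 1)) :
    G.boundaryPerm.SameCycle (Sum.inl (evenTooth n j)) (Sum.inl (oddTooth n j.castSucc)) := by
  induction j using Fin.cases with
  | zero => simpa only [nextPerm_zero, Fin.castSucc_zero] using hG.sameCycle_tooth_zero
  | succ i =>
    simpa only [nextPerm_evenTooth, Fin.castSucc_succ] using hG.sameCycle_tooth_succ_nextPerm i

end Teeth

/-- The number of the boundary cycle of a half-edge of `muGraph n`: the leaf labelled `j` lies in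
the cycle `j`. -/
def muFace (n : ℕ) : HalfEdge (2 * (n + 1) + 1 + 1) (Fin n) → Fin (n + 2)
  | Sum.inl i => if i = 0 then Fin.last (n + 1) else ⟨(i - 1) / 2, by omega⟩
  | Sum.inr (v, t) => ![v.castSucc.castSucc, Fin.last (n + 1), v.succ.castSucc] t

section MuFace

variable (n : ℕ)

theorem muFace_oddTooth (j : Fin (n + 2)) : muFace n (Sum.inl (oddTooth n j)) = j := by
  simp [muFace, oddTooth]

theorem muFace_evenTooth (j : Fin (n + 1)) :
    muFace n (Sum.inl (evenTooth n j)) = j.castSucc := by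
  ext
  simp [muFace, evenTooth]
  omega

theorem muFace_spineStart (j : Fin (n + 1)) :
    muFace n (spineStart id (Sum.inl 0) j) = Fin.last (n + 1) := by
  induction j using Fin.cases <;> simp [muFace]

theorem muFace_spineEnd (j : Fin (n + 1)) :
    muFace n (spineEnd id (evenTooth n (Fin.last n)) j) = j.castSucc := by
  induction j using Fin.lastCases with
  | last => rw [spineEnd_last, muFace_evenTooth]
  | cast i => simp [muFace]

theorem muFace_nextPerm (h : HalfEdge (2 * (n + 1) + 1 + 1) (Fin n)) :
    muFace n (nextPerm _ _ h) = muFace n ((muGraph n).inv h) := by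
  have hG := muGraph_hasComb n
  rcases h with i | ⟨v, t⟩
  · obtain rfl | ⟨j, rfl⟩ | ⟨j, rfl⟩ := eq_zero_or_tooth i
    · rw [nextPerm_zero, muFace_oddTooth]
      exact ((congrArg _ hG.inv_base).trans (muFace_spineEnd n 0)).symm
    · have hleaf : (muGraph n).inv (Sum.inl (oddTooth n j)) = Sum.inl (oddTooth n j) :=
        ((muGraph n).inv_eq_self_iff _).2 ⟨j, rfl⟩
      refine Eq.trans ?_ ((congrArg _ hleaf).trans (muFace_oddTooth n j)).symm
      induction j using Fin.lastCases with
      | last => rw [nextPerm_oddTooth_last]; rfl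
      | cast j => rw [nextPerm_oddTooth_castSucc, muFace_evenTooth]
    · rw [nextPerm_evenTooth, muFace_oddTooth]
      induction j using Fin.lastCases with
      | last => exact ((congrArg _ hG.inv_tooth_last).trans (muFace_spineStart n _)).symm
      | cast j => exact congrArg (muFace n) (hG.inv_tooth_castSucc j).symm
  · rw [nextPerm_inr]
    fin_cases t
    · exact ((congrArg _ (hG.inv_zero v)).trans (muFace_spineStart n _)).symm
    · exact ((congrArg _ (hG.inv_one v)).trans (muFace_spineEnd n _)).symm
    · exact ((congrArg _ (hG.inv_two v)).trans (muFace_evenTooth n _)).symm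

theorem muFace_boundaryPerm (h : HalfEdge (2 * (n + 1) + 1 + 1) (Fin n)) :
    muFace n ((muGraph n).boundaryPerm h) = muFace n h :=
  (muFace_nextPerm n ((muGraph n).inv h)).trans (congrArg _ ((muGraph n).inv_inv h))

theorem muGraph_sameCycle_muFace (h : HalfEdge (2 * (n + 1) + 1 + 1) (Fin n)) :
    (muGraph n).boundaryPerm.SameCycle (Sum.inl (oddTooth n (muFace n h))) h := by
  have hG := muGraph_hasComb n
  rcases h with i | ⟨v, t⟩
  · obtain rfl | ⟨j, rfl⟩ | ⟨j, rfl⟩ := eq_zero_or_tooth i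
    · exact hG.sameCycle_zero_oddTooth_last.symm
    · rw [muFace_oddTooth]
      exact .refl _ _
    · rw [muFace_evenTooth]
      exact (hG.sameCycle_evenTooth_oddTooth j).symm
  · fin_cases t
    · exact (hG.sameCycle_evenTooth_oddTooth v.castSucc).symm.trans
        (hG.sameCycle_tooth_castSucc v)
    · exact hG.sameCycle_zero_oddTooth_last.symm.trans (hG.sameCycle_base_spineStart v.succ)
    · exact (hG.sameCycle_evenTooth_oddTooth v.succ).symm.trans (hG.sameCycle_tooth_succ v)

end MuFace

theorem muGraph_isClosed (n : ℕ) : (muGraph n).IsClosed := by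
  rintro i j _ _ ⟨⟩ ⟨⟩ hij
  have hface := apply_eq_of_sameCycle (muFace_boundaryPerm n) hij
  exact (muFace_oddTooth n i).symm.trans (hface.trans (muFace_oddTooth n j))

theorem muGraph_hasType (n : ℕ) : (muGraph n).HasType 0 (n + 2) := by
  refine ⟨(muGraph n).linked_of_inv_inr (fun _ => 2) _ (muGraph_hasComb n).inv_two,
    fun _ => Option.some_ne_none _, ?_, ?_⟩
  · exact (card_quotient_sameCycle (muFace n) (fun j => Sum.inl (oddTooth n j))
      (muFace_boundaryPerm n) (muFace_oddTooth n) (muGraph_sameCycle_muFace n)).trans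
      (Nat.card_fin _)
  · have hedges := (muGraph n).two_mul_card_edges_add fun _ => rfl
    have hvertices : Fintype.card (muGraph n).V = n := Fintype.card_fin n
    rw [hvertices] at hedges ⊢
    push_cast
    omega

section TGraph

variable (n : ℕ)

theorem tGraph_sameCycle_oddTooth (j : Fin (n + 2)) :
    (tGraph n).boundaryPerm.SameCycle (Sum.inl 0) (Sum.inl (oddTooth n j)) := by
  have hroot : (tGraph n).inv (Sum.inr (Sum.inr 0, 0)) = Sum.inr (Sum.inr 0, 0) :=
    ((tGraph n).inv_eq_self_iff _).2 ⟨0, rfl⟩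
  have hG := tGraph_hasComb_inr n
  induction j using Fin.induction with
  | zero =>
    have hzero := hG.sameCycle_base_nextPerm
    rw [nextPerm_oddTooth_last] at hzero
    have hodd := hG.sameCycle_tooth_spineEnd 0
    rw [← hG.inv_base, hroot] at hodd
    exact (hodd.trans hzero).symm
  | succ i ih =>
    have hsucc := hG.sameCycle_tooth_succ_nextPerm i
    rw [nextPerm_oddTooth_castSucc] at hsucc
    exact ih.trans
      (hsucc.trans ((tGraph_hasComb_inl n).sameCycle_evenTooth_oddTooth i)).symm

theorem tGraph_sameCycle_evenTooth (j : Fin (n + 1)) :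
    (tGraph n).boundaryPerm.SameCycle (Sum.inl 0) (Sum.inl (evenTooth n j)) :=
  (tGraph_sameCycle_oddTooth n j.castSucc).trans
    ((tGraph_hasComb_inl n).sameCycle_evenTooth_oddTooth j).symm

theorem tGraph_sameCycle (h : HalfEdge (2 * (n + 1) + 1 + 1) (tGraph n).V) :
    (tGraph n).boundaryPerm.SameCycle (Sum.inl 0) h := by
  rcases h with i | ⟨v | v, t⟩
  · obtain rfl | ⟨j, rfl⟩ | ⟨j, rfl⟩ := eq_zero_or_tooth i
    exacts [.refl _ _, tGraph_sameCycle_oddTooth n j, tGraph_sameCycle_evenTooth n j]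
  · exact (tGraph_hasComb_inl n).sameCycle_inr (.refl _ _) (tGraph_sameCycle_evenTooth n) v t
  · have hzero := (tGraph_hasComb_inr n).sameCycle_base_nextPerm
    rw [nextPerm_oddTooth_last] at hzero
    exact (tGraph_hasComb_inr n).sameCycle_inr hzero.symm (tGraph_sameCycle_oddTooth n) v t

theorem tGraph_isClosed : (tGraph n).IsClosed :=
  fun _ _ _ _ _ _ _ => Subsingleton.elim _ _

theorem tGraph_hasType : (tGraph n).HasType (n + 1) 1 := by
  refine ⟨(tGraph n).linked_of_inv_inr (fun _ => 2)
    (Sum.elim (fun v => evenTooth n v.castSucc) fun v => oddTooth n v.castSucc) ?_,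
    fun _ => Option.some_ne_none _, ?_, ?_⟩
  · rintro (v | v)
    exacts [(tGraph_hasComb_inl n).inv_two v, (tGraph_hasComb_inr n).inv_two v]
  · rw [card_quotient_sameCycle (fun _ => ()) (fun _ => Sum.inl 0) (fun _ => rfl) (fun _ => rfl)
      (tGraph_sameCycle n), Nat.card_unique]
  · have hedges := (tGraph n).two_mul_card_edges_add fun _ => rfl
    have hvertices : Fintype.card (tGraph n).V = n + (n + 1) := by
      change Fintype.card (Fin n ⊕ Fin (n + 1)) = _
      simp
    rw [hvertices] at hedges ⊢
    push_cast
    omega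

end TGraph

/-! ### Functionals on Hochschild homology -/

theorem sum_telescoping (R : Type*) {M : Type*} [CommRing R] [AddCommGroup M] [Module R M] {p : ℕ}
    (E : Fin (p + 1) → M) :
    E 0 + ∑ i : Fin p, (-1 : R) ^ ((i : ℕ) + 1) • (E i.castSucc + E i.succ)
      + (-1 : R) ^ (p + 1) • E (Fin.last p) = 0 := by
  induction p with
  | zero => simp
  | succ p ih =>
    have h := ih fun i => E i.castSucc
    rw [Fin.sum_univ_castSucc]
    simp only [Fin.val_castSucc, Fin.val_last, Fin.succ_last, Fin.succ_castSucc, Fin.castSucc_zero,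
      Nat.succ_eq_add_one] at h ⊢
    refine Eq.trans ?_ h
    rw [pow_succ _ (p + 1)]
    module

section Hochschild

variable {R A M : Type*} [CommRing R] [CommRing A] [Algebra R A] [AddCommGroup M] [Module R M]
  {p : ℕ}

theorem RedChain.of_eq_zero {a : Fin (p + 1) → A} (i : Fin (p + 1)) (ha : a i = 0) :
    RedChain.of R A a = 0 := by
  rw [RedChain.of, MultilinearMap.map_coord_zero _ i ha, map_zero]

theorem RedChain.of_eq_zero_of_eq_one {a : Fin (p + 1) → A} {i : Fin (p + 1)} (hi : i ≠ 0)
    (ha : a i = 1) : RedChain.of R A a = 0 :=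
  (Submodule.Quotient.mk_eq_zero _).2 (Submodule.subset_span ⟨a, i, hi, ha, rfl⟩)

theorem RedChain.of_smul_univ (c : Fin (p + 1) → R) (a : Fin (p + 1) → A) :
    RedChain.of R A (fun i => c i • a i) = (∏ i, c i) • RedChain.of R A a := by
  rw [RedChain.of, MultilinearMap.map_smul_univ, map_smul, RedChain.of]

theorem RedChain.hom_ext {φ ψ : RedChain R A p →ₗ[R] M}
    (h : ∀ a, φ (RedChain.of R A a) = ψ (RedChain.of R A a)) : φ = ψ :=
  Submodule.linearMap_qext _ (PiTensorProduct.ext (MultilinearMap.ext h))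

/-- The linear map on reduced Hochschild chains induced by a multilinear map which vanishes when
an entry other than the first is `1`. -/
def RedChain.lift (φ : MultilinearMap R (fun _ : Fin (p + 1) => A) M)
    (hφ : ∀ a i, i ≠ 0 → a i = 1 → φ a = 0) : RedChain R A p →ₗ[R] M :=
  (degenerate R A p).liftQ (PiTensorProduct.lift φ) (Submodule.span_le.2 (by
    rintro _ ⟨a, i, hi, ha, rfl⟩
    exact (PiTensorProduct.lift.tprod a).trans (hφ a i hi ha)))

@[simp]
theorem RedChain.lift_of (φ : MultilinearMap R (fun _ : Fin (p + 1) => A) M)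
    (hφ : ∀ a i, i ≠ 0 → a i = 1 → φ a = 0) (a : Fin (p + 1) → A) :
    RedChain.lift φ hφ (RedChain.of R A a) = φ a :=
  PiTensorProduct.lift.tprod a

variable (ρ : Rotation R A)

/-- The face of a Hochschild chain which rotates the last factor to the front and multiplies it
with the first one. -/
def lastFace (a : Fin (p + 2) → A) : RedChain R A p :=
  (degenerate R A p).mkQ (contract R A 0 (ρ.map (p + 1) (PiTensorProduct.tprod R a)))

theorem hoch_of (a : Fin (p + 2) → A) :
    hoch ρ (p + 1) (RedChain.of R A a) =
      ∑ i : Fin (p + 1), (-1 : R) ^ (i : ℕ) • RedChain.of R A (contractFun i a) +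
        (-1 : R) ^ (p + 1) • lastFace ρ a := by
  change (degenerate R A p).mkQ (hochPre ρ p (PiTensorProduct.tprod R a)) = _
  simp only [hochPre, LinearMap.add_apply, LinearMap.sum_apply, LinearMap.smul_apply,
    LinearMap.comp_apply, contract_tprod, map_add, map_sum, map_smul, RedChain.of, lastFace]

variable {ρ}

/-- The linear map on Hochschild homology induced by a cocycle. -/
def HH.lift (φ : RedChain R A p →ₗ[R] M) (hφ : φ ∘ₗ hoch ρ (p + 1) = 0) : HH ρ p →ₗ[R] M :=
  Submodule.liftQ _ (φ ∘ₗ (hochCycles ρ p).subtype) (by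
    rintro c ⟨b, hb⟩
    exact (congrArg φ hb).symm.trans (LinearMap.congr_fun hφ b))

@[simp]
theorem HH.lift_mk (φ : RedChain R A p →ₗ[R] M) (hφ : φ ∘ₗ hoch ρ (p + 1) = 0)
    (c : RedChain R A p) (hc : c ∈ hochCycles ρ p) : HH.lift φ hφ (HH.mk ρ c hc) = φ c :=
  rfl

theorem InducesNonzeroTensor.of_eq_smul {m : ℕ}
    {f : MultilinearMap R (fun _ : Fin m => A) (RedChain R A p)} {c : RedChain R A p}
    (hc : c ∈ hochCycles ρ p) (hc0 : HH.mk ρ c hc ≠ 0) (ψ : HH ρ 0 →ₗ[R] R)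
    (hf : ∀ a, f a = (∏ j, ψ (HH.zeroClass ρ (a j))) • c) {y : A}
    (hy : ψ (HH.zeroClass ρ y) = 1) : InducesNonzeroTensor ρ f := by
  let T : (⨂[R] _ : Fin m, HH ρ 0) →ₗ[R] R :=
    PiTensorProduct.lift ((MultilinearMap.mkPiAlgebra R (Fin m) R).compLinearMap fun _ => ψ)
  have hT : ∀ a : Fin m → A, T (PiTensorProduct.tprod R fun j => HH.zeroClass ρ (a j)) =
      ∏ j, ψ (HH.zeroClass ρ (a j)) := fun a => by simp [T]
  refine ⟨T.smulRight (HH.mk ρ c hc), fun a => ⟨?_, ?_⟩, fun h => hc0 ?_⟩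
  · rw [hf]
    exact Submodule.smul_mem _ _ hc
  · rw [LinearMap.smulRight_apply, hT]
    simp only [hf]
    rfl
  · simpa [hT, hy] using
      LinearMap.congr_fun h (PiTensorProduct.tprod R fun _ => HH.zeroClass ρ y)

theorem InducesNonzeroTensor.inducesNonzero
    {f : MultilinearMap R (fun _ : Fin 1 => A) (RedChain R A p)} (hf : InducesNonzeroTensor ρ f) :
    InducesNonzero ρ f := by
  obtain ⟨T, hT, hT0⟩ := hf
  let e : (⨂[R] _ : Fin 1, HH ρ 0) ≃ₗ[R] HH ρ 0 := PiTensorProduct.subsingletonEquiv 0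
  refine ⟨T ∘ₗ e.symm.toLinearMap, fun a => ?_, fun h => hT0 ?_⟩
  · obtain ⟨hmem, heq⟩ := hT fun _ => a
    exact ⟨hmem, by simpa [e] using heq⟩
  · rw [← LinearMap.comp_id T, ← e.symm_comp, ← LinearMap.comp_assoc, h, LinearMap.zero_comp]

end Hochschild

/-! ### The class of `1 ⊗ x ⊗ … ⊗ x` -/

section TopClass

variable (R : Type*) [CommRing R]

/-- The coefficient of `1 ⊗ x ⊗ … ⊗ x` in a reduced Hochschild chain. -/
def topCoeff (p : ℕ) : RedChain R (DualNumber R) p →ₗ[R] R :=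
  RedChain.lift ((MultilinearMap.mkPiAlgebra R (Fin (p + 1)) R).compLinearMap fun j =>
      if j = 0 then (TrivSqZeroExt.fstHom R R R).toLinearMap else TrivSqZeroExt.sndHom R R)
    fun a i hi ha => Finset.prod_eq_zero (Finset.mem_univ i) (by simp [hi, ha])

theorem topCoeff_of {p : ℕ} (a : Fin (p + 1) → DualNumber R) :
    topCoeff R p (RedChain.of R (DualNumber R) a) =
      TrivSqZeroExt.fst (a 0) * ∏ j : Fin p, TrivSqZeroExt.snd (a j.succ) :=
  (RedChain.lift_of _ _ a).trans (by simp [Fin.prod_univ_succ])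

/-- The coefficient of `x` in a Hochschild chain of degree zero. -/
def sndCoeff : RedChain R (DualNumber R) 0 →ₗ[R] R :=
  RedChain.lift
    ((MultilinearMap.mkPiAlgebra R (Fin 1) R).compLinearMap fun _ => TrivSqZeroExt.sndHom R R)
    fun _ i hi => (hi (Subsingleton.elim (α := Fin 1) i 0)).elim

theorem sndCoeff_of (a : Fin 1 → DualNumber R) :
    sndCoeff R (RedChain.of R (DualNumber R) a) = TrivSqZeroExt.snd (a 0) := by
  simp [sndCoeff]

/-- The chain `1 ⊗ x ⊗ … ⊗ x`. -/
abbrev topChain (p : ℕ) : RedChain R (DualNumber R) p :=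
  RedChain.of R (DualNumber R) (Fin.cons 1 fun _ => xElt R)

theorem topCoeff_topChain (p : ℕ) : topCoeff R p (topChain R p) = 1 := by
  simp [topCoeff_of]

theorem contractFun_zero_cons {A : Type*} [CommRing A] {p : ℕ} (u : A) (a : Fin (p + 1) → A) :
    contractFun 0 (Fin.cons u a : Fin (p + 2) → A) =
      Fin.cons (u * a 0) fun j : Fin p => a j.succ := by
  funext j
  refine Fin.cases ?_ (fun j => ?_) j <;> simp [contractFun, Fin.succ_ne_zero]

theorem contractFun_succ_zero {A : Type*} [CommRing A] {p : ℕ} (i : Fin p) (a : Fin (p + 2) → A) :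
    contractFun i.succ a 0 = a 0 := by
  simp [contractFun, (Fin.succ_ne_zero i).symm]

theorem contractFun_succ_succ {A : Type*} [CommRing A] {p : ℕ} (i : Fin p) (a : Fin (p + 2) → A)
    (j : Fin p) :
    contractFun i.succ a j.succ =
      if j = i then a i.castSucc.succ * a i.succ.succ else a (i.castSucc.succAbove j).succ := by
  simp [contractFun, Fin.succ_inj]

variable {R}

/-- The coefficient of the tensor of factors `1` at the positions `0` and `l + 1` and factors `x`
elsewhere. -/
def unitCoeff {p : ℕ} (a : Fin (p + 2) → DualNumber R) (l : Fin (p + 1)) : R :=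
  TrivSqZeroExt.fst (a 0) * (TrivSqZeroExt.fst (a l.succ) *
    ∏ j : Fin p, TrivSqZeroExt.snd (a (l.succAbove j).succ))

theorem topCoeff_contractFun_zero {p : ℕ} (a : Fin (p + 2) → DualNumber R) :
    topCoeff R p (RedChain.of R (DualNumber R) (contractFun 0 a)) = unitCoeff a 0 := by
  simp [topCoeff_of, unitCoeff, contractFun, Fin.succ_ne_zero, mul_assoc]


theorem topCoeff_contractFun_succ {p : ℕ} (a : Fin (p + 2) → DualNumber R) (i : Fin p) :
    topCoeff R p (RedChain.of R (DualNumber R) (contractFun i.succ a)) =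
      unitCoeff a i.castSucc + unitCoeff a i.succ := by
  let P := ∏ j ∈ Finset.univ.erase i, TrivSqZeroExt.snd (a (i.castSucc.succAbove j).succ)
  have hcast : ∏ j, TrivSqZeroExt.snd (a (i.castSucc.succAbove j).succ) =
      TrivSqZeroExt.snd (a i.succ.succ) * P := by
    rw [← Finset.mul_prod_erase _ _ (Finset.mem_univ i), Fin.succAbove_castSucc_self]
  have hsucc : ∏ j, TrivSqZeroExt.snd (a (i.succ.succAbove j).succ) =
      TrivSqZeroExt.snd (a i.castSucc.succ) * P := by
    rw [← Finset.mul_prod_erase _ _ (Finset.mem_univ i), Fin.succAbove_succ_self]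
    exact congrArg _ (Finset.prod_congr rfl fun j hj => by
      rw [succ_succAbove_of_ne (Finset.ne_of_mem_erase hj)])
  have hface : ∏ j : Fin p, TrivSqZeroExt.snd (contractFun i.succ a j.succ) =
      TrivSqZeroExt.snd (a i.castSucc.succ * a i.succ.succ) * P := by
    rw [← Finset.mul_prod_erase _ _ (Finset.mem_univ i), contractFun_succ_succ, if_pos rfl]
    exact congrArg _ (Finset.prod_congr rfl fun j hj => by
      rw [contractFun_succ_succ, if_neg (Finset.ne_of_mem_erase hj)])
  rw [topCoeff_of, hface, contractFun_succ_zero, unitCoeff, unitCoeff, hcast, hsucc,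
    TrivSqZeroExt.snd_mul]
  simp only [smul_eq_mul, MulOpposite.smul_eq_mul_unop, MulOpposite.unop_op]
  ring

/-- The rotations for which the last face has the same effect on the coefficient of
`1 ⊗ x ⊗ … ⊗ x`, on chains of degree one, and on the chain `1 ⊗ x ⊗ … ⊗ x` of odd degree as for
the rotation without signs. -/
structure Rotation.IsSphereLike (ρ : Rotation R (DualNumber R)) : Prop where
  topCoeff_lastFace : ∀ p (a : Fin (p + 2) → DualNumber R),
    topCoeff R p (lastFace ρ a) = unitCoeff a (Fin.last p)
  sndCoeff_lastFace : ∀ a : Fin 2 → DualNumber R,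
    sndCoeff R (lastFace ρ a) = TrivSqZeroExt.snd (a 0 * a 1)
  lastFace_top : ∀ q, lastFace ρ (Fin.cons 1 fun _ => xElt R : Fin (2 * q + 2) → DualNumber R) =
    RedChain.of R (DualNumber R) fun _ => xElt R

theorem plainRotation_tprod {A : Type*} [CommRing A] [Algebra R A] {p : ℕ} (a : Fin (p + 1) → A) :
    (plainRotation R A).map p (PiTensorProduct.tprod R a) =
      PiTensorProduct.tprod R (Fin.cons (a (Fin.last p)) fun j : Fin p => a j.castSucc) := by
  refine (PiTensorProduct.reindex_tprod _ _).trans (congrArg _ (funext fun j => ?_))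
  refine Fin.cases ?_ (fun j => ?_) j
  · rw [finRotate_symm_zero, Fin.cons_zero]
  · rw [finRotate_symm_succ, Fin.cons_succ]

theorem lastFace_plainRotation {A : Type*} [CommRing A] [Algebra R A] {p : ℕ}
    (a : Fin (p + 2) → A) :
    lastFace (plainRotation R A) a = RedChain.of R A
      (Fin.cons (a (Fin.last (p + 1)) * a 0) fun j : Fin p => a j.castSucc.succ) := by
  rw [lastFace, plainRotation_tprod, contract_tprod, contractFun_zero_cons]
  rfl

theorem lastFace_sphereRotation (N : ℕ) {p : ℕ} (a : Fin (p + 2) → DualNumber R) :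
    lastFace (sphereRotation R N) a =
      RedChain.of R (DualNumber R)
        (Fin.cons (TrivSqZeroExt.inl (TrivSqZeroExt.fst (a (Fin.last (p + 1)))) * a 0)
          fun j : Fin p => a j.castSucc.succ) +
      RedChain.of R (DualNumber R)
        (Fin.cons (TrivSqZeroExt.inr (TrivSqZeroExt.snd (a (Fin.last (p + 1)))) *
            signMap R N (a 0))
          fun j : Fin p => signMap R N (a j.castSucc.succ)) := by
  have hmap : ∀ f g : DualNumber R →ₗ[R] DualNumber R,
      PiTensorProduct.map (fun j : Fin (p + 2) => if j = 0 then f else g)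
          ((plainRotation R (DualNumber R)).map (p + 1) (PiTensorProduct.tprod R a)) =
        PiTensorProduct.tprod R
          (Fin.cons (f (a (Fin.last (p + 1)))) fun j : Fin (p + 1) => g (a j.castSucc)) := by
    intro f g
    rw [plainRotation_tprod, PiTensorProduct.map_tprod]
    congr 1
    funext j
    refine Fin.cases ?_ (fun j => ?_) j <;> simp [Fin.succ_ne_zero]
  simp only [lastFace, sphereRotation, LinearMap.comp_apply, LinearMap.add_apply, hmap, map_add,
    contract_tprod, contractFun_zero_cons, Fin.castSucc_zero]
  rfl

theorem plainRotation_isSphereLike : (plainRotation R (DualNumber R)).IsSphereLike where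
  topCoeff_lastFace p a := by
    simp [lastFace_plainRotation, topCoeff_of, unitCoeff, mul_assoc, mul_left_comm, ← Fin.succ_last]
  sndCoeff_lastFace a := by
    rw [lastFace_plainRotation, sndCoeff_of, Fin.cons_zero, mul_comm]
    rfl
  lastFace_top q := by
    rw [lastFace_plainRotation]
    congr 1
    funext j
    refine Fin.cases ?_ (fun j => ?_) j <;> simp [← Fin.succ_last]

theorem sphereRotation_isSphereLike (N : ℕ) : (sphereRotation R N).IsSphereLike where
  topCoeff_lastFace p a := by
    simp [lastFace_sphereRotation, topCoeff_of, unitCoeff, mul_assoc, mul_left_comm,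
      ← Fin.succ_last]
  sndCoeff_lastFace a := by
    simp [lastFace_sphereRotation, sndCoeff_of, signMap]
    ring
  lastFace_top q := by
    have hlast : (Fin.cons 1 fun _ => xElt R : Fin (2 * q + 2) → DualNumber R)
        (Fin.last (2 * q + 1)) = xElt R := by
      rw [← Fin.succ_last, Fin.cons_succ]
    let c : Fin (2 * q + 1) → R := Fin.cons 1 fun _ => (-1) ^ N
    have hc : ∏ j, c j = 1 := by
      simp [c, Fin.prod_univ_succ, ← pow_mul, mul_comm 2 q, ← mul_assoc]
    have hsign : (Fin.cons (xElt R * signMap R N 1) fun _ => signMap R N (xElt R) :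
        Fin (2 * q + 1) → DualNumber R) = fun j => c j • xElt R := by
      funext j
      refine Fin.cases ?_ (fun j => ?_) j <;> simp [c, signMap]
    rw [lastFace_sphereRotation, hlast, RedChain.of_eq_zero 0 (by simp), zero_add]
    refine (congrArg _ (Eq.trans ?_ hsign)).trans ((RedChain.of_smul_univ c _).trans ?_)
    · simp
    · rw [hc, one_smul]

variable {ρ : Rotation R (DualNumber R)}

theorem Rotation.IsSphereLike.topCoeff_comp_hoch (hρ : ρ.IsSphereLike) (p : ℕ) :
    topCoeff R p ∘ₗ hoch ρ (p + 1) = 0 := by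
  refine RedChain.hom_ext fun a => ?_
  refine (congrArg (topCoeff R p) (hoch_of ρ a)).trans ?_
  simp only [Fin.sum_univ_succ, map_add, map_sum, map_smul, topCoeff_contractFun_zero,
    topCoeff_contractFun_succ, hρ.topCoeff_lastFace, Fin.val_zero, Fin.val_succ, pow_zero, one_smul]
  exact sum_telescoping R (unitCoeff a)

theorem Rotation.IsSphereLike.sndCoeff_comp_hoch (hρ : ρ.IsSphereLike) :
    sndCoeff R ∘ₗ hoch ρ 1 = 0 := by
  refine RedChain.hom_ext fun a => ?_
  refine (congrArg (sndCoeff R) (hoch_of ρ a)).trans ?_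
  simp [sndCoeff_of, contractFun, hρ.sndCoeff_lastFace]

/-- The coefficient of `x` on `HH₀`. -/
def Rotation.IsSphereLike.sndHH (hρ : ρ.IsSphereLike) : HH ρ 0 →ₗ[R] R :=
  HH.lift (sndCoeff R) hρ.sndCoeff_comp_hoch

theorem Rotation.IsSphereLike.sndHH_zeroClass (hρ : ρ.IsSphereLike) (a : DualNumber R) :
    hρ.sndHH (HH.zeroClass ρ a) = TrivSqZeroExt.snd a :=
  sndCoeff_of R fun _ => a

theorem Rotation.IsSphereLike.topChain_mem (hρ : ρ.IsSphereLike) (q : ℕ) :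
    topChain R (2 * q + 1) ∈ hochCycles ρ (2 * q + 1) := by
  have hzero : contractFun 0 (Fin.cons 1 fun _ => xElt R : Fin (2 * q + 2) → DualNumber R) =
      fun _ => xElt R := by
    rw [contractFun_zero_cons]
    funext j
    refine Fin.cases ?_ (fun j => ?_) j <;> simp
  have hsucc : ∀ i : Fin (2 * q), RedChain.of R (DualNumber R)
      (contractFun i.succ (Fin.cons 1 fun _ => xElt R : Fin (2 * q + 2) → DualNumber R)) = 0 :=
    fun i => RedChain.of_eq_zero i.succ (by simp [contractFun])
  rw [hochCycles, LinearMap.mem_ker, hoch_of, hρ.lastFace_top, Fin.sum_univ_succ, hzero]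
  simp [hsucc, pow_succ]

theorem Rotation.IsSphereLike.inducesNonzeroTensor [Nontrivial R] (hρ : ρ.IsSphereLike)
    {q : ℕ} (u : ℤˣ)
    {f : MultilinearMap R (fun _ : Fin m => DualNumber R) (RedChain R (DualNumber R) (2 * q + 1))}
    (hf : ∀ a, f a = (((u : ℤ) : R) * ∏ j, TrivSqZeroExt.snd (a j)) • topChain R (2 * q + 1)) :
    InducesNonzeroTensor ρ f := by
  refine InducesNonzeroTensor.of_eq_smul (c := ((u : ℤ) : R) • topChain R (2 * q + 1))
    (Submodule.smul_mem _ _ (hρ.topChain_mem q)) (fun h => ?_) hρ.sndHH (fun a => ?_)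
    ((hρ.sndHH_zeroClass (xElt R)).trans (by simp))
  · have hu := congrArg (HH.lift (topCoeff R _) (hρ.topCoeff_comp_hoch _)) h
    rw [HH.lift_mk, map_smul, topCoeff_topChain, map_zero] at hu
    rcases Int.units_eq_one_or u with rfl | rfl <;> simp at hu
  · simp only [hf, hρ.sndHH_zeroClass, smul_smul, mul_comm]

end TopClass

/-! ### The contributing labellings -/

section Weights

variable (R : Type*) [CommRing R]

@[simp]
theorem dualBasis_false : dualBasis R false = 1 := by
  simp [dualBasis, Module.Basis.coe_ofEquivFun]

@[simp]
theorem dualBasis_true : dualBasis R true = xElt R := by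
  simp [dualBasis, Module.Basis.coe_ofEquivFun]

theorem dualBasis_coord_true (a : DualNumber R) :
    (dualBasis R).coord true a = TrivSqZeroExt.snd a := by
  simp [dualBasis, Module.Basis.coord_apply]

theorem dualFrobenius_copairing (i j : Bool) :
    (dualFrobenius R).copairing (dualBasis R) i j = if i ≠ j then 1 else 0 := by
  have h : (dualFrobenius R).comul 1 = dualBasis R false ⊗ₜ[R] dualBasis R true +
      dualBasis R true ⊗ₜ[R] dualBasis R false := by
    simp [dualFrobenius]
  rw [Frobenius.copairing, h, map_add, Finsupp.add_apply,
    Module.Basis.tensorProduct_repr_tmul_apply, Module.Basis.tensorProduct_repr_tmul_apply]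
  cases i <;> cases j <;> simp [-dualBasis_false, -dualBasis_true]

theorem dualFrobenius_vertex (i j l : Bool) :
    (dualFrobenius R).vertex (dualBasis R) i j l =
      if i.toNat + j.toNat + l.toNat = 1 then 1 else 0 := by
  rw [Frobenius.vertex]
  cases i <;> cases j <;> cases l <;> simp [dualFrobenius]

/-- A labelling of the half-edges by `1` and `x` contributes to the action on `R[x]/(x²)` if each
edge has exactly one half labelled by `x`, and each black vertex exactly one half-edge labelled by
`x`. The label `x` is encoded as `true`. -/
structure BWGraph.IsAdmissible (G : BWGraph m k) (c : HalfEdge k G.V → Bool) : Prop where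
  edge : ∀ h, G.inv h ≠ h → c h ≠ c (G.inv h)
  vertex : ∀ v, (c (Sum.inr (v, 0))).toNat + (c (Sum.inr (v, 1))).toNat +
    (c (Sum.inr (v, 2))).toNat = 1

open Classical in
theorem edgeWeight_dualFrobenius (G : BWGraph m k) (c : HalfEdge k G.V → Bool) :
    edgeWeight (dualFrobenius R) (dualBasis R) G c =
      if ∀ h, G.inv h ≠ h → c h ≠ c (G.inv h) then 1 else 0 := by
  rw [edgeWeight]
  split_ifs with hc
  · refine Finset.prod_eq_one fun e he => ?_
    obtain ⟨h, hh, rfl⟩ := Finset.mem_image.1 he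
    exact (dualFrobenius_copairing R _ _).trans (if_pos (hc h (Finset.mem_filter.1 hh).2))
  · push Not at hc
    obtain ⟨h, hh, heq⟩ := hc
    refine Finset.prod_eq_zero (i := s(h, G.inv h))
      (Finset.mem_image_of_mem _ (Finset.mem_filter.2 ⟨Finset.mem_univ _, hh⟩)) ?_
    exact (dualFrobenius_copairing R _ _).trans (if_neg (not_not.2 heq))

open Classical in
theorem vertexWeight_dualFrobenius {V : Type} [Fintype V] (β : V × Fin 3 → Bool) :
    vertexWeight (dualFrobenius R) (dualBasis R) β =
      if ∀ v, (β (v, 0)).toNat + (β (v, 1)).toNat + (β (v, 2)).toNat = 1 then 1 else 0 := by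
  simp only [vertexWeight, dualFrobenius_vertex, Finset.prod_ite_zero, Finset.prod_const_one,
    Finset.mem_univ, true_imp_iff]

open Classical in
theorem edgeWeight_mul_vertexWeight (G : BWGraph m k) (μ : Fin k → Bool)
    (β : G.V × Fin 3 → Bool) :
    edgeWeight (dualFrobenius R) (dualBasis R) G (Sum.elim μ β) *
      vertexWeight (dualFrobenius R) (dualBasis R) β =
    if G.IsAdmissible (Sum.elim μ β) then 1 else 0 := by
  have hadm : G.IsAdmissible (Sum.elim μ β) ↔
      (∀ h, G.inv h ≠ h → Sum.elim μ β h ≠ Sum.elim μ β (G.inv h)) ∧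
        ∀ v, (β (v, 0)).toNat + (β (v, 1)).toNat + (β (v, 2)).toNat = 1 :=
    ⟨fun h => ⟨h.edge, h.vertex⟩, fun h => ⟨h.1, h.2⟩⟩
  rw [edgeWeight_dualFrobenius, vertexWeight_dualFrobenius, ite_zero_mul_ite_zero, mul_one]
  exact if_congr hadm.symm rfl rfl

end Weights

section StdLabel

/-- The labelling with `1` at `i` and `x` elsewhere. -/
def oneAt (i : Fin k) (j : Fin k) : Bool := decide (j ≠ i)

@[simp]
theorem oneAt_eq_false_iff {i j : Fin k} : oneAt i j = false ↔ j = i := by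
  simp [oneAt]

@[simp]
theorem oneAt_eq_true_iff {i j : Fin k} : oneAt i j = true ↔ j ≠ i := by
  simp [oneAt]

theorem oneAt_zero : oneAt (0 : Fin (k + 1)) = Fin.cons false fun _ => true := by
  funext j
  induction j using Fin.cases <;> simp

/-- The labelling which has the label `1` exactly at the start half-edge of the white vertex and at
the half-edges `1`, `2` of the black vertices. -/
def stdLabel {V : Type} : HalfEdge (k + 1) V → Bool :=
  Sum.elim (oneAt 0) fun x => decide (x.2 = 0)

@[simp]
theorem stdLabel_inl {V : Type} (i : Fin (k + 1)) :
    stdLabel (Sum.inl i : HalfEdge (k + 1) V) = oneAt 0 i := rfl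

@[simp]
theorem stdLabel_inr {V : Type} (v : V) (t : Fin 3) :
    stdLabel (Sum.inr (v, t) : HalfEdge (k + 1) V) = decide (t = 0) := rfl

/-- The standard labelling is the only one that contributes to the coefficients of `1 ⊗ x ⊗ … ⊗ x`
and `x ⊗ x ⊗ … ⊗ x`, and all leaves have the label `x`. -/
structure BWGraph.HasStdLabel (G : BWGraph m (k + 1)) : Prop where
  admissible : G.IsAdmissible stdLabel
  unique : ∀ c, G.IsAdmissible c → (∀ i, i ≠ 0 → c (Sum.inl i) = true) → c = stdLabel
  leaf : ∀ j, ∃ h, G.leaf j = some h ∧ stdLabel h = true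

end StdLabel

theorem BWGraph.IsAdmissible.eq_not {G : BWGraph m k} {c : HalfEdge k G.V → Bool}
    (hc : G.IsAdmissible c) {h : HalfEdge k G.V} (hh : G.inv h ≠ h) : c h = !c (G.inv h) :=
  Bool.eq_not.2 (hc.edge h hh)

namespace BWGraph.HasComb

section Label

variable {n : ℕ} {G : BWGraph m k} {v : Fin n → G.V} {base : HalfEdge k G.V}
  {tooth : Fin (n + 1) → Fin k} {c : HalfEdge k G.V → Bool}

theorem label_two (hG : G.HasComb v base tooth) (hc : G.IsAdmissible c)
    (htooth : ∀ j, c (Sum.inl (tooth j)) = true) (i : Fin n) : c (Sum.inr (v i, 2)) = false := by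
  rw [hc.eq_not (by simp [hG.inv_two]), hG.inv_two, htooth, Bool.not_true]

theorem label_one (hG : G.HasComb v base tooth) (hc : G.IsAdmissible c) {i : Fin n}
    (hi : c (spineEnd v (tooth (Fin.last n)) i.succ) = true) : c (Sum.inr (v i, 1)) = false := by
  have hne : G.inv (Sum.inr (v i, 1)) ≠ Sum.inr (v i, 1) := by
    rw [hG.inv_one]
    exact spineEnd_ne_inr_one v _ _ _
  rw [hc.eq_not hne, hG.inv_one, hi, Bool.not_true]

theorem label_spineEnd (hG : G.HasComb v base tooth) (hc : G.IsAdmissible c)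
    (htooth : ∀ j, c (Sum.inl (tooth j)) = true) (j : Fin (n + 1)) :
    c (spineEnd v (tooth (Fin.last n)) j) = true := by
  induction j using Fin.reverseInduction with
  | last => simpa using htooth (Fin.last n)
  | cast i ih =>
    have hv := hc.vertex (v i)
    rw [hG.label_one hc ih, hG.label_two hc htooth] at hv
    simpa using hv

theorem label_inr (hG : G.HasComb v base tooth) (hc : G.IsAdmissible c)
    (htooth : ∀ j, c (Sum.inl (tooth j)) = true) (i : Fin n) (t : Fin 3) :
    c (Sum.inr (v i, t)) = decide (t = 0) := by
  fin_cases t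
  · simpa using hG.label_spineEnd hc htooth i.castSucc
  · exact hG.label_one hc (hG.label_spineEnd hc htooth i.succ)
  · exact hG.label_two hc htooth i

theorem label_base (hG : G.HasComb v base tooth) (hc : G.IsAdmissible c)
    (htooth : ∀ j, c (Sum.inl (tooth j)) = true) (hbase : G.inv base ≠ base) :
    c base = false := by
  rw [hc.eq_not hbase, hG.inv_base, hG.label_spineEnd hc htooth, Bool.not_true]

end Label

section StdLabel

variable {n : ℕ} {G : BWGraph m (k + 1)} {v : Fin n → G.V} {base : HalfEdge (k + 1) G.V}
  {tooth : Fin (n + 1) → Fin (k + 1)}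

theorem stdLabel_spineStart (hG : G.HasComb v base tooth) (htooth : ∀ j, tooth j ≠ 0)
    (hbase : G.inv base ≠ base → stdLabel base = false) (j : Fin (n + 1))
    (hj : G.inv (spineStart v base j) ≠ spineStart v base j) :
    stdLabel (spineStart v base j) ≠ stdLabel (G.inv (spineStart v base j)) := by
  have hstart : stdLabel (spineStart v base j) = false := by
    induction j using Fin.cases with
    | zero => exact hbase hj
    | succ i => simp
  have hend : stdLabel (spineEnd v (tooth (Fin.last n)) j) = true := by
    induction j using Fin.lastCases with
    | last => simpa using htooth _
    | cast i => simp
  rw [hG.inv_spineStart, hstart, hend]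
  exact Bool.false_ne_true

theorem stdLabel_spineEnd (hG : G.HasComb v base tooth) (htooth : ∀ j, tooth j ≠ 0)
    (hbase : G.inv base ≠ base → stdLabel base = false) (j : Fin (n + 1))
    (hj : G.inv (spineEnd v (tooth (Fin.last n)) j) ≠ spineEnd v (tooth (Fin.last n)) j) :
    stdLabel (spineEnd v (tooth (Fin.last n)) j) ≠
      stdLabel (G.inv (spineEnd v (tooth (Fin.last n)) j)) := by
  rw [hG.inv_spineEnd] at hj ⊢
  rw [← hG.inv_spineStart] at hj ⊢
  exact (hG.stdLabel_spineStart htooth hbase j hj.symm).symm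

theorem stdLabel_inr (hG : G.HasComb v base tooth) (htooth : ∀ j, tooth j ≠ 0)
    (hbase : G.inv base ≠ base → stdLabel base = false) (i : Fin n) (t : Fin 3)
    (hi : G.inv (Sum.inr (v i, t)) ≠ Sum.inr (v i, t)) :
    stdLabel (Sum.inr (v i, t) : HalfEdge (k + 1) G.V) ≠ stdLabel (G.inv (Sum.inr (v i, t))) := by
  fin_cases t
  · have hend := hG.stdLabel_spineEnd htooth hbase i.castSucc
    rw [spineEnd_castSucc] at hend
    exact hend hi
  · exact hG.stdLabel_spineStart htooth hbase i.succ hi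
  · simp [hG.inv_two, htooth]

theorem stdLabel_tooth (hG : G.HasComb v base tooth) (htooth : ∀ j, tooth j ≠ 0)
    (hbase : G.inv base ≠ base → stdLabel base = false) (j : Fin (n + 1))
    (hj : G.inv (Sum.inl (tooth j)) ≠ Sum.inl (tooth j)) :
    stdLabel (Sum.inl (tooth j) : HalfEdge (k + 1) G.V) ≠ stdLabel (G.inv (Sum.inl (tooth j))) := by
  induction j using Fin.lastCases with
  | last =>
    have hend := hG.stdLabel_spineEnd htooth hbase (Fin.last n)
    rw [spineEnd_last] at hend
    exact hend hj
  | cast i => simp [hG.inv_tooth_castSucc, htooth]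

end StdLabel

end BWGraph.HasComb

theorem evenTooth_ne_zero (n : ℕ) (j : Fin (n + 1)) : evenTooth n j ≠ 0 :=
  Fin.ne_of_val_ne (Nat.succ_ne_zero _)

theorem oddTooth_ne_zero (n : ℕ) (j : Fin (n + 2)) : oddTooth n j ≠ 0 :=
  Fin.ne_of_val_ne (Nat.succ_ne_zero _)

theorem muGraph_inv_oddTooth (n : ℕ) (j : Fin (n + 2)) :
    (muGraph n).inv (Sum.inl (oddTooth n j)) = Sum.inl (oddTooth n j) :=
  ((muGraph n).inv_eq_self_iff _).2 ⟨j, rfl⟩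

theorem muGraph_hasStdLabel (n : ℕ) : (muGraph n).HasStdLabel where
  admissible := by
    have hG := muGraph_hasComb n
    refine ⟨?_, fun v => by simp⟩
    rintro (i | ⟨v, t⟩)
    · obtain rfl | ⟨j, rfl⟩ | ⟨j, rfl⟩ := eq_zero_or_tooth i
      · exact hG.stdLabel_spineStart (evenTooth_ne_zero n) (fun _ => rfl) 0
      · exact fun h => (h (muGraph_inv_oddTooth n j)).elim
      · exact hG.stdLabel_tooth (evenTooth_ne_zero n) (fun _ => rfl) j
    · exact hG.stdLabel_inr (evenTooth_ne_zero n) (fun _ => rfl) v t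
  unique c hc h := by
    have hG := muGraph_hasComb n
    have htooth j : c (Sum.inl (evenTooth n j)) = true := h _ (evenTooth_ne_zero n j)
    funext x
    rcases x with i | ⟨v, t⟩
    · obtain rfl | hi := eq_or_ne i 0
      · exact hG.label_base hc htooth hG.inv_zero_ne
      · exact (h i hi).trans (oneAt_eq_true_iff.2 hi).symm
    · exact hG.label_inr hc htooth v t
  leaf j := ⟨_, rfl, oneAt_eq_true_iff.2 (oddTooth_ne_zero n j)⟩

theorem tGraph_hasStdLabel (n : ℕ) : (tGraph n).HasStdLabel where
  admissible := by
    have hG := tGraph_hasComb_inl n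
    have hG' := tGraph_hasComb_inr n
    have hbase : (tGraph n).inv (Sum.inr (Sum.inr 0, 0)) = Sum.inr (Sum.inr 0, 0) :=
      ((tGraph n).inv_eq_self_iff _).2 ⟨0, rfl⟩
    refine ⟨?_, fun v => by simp⟩
    rintro (i | ⟨v | v, t⟩)
    · obtain rfl | ⟨j, rfl⟩ | ⟨j, rfl⟩ := eq_zero_or_tooth i
      · exact hG.stdLabel_spineStart (evenTooth_ne_zero n) (fun _ => rfl) 0
      · exact hG'.stdLabel_tooth (oddTooth_ne_zero n) (absurd hbase) j
      · exact hG.stdLabel_tooth (evenTooth_ne_zero n) (fun _ => rfl) j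
    · exact hG.stdLabel_inr (evenTooth_ne_zero n) (fun _ => rfl) v t
    · exact hG'.stdLabel_inr (oddTooth_ne_zero n) (absurd hbase) v t
  unique c hc h := by
    have hG := tGraph_hasComb_inl n
    have htooth j : c (Sum.inl (evenTooth n j)) = true := h _ (evenTooth_ne_zero n j)
    funext x
    rcases x with i | ⟨v | v, t⟩
    · obtain rfl | hi := eq_or_ne i 0
      · exact hG.label_base hc htooth hG.inv_zero_ne
      · exact (h i hi).trans (oneAt_eq_true_iff.2 hi).symm
    · exact hG.label_inr hc htooth v t
    · exact (tGraph_hasComb_inr n).label_inr hc (fun j => h _ (oddTooth_ne_zero n j)) v t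
  leaf _ := ⟨_, rfl, rfl⟩

/-! ### The action of a graph with standard labelling -/

section Action

variable {R : Type*} [CommRing R] {p : ℕ} {G : BWGraph m (p + 1)}

/-- The coefficient `amplitude` with the signs of `signedAction`. -/
def signedAmplitude (R : Type*) [CommRing R] (G : BWGraph m k)
    (s : (HalfEdge k G.V → Bool) → ℤˣ) (μ : Fin k → Bool) :
    MultilinearMap R (fun _ : Fin m => DualNumber R) R :=
  ∑ β : G.V × Fin 3 → Bool,
    (((s (Sum.elim μ β) : ℤ) : R) * (edgeWeight (dualFrobenius R) (dualBasis R) G (Sum.elim μ β) *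
      vertexWeight (dualFrobenius R) (dualBasis R) β)) •
        leafWeight (dualFrobenius R) (dualBasis R) G (Sum.elim μ β)

theorem signedAmplitude_one (G : BWGraph m k) :
    signedAmplitude R G (fun _ => 1) = amplitude (dualFrobenius R) (dualBasis R) G := by
  funext μ
  simp [signedAmplitude, amplitude]

theorem BWGraph.HasStdLabel.leafWeight (hG : G.HasStdLabel) (a : Fin m → DualNumber R) :
    Sullivan.leafWeight (dualFrobenius R) (dualBasis R) G stdLabel a =
      ∏ j, TrivSqZeroExt.snd (a j) := by
  rw [Sullivan.leafWeight, MultilinearMap.compLinearMap_apply, MultilinearMap.mkPiAlgebra_apply]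
  refine Finset.prod_congr rfl fun j _ => ?_
  obtain ⟨h, hleaf, hlabel⟩ := hG.leaf j
  rw [hleaf, Option.elim_some, hlabel, dualBasis_coord_true]

theorem BWGraph.HasStdLabel.signedAmplitude_oneAt (hG : G.HasStdLabel)
    (s : (HalfEdge (p + 1) G.V → Bool) → ℤˣ) (a : Fin m → DualNumber R) :
    signedAmplitude R G s (oneAt 0) a = ((s stdLabel : ℤ) : R) * ∏ j, TrivSqZeroExt.snd (a j) := by
  classical
  rw [signedAmplitude, Finset.sum_eq_single fun x : G.V × Fin 3 => decide (x.2 = 0)]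
  · have hone := (edgeWeight_mul_vertexWeight R G (oneAt 0) fun x => decide (x.2 = 0)).trans
      (if_pos hG.admissible)
    rw [hone, mul_one]
    exact congrArg (((s stdLabel : ℤ) : R) * ·) (hG.leafWeight a)
  · intro β _ hβ
    have hadm : ¬G.IsAdmissible (Sum.elim (oneAt 0) β) := fun hc => hβ <| by
      have hstd := hG.unique _ hc fun i hi => oneAt_eq_true_iff.2 hi
      exact funext fun x => congrFun hstd (Sum.inr x)
    rw [edgeWeight_mul_vertexWeight, if_neg hadm, mul_zero, zero_smul]
  · exact fun h => (h (Finset.mem_univ _)).elim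

theorem BWGraph.HasStdLabel.signedAmplitude_eq_zero (hG : G.HasStdLabel)
    (s : (HalfEdge (p + 1) G.V → Bool) → ℤˣ) {μ : Fin (p + 1) → Bool}
    (hμ : ∀ i, i ≠ 0 → μ i = true) (hne : μ ≠ oneAt 0) : signedAmplitude R G s μ = 0 := by
  classical
  refine Finset.sum_eq_zero fun β _ => ?_
  have hadm : ¬G.IsAdmissible (Sum.elim μ β) := fun hc =>
    hne <| funext fun i => congrFun (hG.unique _ hc hμ) (Sum.inl i)
  rw [edgeWeight_mul_vertexWeight, if_neg hadm, mul_zero, zero_smul]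

theorem BWGraph.HasStdLabel.signedAction_eq (hG : G.HasStdLabel)
    (s : (HalfEdge (p + 1) G.V → Bool) → ℤˣ) (a : Fin m → DualNumber R) :
    signedAction R G s a =
      (((s stdLabel : ℤ) : R) * ∏ j, TrivSqZeroExt.snd (a j)) • topChain R p := by
  change (∑ μ, (signedAmplitude R G s μ).smulRight _) a = _
  rw [sum_apply, Finset.sum_eq_single (oneAt 0)]
  · rw [MultilinearMap.smulRight_apply, hG.signedAmplitude_oneAt, topChain, oneAt_zero]
    congr 2
    funext i
    induction i using Fin.cases <;> simp
  · intro μ _ hne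
    rw [MultilinearMap.smulRight_apply]
    by_cases hμ : ∀ i, i ≠ 0 → μ i = true
    · rw [hG.signedAmplitude_eq_zero s hμ hne, zero_apply, zero_smul]
    · push Not at hμ
      obtain ⟨i, hi, hμi⟩ := hμ
      rw [RedChain.of_eq_zero_of_eq_one hi (by simp [hμi]), smul_zero]
  · exact fun h => (h (Finset.mem_univ _)).elim

theorem BWGraph.HasStdLabel.dualAction_single (hG : G.HasStdLabel) (a : Fin m → DualNumber R) :
    dualAction R (Finsupp.single (Sum.inl G.toDiagram : Gen m p) 1) a =
      (∏ j, TrivSqZeroExt.snd (a j)) • topChain R p := by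
  have h : dualAction R (Finsupp.single (Sum.inl G.toDiagram : Gen m p) 1) =
      signedAction R G fun _ => 1 := by
    rw [dualAction, action, Finsupp.linearCombination_single, one_smul]
    exact Finset.sum_congr rfl fun μ _ => congrArg (MultilinearMap.smulRight · _)
      (congrFun (signedAmplitude_one G) μ).symm
  rw [h, hG.signedAction_eq, Units.val_one, Int.cast_one, one_mul]

end Action

/-! ### Merging half-edges at the white vertex -/

section Merge

variable {R A : Type*} [CommRing R] [CommRing A] [Algebra R A] {ι : Type}
  (Φ : Frobenius R A) (b : Module.Basis ι R A)

theorem edges_addEdge {k' : ℕ} (G : BWGraph m k) (W : Type) [Fintype W] [DecidableEq W]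
    (e : HalfEdge k G.V ⊕ Bool ≃ HalfEdge k' W) :
    (G.addEdge W e).edges =
      insert s(e (Sum.inr false), e (Sum.inr true))
        (G.edges.image (Sym2.map fun h => e (Sum.inl h))) := by
  ext x
  simp only [BWGraph.edges, Finset.mem_insert, Finset.mem_image, Finset.mem_filter,
    Finset.mem_univ, true_and]
  constructor
  · rintro ⟨h, hh, rfl⟩
    obtain ⟨y | (_ | _), rfl⟩ := e.surjective h
    · exact Or.inr ⟨_, ⟨y, fun h' => hh (by simp [h']), rfl⟩, by simp⟩
    · exact Or.inl (by simp)
    · exact Or.inl (by simp [Sym2.eq_swap])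
  · rintro (rfl | ⟨_, ⟨h, hh, rfl⟩, rfl⟩)
    · exact ⟨e (Sum.inr false), by simp, by simp⟩
    · exact ⟨e (Sum.inl h), by simpa using hh, by simp⟩

theorem edgeWeight_addEdge {k' : ℕ} (G : BWGraph m k) (W : Type) [Fintype W] [DecidableEq W]
    (e : HalfEdge k G.V ⊕ Bool ≃ HalfEdge k' W) (c : HalfEdge k' W → ι) :
    edgeWeight Φ b (G.addEdge W e) c =
      Φ.copairing b (c (e (Sum.inr false))) (c (e (Sum.inr true))) *
        edgeWeight Φ b G fun h => c (e (Sum.inl h)) := by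
  have hnew : s(e (Sum.inr false), e (Sum.inr true)) ∉
      G.edges.image (Sym2.map fun h => e (Sum.inl h)) := by
    intro h
    obtain ⟨x, -, hx⟩ := Finset.mem_image.1 h
    have hmem : e (Sum.inr false) ∈ Sym2.map (fun h => e (Sum.inl h)) x := by simp [hx]
    obtain ⟨y, -, hy⟩ := Sym2.mem_map.1 hmem
    simp at hy
  have hinj : Function.Injective fun h => e (Sum.inl h) := e.injective.comp Sum.inl_injective
  rw [edgeWeight, edges_addEdge, Finset.prod_insert hnew,
    Finset.prod_image (Sym2.map.injective hinj).injOn]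
  simp only [edgeWeight, Sym2.map_map]
  rfl

theorem leafWeight_addEdge {k' : ℕ} (G : BWGraph m k) (W : Type) [Fintype W] [DecidableEq W]
    (e : HalfEdge k G.V ⊕ Bool ≃ HalfEdge k' W) (c : HalfEdge k' W → ι) :
    leafWeight Φ b (G.addEdge W e) c = leafWeight Φ b G fun h => c (e (Sum.inl h)) := by
  refine congrArg (MultilinearMap.compLinearMap _) (funext fun j => ?_)
  change ((G.leaf j).map _).elim _ _ = _
  rcases G.leaf j with _ | h <;> rfl

/-- Labellings of the half-edges at the vertices `Option V`, split into the labels at the vertex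
`none` and those at the vertices `some v`. -/
def optionLabelEquiv (V ι : Type) :
    (ι × ι × ι) × (V × Fin 3 → ι) ≃ (Option V × Fin 3 → ι) where
  toFun q
    | (none, t) => ![q.1.1, q.1.2.1, q.1.2.2] t
    | (some v, t) => q.2 (v, t)
  invFun β := ((β (none, 0), β (none, 1), β (none, 2)), fun x => β (some x.1, x.2))
  left_inv _ := rfl
  right_inv β := by
    funext ⟨v, t⟩
    rcases v with _ | v
    · fin_cases t <;> rfl
    · rfl

theorem vertexWeight_optionLabelEquiv {V : Type} [Fintype V] (x y z : ι) (β : V × Fin 3 → ι) :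
    vertexWeight Φ b (optionLabelEquiv V ι ((x, y, z), β)) =
      Φ.vertex b x y z * vertexWeight Φ b β :=
  Fintype.prod_option _

/-- The tuple `μ` with its entry at `i` replaced by the two entries `y` and `z`. -/
def splitEntry (i : Fin k) (y z : ι) (μ : Fin k → ι) : Fin (k + 1) → ι :=
  Fin.insertNth (α := fun _ => ι) i.castSucc y (Function.update μ i z)

theorem label_mergeEquiv {V : Type} (i : Fin k) (x y z : ι) (μ : Fin k → ι) (β : V × Fin 3 → ι) :
    (fun h => Sum.elim μ (optionLabelEquiv V ι ((x, y, z), β)) (mergeEquiv i (Sum.inl h))) =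
      Sum.elim (splitEntry i y z μ) β := by
  funext h
  rcases h with j | ⟨v, t⟩
  · induction j using i.castSucc.succAboveCases with
    | x =>
      simp only [mergeEquiv, Equiv.coe_fn_mk, finSuccEquiv'_at, Sum.elim_inl, splitEntry,
        Fin.insertNth_apply_same]
      rfl
    | p j =>
      simp only [mergeEquiv, Equiv.coe_fn_mk, finSuccEquiv'_succAbove, Sum.elim_inl, splitEntry,
        Fin.insertNth_apply_succAbove]
      obtain rfl | hj := eq_or_ne j i
      · rw [if_pos rfl, Function.update_self]
        rfl
      · simp [hj]
  · rfl

theorem amplitude_merge [Fintype ι] (G : BWGraph m (k + 1)) (i : Fin k) (μ : Fin k → ι) :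
    amplitude Φ b (G.merge i) μ =
      ∑ r : ι × ι × ι, (Φ.copairing b (μ i) r.1 * Φ.vertex b r.1 r.2.1 r.2.2) •
        amplitude Φ b G (splitEntry i r.2.1 r.2.2 μ) := by
  simp only [amplitude, Finset.smul_sum]
  rw [← Fintype.sum_prod_type']
  refine (Fintype.sum_equiv (optionLabelEquiv G.V ι) _ _ ?_).symm
  rintro ⟨⟨x, y, z⟩, β⟩
  have hedge : edgeWeight Φ b (G.merge i) (Sum.elim μ (optionLabelEquiv G.V ι ((x, y, z), β))) =
      Φ.copairing b (μ i) x * edgeWeight Φ b G (Sum.elim (splitEntry i y z μ) β) := by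
    rw [edgeWeight_addEdge, label_mergeEquiv]
    rfl
  rw [hedge, leafWeight_addEdge, label_mergeEquiv, vertexWeight_optionLabelEquiv, smul_smul]
  congr 1
  ring

theorem amplitude_rotate [Fintype ι] (G : BWGraph m k) (μ : Fin k → ι) :
    amplitude Φ b G.rotate μ = amplitude Φ b G (μ ∘ finRotate k) := by
  refine Finset.sum_congr rfl fun β _ => ?_
  have h : Sum.elim μ β ∘ Equiv.sumCongr (finRotate k) (Equiv.refl (G.V × Fin 3)) =
      Sum.elim (μ ∘ finRotate k) β := by
    funext x
    rcases x with x | x <;> rfl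
  rw [← h, ← edgeWeight_relabel, ← leafWeight_relabel]

end Merge

section SplitEntry

variable {ι : Type}

theorem splitEntry_zero_cons (y z u : ι) (μ : Fin k → ι) :
    splitEntry 0 y z (Fin.cons u μ : Fin (k + 1) → ι) = Fin.cons y (Fin.cons z μ) := by
  rw [splitEntry, Fin.update_cons_zero, Fin.castSucc_zero, Fin.insertNth_zero]
  rfl

theorem splitEntry_succ_cons (i : Fin k) (y z u : ι) (μ : Fin k → ι) :
    splitEntry i.succ y z (Fin.cons u μ : Fin (k + 1) → ι) = Fin.cons u (splitEntry i y z μ) := by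
  rw [splitEntry, ← Fin.cons_update, ← Fin.succ_castSucc]
  exact Fin.insertNth_succ_cons _ _ _ _

theorem splitEntry_false_true (i : Fin k) :
    splitEntry i false true (fun _ => true) = oneAt i.castSucc := by
  rw [splitEntry, Function.update_eq_self, Fin.insertNth_eq_iff]
  exact ⟨by simp [oneAt], funext fun j => by simp [Fin.removeNth, oneAt, Fin.succAbove_ne]⟩

theorem splitEntry_true_false (i : Fin k) :
    splitEntry i true false (fun _ => true) = oneAt i.succ := by
  rw [splitEntry, Fin.insertNth_eq_iff]
  refine ⟨by simp [oneAt, Fin.castSucc_lt_succ.ne], funext fun j => ?_⟩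
  have hj : i.castSucc.succAbove j = i.succ ↔ j = i := by
    rw [← Fin.succAbove_castSucc_self i, Fin.succAbove_right_inj]
  by_cases h : j = i <;> simp [Fin.removeNth, oneAt, hj, h]

theorem oneAt_zero_comp_finRotate {p : ℕ} :
    oneAt (0 : Fin (p + 1)) ∘ finRotate (p + 1) = oneAt (Fin.last p) := by
  funext j
  have h : finRotate (p + 1) j = 0 ↔ j = Fin.last p := by
    rw [← Equiv.eq_symm_apply, finRotate_symm_zero]
  simp only [oneAt, Function.comp_apply, ne_eq, h]

theorem cons_oneAt_zero_comp_finRotate {p : ℕ} :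
    (Fin.cons false (oneAt (0 : Fin (p + 1))) : Fin (p + 2) → Bool) ∘ finRotate (p + 2) =
      Fin.cons false (oneAt (Fin.last p)) := by
  funext j
  induction j using Fin.lastCases with
  | last =>
    rw [Function.comp_apply, finRotate_last, Fin.cons_zero, ← Fin.succ_last, Fin.cons_succ]
    simp
  | cast i =>
    rw [Function.comp_apply, finRotate_apply, Fin.coeSucc_eq_succ, Fin.cons_succ]
    induction i using Fin.cases with
    | zero => simp
    | succ i => rw [← Fin.succ_castSucc, Fin.cons_succ]; simp [oneAt, Fin.castSucc_lt_last i |>.ne]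

end SplitEntry

/-! ### The coefficient of `1 ⊗ x ⊗ … ⊗ x` on Sullivan diagrams -/

section TopAmplitude

variable (R : Type*) [CommRing R]

/-- The coefficient of the tensor with labels `μ` in the action of a diagram on `R[x]/(x²)`. -/
abbrev Diagram.dualAmplitude (D : Diagram m k) (μ : Fin k → Bool) :
    MultilinearMap R (fun _ : Fin m => DualNumber R) R :=
  D.amplitude (dualFrobenius R) (dualBasis R) μ

theorem Diagram.dualAmplitude_rotate (D : Diagram m k) (μ : Fin k → Bool) :
    D.rotate.dualAmplitude R μ = D.dualAmplitude R (μ ∘ finRotate k) := by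
  induction D using Quot.ind with | mk G => ?_
  exact amplitude_rotate (dualFrobenius R) (dualBasis R) G μ

theorem Diagram.dualAmplitude_merge (D : Diagram m (k + 1)) (i : Fin k) (μ : Fin k → Bool) :
    (D.merge i).dualAmplitude R μ =
      if μ i then D.dualAmplitude R (splitEntry i false true μ) +
        D.dualAmplitude R (splitEntry i true false μ)
      else D.dualAmplitude R (splitEntry i false false μ) := by
  induction D using Quot.ind with | mk G => ?_
  change Sullivan.amplitude _ _ (G.merge i) μ =
    if μ i then Sullivan.amplitude _ _ G _ + Sullivan.amplitude _ _ G _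
    else Sullivan.amplitude _ _ G _
  rw [amplitude_merge]
  simp only [dualFrobenius_copairing, dualFrobenius_vertex, Fintype.sum_prod_type,
    Fintype.sum_bool]
  rcases μ i <;> simp [add_comm]

theorem Diagram.dualAmplitude_merge_true (D : Diagram m (k + 1)) (i : Fin k) :
    (D.merge i).dualAmplitude R (fun _ => true) =
      D.dualAmplitude R (oneAt i.castSucc) + D.dualAmplitude R (oneAt i.succ) := by
  rw [D.dualAmplitude_merge R, if_pos rfl, splitEntry_false_true, splitEntry_true_false]

theorem Diagram.dualAmplitude_merge_zero_oneAt (D : Diagram m (k + 2)) :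
    (D.merge 0).dualAmplitude R (oneAt 0) = D.dualAmplitude R (Fin.cons false (oneAt 0)) := by
  rw [D.dualAmplitude_merge R, if_neg (by simp), oneAt_zero, splitEntry_zero_cons]

theorem Diagram.dualAmplitude_merge_succ_oneAt (D : Diagram m (k + 2)) (i : Fin k) :
    (D.merge i.succ).dualAmplitude R (oneAt 0) =
      D.dualAmplitude R (Fin.cons false (oneAt i.castSucc)) +
        D.dualAmplitude R (Fin.cons false (oneAt i.succ)) := by
  rw [D.dualAmplitude_merge R, if_pos (by simp), oneAt_zero, splitEntry_succ_cons,
    splitEntry_succ_cons, splitEntry_false_true, splitEntry_true_false]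

/-- The coefficient of `1 ⊗ x ⊗ … ⊗ x` in the action of a chain of diagrams on `R[x]/(x²)`: the
label of the start half-edge is `1`, and all other labels are `x`. -/
def topAmplitude (p : ℕ) :
    (Gen m p →₀ R) →ₗ[R] MultilinearMap R (fun _ : Fin m => DualNumber R) R :=
  Finsupp.linearCombination R <|
    Sum.elim (fun D => D.dualAmplitude R (oneAt 0)) fun D => D.dualAmplitude R fun _ => true

theorem topAmplitude_boundaryGen (p : ℕ) (γ : Gen m (p + 1)) :
    topAmplitude R p (boundaryGen R p γ) = 0 := by
  rcases γ with D | D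
  · rw [boundaryGen.eq_def,
      ← sum_telescoping R fun i => D.dualAmplitude R (Fin.cons false (oneAt i))]
    simp only [topAmplitude, map_add, map_sum, Finsupp.linearCombination_single, Sum.elim_inl]
    rw [Fin.sum_univ_succ, D.dualAmplitude_merge_zero_oneAt R,
      D.rotate.dualAmplitude_merge_zero_oneAt R, D.dualAmplitude_rotate R,
      cons_oneAt_zero_comp_finRotate]
    simp only [D.dualAmplitude_merge_succ_oneAt R, Fin.val_zero, pow_zero, one_smul, Fin.val_succ]
  · rw [boundaryGen.eq_def, ← sum_telescoping R fun i => D.dualAmplitude R (oneAt i)]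
    simp only [topAmplitude, map_add, map_sum, Finsupp.linearCombination_single, Sum.elim_inl,
      Sum.elim_inr]
    rw [D.dualAmplitude_rotate R, oneAt_zero_comp_finRotate, one_smul]
    simp only [D.dualAmplitude_merge_true R]

theorem topAmplitude_boundary (p : ℕ) (c : Gen m (p + 1) →₀ R) :
    topAmplitude R p (boundary R (p + 1) c) = 0 := by
  have h : topAmplitude R p ∘ₗ
      (boundary R (p + 1) : (Gen m (p + 1) →₀ R) →ₗ[R] (Gen m p →₀ R)) = 0 :=
    Finsupp.lhom_ext' fun γ => LinearMap.ext_ring <| by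
      simpa [boundary] using topAmplitude_boundaryGen R p γ
  exact LinearMap.congr_fun h c

theorem BWGraph.HasStdLabel.topAmplitude_single {p : ℕ} {G : BWGraph m (p + 1)}
    (hG : G.HasStdLabel) (a : Fin m → DualNumber R) :
    topAmplitude R p (Finsupp.single (Sum.inl G.toDiagram) 1) a =
      ∏ j, TrivSqZeroExt.snd (a j) := by
  have hamp := hG.signedAmplitude_oneAt (fun _ => 1) a
  rw [signedAmplitude_one, Units.val_one, Int.cast_one, one_mul] at hamp
  rw [topAmplitude, Finsupp.linearCombination_single, one_smul]
  exact hamp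

theorem SD.isNonzeroClass_single [Nontrivial R] {n : ℕ} {G : BWGraph m (2 * (n + 1) + 1 + 1)}
    {v : Fin n → G.V} (hclosed : G.IsClosed) (hcomb : G.HasComb v (Sum.inl 0) (evenTooth n))
    (hlabel : G.HasStdLabel) :
    SD.IsNonzeroClass
      (Finsupp.single (Sum.inl G.toDiagram : Gen m (2 * (n + 1) + 1)) (1 : R)) := by
  refine ⟨⟨Submodule.subset_span ⟨_, Or.inl ⟨G, hclosed, rfl⟩, rfl⟩,
    hcomb.boundary_eq_zero R⟩, ?_⟩
  rintro ⟨c, -, hc⟩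
  have hzero := topAmplitude_boundary R _ c
  rw [hc] at hzero
  have hone := hlabel.topAmplitude_single R fun _ => xElt R
  rw [hzero] at hone
  simp at hone

end TopAmplitude

end Sullivan

end

theorem proposition3_general (R : Type*) [CommRing R] [Nontrivial R] (n : ℕ) :
    ((Sullivan.tGraph n).IsClosed ∧ (Sullivan.tGraph n).HasType (n + 1) 1) ∧
    ((Sullivan.muGraph n).IsClosed ∧ (Sullivan.muGraph n).HasType 0 (n + 2)) ∧
    Sullivan.dualAction R (Sullivan.tChain R n) (fun _ => Sullivan.xElt R) =
      Sullivan.RedChain.of R (DualNumber R) (Fin.cons 1 fun _ => Sullivan.xElt R) ∧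
    Sullivan.InducesNonzero (Sullivan.plainRotation R (DualNumber R))
      (Sullivan.dualAction R (Sullivan.tChain R n)) ∧
    Sullivan.InducesNonzeroTensor (Sullivan.plainRotation R (DualNumber R))
      (Sullivan.dualAction R (Sullivan.muChain R n)) ∧
    Sullivan.SD.IsNonzeroClass (Sullivan.tChain R n) ∧
    Sullivan.SD.IsNonzeroClass (Sullivan.muChain R n) ∧
    ∀ N : ℕ,
      (∀ s, Sullivan.InducesNonzero (Sullivan.sphereRotation R N)
        (Sullivan.signedAction R (Sullivan.tGraph n) s)) ∧
      (∀ s, Sullivan.InducesNonzeroTensor (Sullivan.sphereRotation R N)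
        (Sullivan.signedAction R (Sullivan.muGraph n) s)) := by
  have ht := Sullivan.tGraph_hasStdLabel n
  have hμ := Sullivan.muGraph_hasStdLabel n
  have hplain := Sullivan.plainRotation_isSphereLike (R := R)
  refine ⟨⟨Sullivan.tGraph_isClosed n, Sullivan.tGraph_hasType n⟩,
    ⟨Sullivan.muGraph_isClosed n, Sullivan.muGraph_hasType n⟩,
    (ht.dualAction_single _).trans (by simp [Sullivan.topChain]),
    (hplain.inducesNonzeroTensor 1 fun a => ?_).inducesNonzero,
    hplain.inducesNonzeroTensor 1 fun a => ?_,
    Sullivan.SD.isNonzeroClass_single R (Sullivan.tGraph_isClosed n)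
      (Sullivan.tGraph_hasComb_inl n) ht,
    Sullivan.SD.isNonzeroClass_single R (Sullivan.muGraph_isClosed n)
      (Sullivan.muGraph_hasComb n) hμ,
    fun N => ?_⟩
  · exact (ht.dualAction_single a).trans (by simp)
  · exact (hμ.dualAction_single a).trans (by simp)
  · have hsphere := Sullivan.sphereRotation_isSphereLike (R := R) N
    exact ⟨fun s => (hsphere.inducesNonzeroTensor _ (ht.signedAction_eq s)).inducesNonzero,
      fun s => hsphere.inducesNonzeroTensor _ (hμ.signedAction_eq s)⟩

/-- Here `g = n + 1 ≥ 1`. -/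
theorem proposition3 (n : ℕ) :
    -- the topological types of `t_g` and `μ_g`, all of whose leaves mark closed boundary components
    ((Sullivan.tGraph n).IsClosed ∧ (Sullivan.tGraph n).HasType (n + 1) 1) ∧
    ((Sullivan.muGraph n).IsClosed ∧ (Sullivan.muGraph n).HasType 0 (n + 2)) ∧
    -- `F(t_g ⊗ x) = 1 ⊗ x ⊗ … ⊗ x`
    Sullivan.dualAction ℤ (Sullivan.tChain ℤ n) (fun _ => Sullivan.xElt ℤ) =
      Sullivan.RedChain.of ℤ (DualNumber ℤ) (Fin.cons 1 fun _ => Sullivan.xElt ℤ) ∧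
    -- `t_g` induces a nonzero map on Hochschild homology, also rationally
    Sullivan.InducesNonzero (Sullivan.plainRotation ℤ (DualNumber ℤ))
      (Sullivan.dualAction ℤ (Sullivan.tChain ℤ n)) ∧
    Sullivan.InducesNonzero (Sullivan.plainRotation ℚ (DualNumber ℚ))
      (Sullivan.dualAction ℚ (Sullivan.tChain ℚ n)) ∧
    -- `μ_g` induces a nonzero map on Hochschild homology, also rationally
    Sullivan.InducesNonzeroTensor (Sullivan.plainRotation ℤ (DualNumber ℤ))
      (Sullivan.dualAction ℤ (Sullivan.muChain ℤ n)) ∧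
    Sullivan.InducesNonzeroTensor (Sullivan.plainRotation ℚ (DualNumber ℚ))
      (Sullivan.dualAction ℚ (Sullivan.muChain ℚ n)) ∧
    -- the homology classes of the Sullivan diagrams `t_g` and `μ_g` are nonzero, also rationally
    Sullivan.SD.IsNonzeroClass (Sullivan.tChain ℤ n) ∧
    Sullivan.SD.IsNonzeroClass (Sullivan.tChain ℚ n) ∧
    Sullivan.SD.IsNonzeroClass (Sullivan.muChain ℤ n) ∧
    Sullivan.SD.IsNonzeroClass (Sullivan.muChain ℚ n) ∧
    -- the operations on the Hochschild homology of the cohomology algebra of the sphere of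
    -- dimension `N` are nonzero, whatever the signs
    ∀ N : ℕ, 2 ≤ N →
      (∀ s, Sullivan.InducesNonzero (Sullivan.sphereRotation ℚ N)
        (Sullivan.signedAction ℚ (Sullivan.tGraph n) s)) ∧
      (∀ s, Sullivan.InducesNonzeroTensor (Sullivan.sphereRotation ℚ N)
        (Sullivan.signedAction ℚ (Sullivan.muGraph n) s)) := by
  obtain ⟨ht, hμ, hx, htZ, hμZ, ctZ, cμZ, -⟩ := proposition3_general ℤ n
  obtain ⟨-, -, -, htQ, hμQ, ctQ, cμQ, hS⟩ := proposition3_general ℚ n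
  exact ⟨ht, hμ, hx, htZ, htQ, hμZ, hμQ, ctZ, ctQ, cμZ, cμQ, fun N _ => hS N⟩
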